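/- There is a single randomized word-RAM program (a tester), given as input $n$, $d\ge 0$ and $\lceil 1/\epsilon\rceil$, where $0<\epsilon\le 1$, with oracle access to an unknown Boolean function $f:\{0,1\}^n\to\{0,1\}$ through black-box queries ($x\mapsto f(x)$) and random example queries (which return $(x,f(x))$ with $x$ drawn from an unknown distribution $\mathcal D$), such that for all $n,d,\epsilon$, every $f$ and every distribution $\mathcal D$ on $\{0,1\}^n$ the following holds. On every run the program makes at most $q=\tilde O(2^{2d}+2^d/\epsilon)$ queries (of both kinds together) and halts within time $2^{O(d)}+O(qn)$, and 1. if $f$ is computed by a decision tree of depth at most $d$, then the program accepts with probability at least $2/3$; 2. if $f$ is $\epsilon$-far with respect to $\mathcal D$ from every function computed by a decision tree of depth $O(\min(d^3,d^2+\log(1/\epsilon)))$, then the program rejects with probability at least $2/3$. Here $f$ is $\epsilon$-far from $g$ with respect to $\mathcal D$ if $\Pr_{x\sim\mathcal D}[f(x)\ne g(x)]>\epsilon$; $\tilde O(X)$ means $O(X(\log X)^k)$ for some constant $k$; all hidden constants are absolute. The word length may be any $w\ge\kappa\,(d+\log(n+1/\epsilon)+1)$ for an absolute constant $\kappa$; word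 arithmetic, comparisons, memory accesses, control steps and random bits cost one unit of time each, and each query costs $n+1$ units. -/

import Mathlib

noncomputable section

namespace DTTest

/-! ### Boolean functions and decision trees -/

/-- The cube `{0,1}^n`. -/
abbrev Cube (n : ℕ) : Type := Fin n → Bool

/-- Boolean functions on `{0,1}^n`. -/
abbrev BoolFun (n : ℕ) : Type := Cube n → Bool

/-- Decision trees over the variables `x_0, …, x_{n-1}`; in `node i l r` the left subtree `l` is taken
when `x_i = 0` and the right subtree `r` when `x_i = 1`. -/
inductive DecisionTree (n : ℕ) : Type where
  | leaf (b : Bool) : DecisionTree n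
  | node (i : Fin n) (l r : DecisionTree n) : DecisionTree n

/-- The function computed by a decision tree. -/
def DecisionTree.eval {n : ℕ} : DecisionTree n → BoolFun n
  | .leaf b, _ => b
  | .node i l r, x => if x i then r.eval x else l.eval x

/-- The depth of a decision tree: the largest number of edges on a path from the root to a leaf. -/
def DecisionTree.depth {n : ℕ} : DecisionTree n → ℕ
  | .leaf _ => 0
  | .node _ l r => max l.depth r.depth + 1

/-- The class of Boolean functions computed by decision trees of depth at most `d`. -/
def DT (n d : ℕ) : Set (BoolFun n) :=
  {f | ∃ T : DecisionTree n, T.depth ≤ d ∧ T.eval = f}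

/-- `Pr_{x ∼ D}[f x ≠ g x]`. -/
def disagreement {n : ℕ} (D : PMF (Cube n)) (f g : BoolFun n) : ENNReal :=
  D.toOuterMeasure {x | f x ≠ g x}

/-- `f` is `ε`-far (that is, not `ε`-close) from every function of `H` with respect to `D`. -/
def IsFarFrom {n : ℕ} (D : PMF (Cube n)) (ε : ℝ) (f : BoolFun n) (H : Set (BoolFun n)) : Prop :=
  ∀ g ∈ H, ENNReal.ofReal ε < disagreement D f g

/-! ### Randomized word RAM programs with black-box queries and random examples -/

/-- The arithmetic and comparison operations on machine words. -/
inductive WordOp : Type where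
  | add | sub | mul | div | mod | eq | lt

/-- Operations act on unsigned `w`-bit words, modulo `2^w`; comparisons return `1` or `0`. -/
def WordOp.apply {w : ℕ} : WordOp → BitVec w → BitVec w → BitVec w
  | .add, a, b => a + b
  | .sub, a, b => a - b
  | .mul, a, b => a * b
  | .div, a, b => a / b
  | .mod, a, b => a % b
  | .eq, a, b => if a = b then 1 else 0
  | .lt, a, b => if a < b then 1 else 0

/-- Structured programs of the word RAM. Registers are named by natural numbers fixed in the program
text, memory is addressed indirectly through registers. -/
inductive Prog : Type where
  /-- `reg r := k` -/
  | const (r k : ℕ) : Prog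
  /-- `reg r := o (reg a) (reg b)` -/
  | arith (o : WordOp) (r a b : ℕ) : Prog
  /-- `reg r := mem[reg a]` -/
  | load (r a : ℕ) : Prog
  /-- `mem[reg a] := reg r` -/
  | store (a r : ℕ) : Prog
  /-- `reg r :=` a fresh uniformly random bit -/
  | coin (r : ℕ) : Prog
  /-- black-box query: `reg r := f x`, where `x` is the bit vector stored in the `n` memory cells
  starting at address `reg a` (a cell stands for the bit `1` iff it is nonzero) -/
  | query (r a : ℕ) : Prog
  /-- random example query: a fresh `x ∼ D` is written to the `n` memory cells starting at address
  `reg a`, and `reg r := f x` -/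
  | sample (r a : ℕ) : Prog
  /-- sequential composition -/
  | seq (p₁ p₂ : Prog) : Prog
  /-- if `reg r ≠ 0` then `p₁` else `p₂` -/
  | branch (r : ℕ) (p₁ p₂ : Prog) : Prog
  /-- while `reg r ≠ 0` do `p` -/
  | loop (r : ℕ) (p : Prog) : Prog

/-- A configuration: the list of programs still to be executed, the registers, the memory, and the
time and the number of queries (of both kinds) used so far. The counters are not visible to the
program. -/
structure Config (w : ℕ) : Type where
  todo : List Prog
  reg : ℕ → BitVec w
  mem : BitVec w → BitVec w
  time : ℕ
  queries : ℕ

/-- The word that represents a bit. -/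
def bitWord (w : ℕ) (b : Bool) : BitVec w := if b then 1 else 0

/-- The bit vector stored in the `n` memory cells starting at address `a`. -/
def readVec {w : ℕ} (n : ℕ) (mem : BitVec w → BitVec w) (a : BitVec w) : Cube n :=
  fun i => decide (mem (a + BitVec.ofNat w i) ≠ 0)

/-- The memory after the bit vector `x` is written to the `n` cells starting at address `a`. -/
def writeVec {w n : ℕ} (mem : BitVec w → BitVec w) (a : BitVec w) (x : Cube n) :
    BitVec w → BitVec w :=
  fun j => if h : (j - a).toNat < n then bitWord w (x ⟨(j - a).toNat, h⟩) else mem j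

/-- One step of the machine with oracle access to `f` and to random examples drawn from `D`. Every
step costs one unit of time, except that a query of either kind costs `n + 1` units. A configuration
with nothing left to execute has halted. -/
def step {w n : ℕ} (f : BoolFun n) (D : PMF (Cube n)) (c : Config w) : PMF (Config w) :=
  match c.todo with
  | [] => PMF.pure c
  | .const r k :: ps => PMF.pure
      { c with todo := ps, reg := Function.update c.reg r (BitVec.ofNat w k), time := c.time + 1 }
  | .arith o r a b :: ps => PMF.pure
      { c with todo := ps, reg := Function.update c.reg r (o.apply (c.reg a) (c.reg b)),
               time := c.time + 1 }
  | .load r a :: ps => PMF.pure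
      { c with todo := ps, reg := Function.update c.reg r (c.mem (c.reg a)), time := c.time + 1 }
  | .store a r :: ps => PMF.pure
      { c with todo := ps, mem := Function.update c.mem (c.reg a) (c.reg r), time := c.time + 1 }
  | .coin r :: ps => (PMF.uniformOfFintype Bool).map fun b =>
      { c with todo := ps, reg := Function.update c.reg r (bitWord w b), time := c.time + 1 }
  | .query r a :: ps => PMF.pure
      { c with todo := ps,
               reg := Function.update c.reg r (bitWord w (f (readVec n c.mem (c.reg a)))),
               time := c.time + (n + 1), queries := c.queries + 1 }
  | .sample r a :: ps => D.map fun x =>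
      { todo := ps, reg := Function.update c.reg r (bitWord w (f x)),
        mem := writeVec c.mem (c.reg a) x,
        time := c.time + (n + 1), queries := c.queries + 1 }
  | .seq p₁ p₂ :: ps => PMF.pure { c with todo := p₁ :: p₂ :: ps, time := c.time + 1 }
  | .branch r p₁ p₂ :: ps => PMF.pure
      { c with todo := (if c.reg r ≠ 0 then p₁ else p₂) :: ps, time := c.time + 1 }
  | .loop r p :: ps => PMF.pure
      { c with todo := (if c.reg r ≠ 0 then p :: .loop r p :: ps else ps), time := c.time + 1 }

/-- The distribution of the configuration after `N` steps. -/
def run {w n : ℕ} (f : BoolFun n) (D : PMF (Cube n)) (c : Config w) : ℕ → PMF (Config w)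
  | 0 => PMF.pure c
  | N + 1 => (run f D c N).bind (step f D)

/-- The initial configuration: the input numbers stand in the first registers, all other registers
and all memory cells are zero. -/
def initial (w : ℕ) (p : Prog) (input : List ℕ) : Config w where
  todo := [p]
  reg := fun i => BitVec.ofNat w (input.getD i 0)
  mem := fun _ => 0
  time := 0
  queries := 0

/-- On every computation path of positive probability the machine halts, having made at most `Q`
queries and having used at most `T` units of time. -/
def RunsWithin {w n : ℕ} (f : BoolFun n) (D : PMF (Cube n)) (c : Config w) (Q T : ℝ) : Prop :=
  ∃ N : ℕ, ∀ c' ∈ (run f D c N).support,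
    c'.todo = [] ∧ (c'.queries : ℝ) ≤ Q ∧ (c'.time : ℝ) ≤ T

/-- The probability that the machine halts and accepts (register `0` is nonzero). -/
def acceptProb {w n : ℕ} (f : BoolFun n) (D : PMF (Cube n)) (c : Config w) : ENNReal :=
  ⨆ N : ℕ, (run f D c N).toOuterMeasure {c' | c'.todo = [] ∧ c'.reg 0 ≠ 0}

/-- The probability that the machine halts and rejects (register `0` is zero). -/
def rejectProb {w n : ℕ} (f : BoolFun n) (D : PMF (Cube n)) (c : Config w) : ENNReal :=
  ⨆ N : ℕ, (run f D c N).toOuterMeasure {c' | c'.todo = [] ∧ c'.reg 0 = 0}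

/-- The quantity `X · (log X)^k`, up to a constant factor, for `X = 2^{2d} + 2^d / ε`. -/
def queryBound (C k d : ℕ) (ε : ℝ) : ℝ :=
  C * (2 ^ (2 * d) + 2 ^ d / ε) * Real.log (2 ^ (2 * d) + 2 ^ d / ε) ^ k

/-- The depth `C · min(d^3, d^2 + log(1/ε))`, rounded down. -/
def depthBound (C d : ℕ) (ε : ℝ) : ℕ :=
  ⌊(C : ℝ) * min ((d : ℝ) ^ 3) ((d : ℝ) ^ 2 + Real.log (1 / ε))⌋₊

end DTTest

end

noncomputable section

namespace DTTest

/-! ### Refinement of probability distributions by machine configurations -/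

/-! Over the field with two elements a decision tree of depth d is a polynomial of degree at most d
(`polyDeg_tree`). To process an example x, the tester tries to discover the variables that the tree
queries on x. Variables are hashed into random blocks, and each variable carries a label: fixed to a
bit, free, or member of a class. With s classes, `classSum` adds up f over the 2^s values of the
classes. This is an s-fold derivative of f, so for a tree it has degree at most d - s
(`polyDeg_sum`).

One step evaluates `classSum` on 2^(d-s) * `rowFactor d` rows of a random table. If two rows differ,
binary search over hybrids of the two rows finds a block that matters, and the block becomes a new
class. If all rows agree and s = 0, the common value is compared with f(x). If they agree on 0 and s
> 0, the tester rejects. If they agree on 1, then for each class the sum over the other classes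
should be a literal in a single variable of the class; this is tested, the value of that variable at
x is read off, and the classes are fixed to the bits read. There are at most (d+1)^2 steps per
example.

Completeness. With probability at least 15/16 the hash separates the variables of the tree
(`blockOf_injOn`), and with probability at least 15/16 the table exposes every nonconstant class sum
that can occur (`goodTab_prob`). The latter is a union bound over sparse labellings: a nonzero
polynomial of degree r is nonzero on a fraction at least 2^(-r) of the points (`PolyDeg.card_le`).
Under both events every example is accepted surely (`walk_complete`). A class sum that is
identically 1 forces some class variable onto the path of x, since otherwise 2^s equal values would
add up to 0 (`WalkInv.exists_path`). So each reading fixes at least one new variable of the path,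
and there are at most d rounds of at most d + 1 steps. Never more than d classes arise, because a
d-fold derivative is constant.

Soundness holds for every hash and table and uses no property of f. Once these are drawn, the run is
the path of x in one decision tree `walkTree`, in which reading a class queries one variable. The
depth is at most (d+1)^2, because every class costs a step. The queried variable comes from an
analysis of the literal test in the style of linearity testing (`exists_literal`): for any function
φ there is a coordinate such that the test fails with probability at least 1/40 at each x where the
bit read differs from the coordinate. Hence an example at which the tree disagrees with f is
accepted with probability at most 39/40 (`walk_sound`). If f is ε-far from the tree, one example
passes with probability at most 1 - ε/40, and 80⌈1/ε⌉ examples all pass with probability at most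
exp(-2).

Cost. A class sum takes at most 2^s queries but the scan needs only a 2^(-s) fraction of the table,
so every step takes 2^d poly(d) queries.

The machine side is a small program logic: `Ref` says that a program, started in an abstract state,
ends in a state related to an outcome of a given distribution, with bounds on time and queries. Each
piece of code is related in this way to a mathematical process (`testerCode_spec`), and only that
process, `verdictP`, is analysed probabilistically. -/

/-- `Refines f D Φ c μ`: from the configuration `c` the machine reaches, after finitely many steps,
a configuration related by `Φ` to an outcome that is distributed according to `μ`. -/
inductive Refines {w n : ℕ} (f : BoolFun n) (D : PMF (Cube n)) {β : Type}
    (Φ : β → Config w → Prop) : Config w → PMF β → Prop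
  | here {b : β} {c : Config w} : Φ b c → Refines f D Φ c (PMF.pure b)
  | step {γ : Type} [Finite γ] {c : Config w} {ν : PMF γ} {k : γ → Config w} {μ : γ → PMF β} :
      step f D c = ν.map k → (∀ y, Refines f D Φ (k y) (μ y)) → Refines f D Φ c (ν.bind μ)

section Refinement

variable {w n : ℕ} {f : BoolFun n} {D : PMF (Cube n)} {β β' : Type}

theorem Refines.det {Φ : β → Config w → Prop} {c c' : Config w} {μ : PMF β}
    (h : DTTest.step f D c = PMF.pure c') (h' : Refines f D Φ c' μ) : Refines f D Φ c μ := by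
  have := Refines.step (f := f) (D := D) (Φ := Φ) (γ := Unit) (c := c) (ν := PMF.pure ())
    (k := fun _ => c') (μ := fun _ => μ) (by rw [h, PMF.pure_map]) (fun _ => h')
  rwa [PMF.pure_bind] at this

theorem Refines.bind {Φ : β → Config w → Prop} {Ψ : β' → Config w → Prop} {c : Config w}
    {μ : PMF β} {ν : β → PMF β'} (h : Refines f D Φ c μ)
    (h' : ∀ b c', Φ b c' → Refines f D Ψ c' (ν b)) : Refines f D Ψ c (μ.bind ν) := by
  induction h with
  | here hb => rw [PMF.pure_bind]; exact h' _ _ hb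
  | step hs _ ih => rw [PMF.bind_bind]; exact Refines.step hs ih

theorem Refines.step_self {γ : Type} [Finite γ] {Φ : γ → Config w → Prop} {c : Config w}
    {ν : PMF γ} {k : γ → Config w} (h : DTTest.step f D c = ν.map k) (h' : ∀ y, Φ y (k y)) :
    Refines f D Φ c ν := by
  have := Refines.step (μ := PMF.pure) h fun y => Refines.here (h' y)
  rwa [PMF.bind_pure] at this

theorem Refines.mono {Φ Ψ : β → Config w → Prop} {c : Config w} {μ : PMF β}
    (h : Refines f D Φ c μ) (h' : ∀ b c', Φ b c' → Ψ b c') : Refines f D Ψ c μ := by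
  have := h.bind (ν := PMF.pure) (Ψ := Ψ) (fun b c' hb => Refines.here (h' b c' hb))
  rwa [PMF.bind_pure] at this

/-- `run` appends steps at the end, whereas `Refines` unfolds a computation from its first step;
this reconciles the two. -/
theorem run_succ' (f : BoolFun n) (D : PMF (Cube n)) (c : Config w) (N : ℕ) :
    run f D c (N + 1) = (step f D c).bind fun c' => run f D c' N := by
  induction N with
  | zero => simp [run]
  | succ N ih =>
    rw [run, ih, PMF.bind_bind]
    rfl

theorem run_halted (f : BoolFun n) (D : PMF (Cube n)) {c : Config w} (h : c.todo = []) (N : ℕ) :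
    run f D c N = PMF.pure c := by
  induction N with
  | zero => rfl
  | succ N ih =>
    rw [run, ih, PMF.pure_bind]
    simp [step, h]

/-- If a configuration refines `μ` and every final configuration has halted, then after some number
of steps the machine has halted surely, and its final configuration is distributed as `μ` says. -/
theorem Refines.run {Φ : β → Config w → Prop} {c : Config w} {μ : PMF β} (h : Refines f D Φ c μ)
    (hΦ : ∀ b c', Φ b c' → c'.todo = []) :
    ∃ N, ∀ N' ≥ N, (∀ c' ∈ (run f D c N').support, ∃ b, Φ b c') ∧
      ∀ S : Set β, μ.toOuterMeasure S ≤
        (DTTest.run f D c N').toOuterMeasure {c' | ∃ b ∈ S, Φ b c'} := by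
  induction h with
  | @here b c hb =>
    refine ⟨0, fun N' _ => ?_⟩
    rw [run_halted f D (hΦ _ _ hb)]
    refine ⟨fun c' hc' => ?_, fun S => ?_⟩
    · rw [PMF.support_pure, Set.mem_singleton_iff] at hc'
      exact ⟨b, hc' ▸ hb⟩
    · rw [PMF.toOuterMeasure_pure_apply, PMF.toOuterMeasure_pure_apply]
      by_cases hS : b ∈ S
      · rw [if_pos hS, if_pos]
        exact ⟨b, hS, hb⟩
      · rw [if_neg hS]
        exact zero_le
  | @step γ _ c ν k μ hs _ ih =>
    choose N hN using ih
    -- A random step has finitely many outcomes, so the running times of the branches have a common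
    -- bound. A branch that halts earlier keeps its configuration.
    obtain ⟨M, hM⟩ := (Set.finite_range N).bddAbove
    refine ⟨M + 1, fun N' hN' => ?_⟩
    obtain ⟨N'', rfl⟩ : ∃ N'', N' = N'' + 1 := ⟨N' - 1, by omega⟩
    have hle : ∀ y, N y ≤ N'' := fun y => by
      have := hM (Set.mem_range_self y)
      omega
    have hrun : DTTest.run f D c (N'' + 1) = ν.bind fun y => DTTest.run f D (k y) N'' := by
      rw [run_succ', hs, PMF.bind_map]
      rfl
    rw [hrun]
    refine ⟨fun c' hc' => ?_, fun S => ?_⟩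
    · rw [PMF.mem_support_bind_iff] at hc'
      obtain ⟨y, _, hy⟩ := hc'
      exact (hN y N'' (hle y)).1 c' hy
    · rw [PMF.toOuterMeasure_bind_apply, PMF.toOuterMeasure_bind_apply]
      exact ENNReal.tsum_le_tsum fun y => by gcongr; exact (hN y N'' (hle y)).2 S

end Refinement

/-! ### Abstract states and expressions -/

/-- The part of a configuration that programs below refer to: the first registers, and the memory
cut into rows of length `n`. -/
@[ext] structure AbsState : Type where
  v : ℕ → ℕ
  a : ℕ → ℕ → ℕ

/-- Assign the value `x` to the register `r`. -/
def AbsState.set (σ : AbsState) (r x : ℕ) : AbsState := { σ with v := Function.update σ.v r x }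

/-- Write the value `x` to the cell `i` of the row `k`. -/
def AbsState.put (σ : AbsState) (k i x : ℕ) : AbsState :=
  { σ with a := Function.update σ.a k (Function.update (σ.a k) i x) }

@[simp] theorem AbsState.set_a (σ : AbsState) (r x : ℕ) : (σ.set r x).a = σ.a := rfl
@[simp] theorem AbsState.put_v (σ : AbsState) (k i x : ℕ) : (σ.put k i x).v = σ.v := rfl

theorem AbsState.set_v (σ : AbsState) (r x s : ℕ) :
    (σ.set r x).v s = if s = r then x else σ.v s := by
  simp [AbsState.set, Function.update_apply]

theorem AbsState.put_a (σ : AbsState) (k i x k' i' : ℕ) :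
    (σ.put k i x).a k' i' = if k' = k ∧ i' = i then x else σ.a k' i' := by
  by_cases hk : k' = k
  · subst hk
    simp [AbsState.put, Function.update_apply]
  · simp [AbsState.put, hk]

/-- The number of registers available to programs; the registers above it hold temporaries. -/
def numRegs : ℕ := 64

/-- The abstract state of a configuration. -/
def Config.view {w : ℕ} (n : ℕ) (c : Config w) : AbsState where
  v r := if r < numRegs then (c.reg r).toNat else 0
  a k i := if i < n ∧ (k + 1) * n ≤ 2 ^ w then (c.mem (BitVec.ofNat w (k * n + i))).toNat else 0

/-- Expressions over registers and memory rows. -/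
inductive Expr : Type where
  | v (r : ℕ) : Expr
  | c (k : ℕ) : Expr
  | op (o : WordOp) (e₁ e₂ : Expr) : Expr
  | get (k i : Expr) : Expr

instance : Add Expr := ⟨.op .add⟩
instance : Mul Expr := ⟨.op .mul⟩
instance : Div Expr := ⟨.op .div⟩
instance : Mod Expr := ⟨.op .mod⟩

/-- The operations on natural numbers. -/
def WordOp.natApply : WordOp → ℕ → ℕ → ℕ
  | .add, a, b => a + b
  | .sub, a, b => a - b
  | .mul, a, b => a * b
  | .div, a, b => a / b
  | .mod, a, b => a % b
  | .eq, a, b => if a = b then 1 else 0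
  | .lt, a, b => if a < b then 1 else 0

/-- No overflow occurs. -/
def WordOp.Fits (w : ℕ) : WordOp → ℕ → ℕ → Prop
  | .add, a, b => a + b < 2 ^ w
  | .sub, a, b => b ≤ a
  | .mul, a, b => a * b < 2 ^ w
  | _, _, _ => True

/-- The value of an expression. -/
def Expr.eval (σ : AbsState) : Expr → ℕ
  | .v r => σ.v r
  | .c k => k
  | .op o e₁ e₂ => o.natApply (e₁.eval σ) (e₂.eval σ)
  | .get k i => σ.a (k.eval σ) (i.eval σ)

/-- The machine evaluates the expression correctly. -/
def Expr.Ok (w n : ℕ) (σ : AbsState) : Expr → Prop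
  | .v r => r < numRegs
  | .c k => k < 2 ^ w
  | .op o e₁ e₂ => e₁.Ok w n σ ∧ e₂.Ok w n σ ∧ o.Fits w (e₁.eval σ) (e₂.eval σ)
  | .get k i => k.Ok w n σ ∧ i.Ok w n σ ∧ i.eval σ < n ∧ (k.eval σ + 1) * n ≤ 2 ^ w ∧ σ.v 0 = n

/-- Code that computes an expression into the register `t`. -/
def Expr.code : Expr → ℕ → Prog
  | .v r, t => .seq (.const (t + 1) 0) (.arith .add t r (t + 1))
  | .c k, t => .const t k
  | .op o e₁ e₂, t => .seq (e₁.code t) (.seq (e₂.code (t + 1)) (.arith o t t (t + 1)))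
  | .get k i, t => .seq (k.code t) (.seq (i.code (t + 1))
      (.seq (.arith .mul t t 0) (.seq (.arith .add t t (t + 1)) (.load t t))))

/-- The running time of that code. -/
def Expr.cost : Expr → ℕ
  | .v _ => 3
  | .c _ => 1
  | .op _ e₁ e₂ => e₁.cost + e₂.cost + 3
  | .get k i => k.cost + i.cost + 7

theorem numRegs_pos : 0 < numRegs := by simp [numRegs]

theorem WordOp.toNat_apply {w : ℕ} (hw : 0 < w) (o : WordOp) (a b : BitVec w)
    (h : o.Fits w a.toNat b.toNat) : (o.apply a b).toNat = o.natApply a.toNat b.toNat := by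
  have h1 : 1 < 2 ^ w := Nat.one_lt_two_pow hw.ne'
  cases o with
  | add => simpa [WordOp.apply, WordOp.natApply] using Nat.mod_eq_of_lt h
  | sub => exact BitVec.toNat_sub_of_le (BitVec.le_def.2 h)
  | mul => simpa [WordOp.apply, WordOp.natApply] using Nat.mod_eq_of_lt h
  | div => simp [WordOp.apply, WordOp.natApply]
  | mod => simp [WordOp.apply, WordOp.natApply]
  | eq =>
    simp only [WordOp.apply, WordOp.natApply, BitVec.toNat_inj]
    split_ifs <;> simp [Nat.mod_eq_of_lt h1]
  | lt =>
    simp only [WordOp.apply, WordOp.natApply, BitVec.lt_def]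
    split_ifs <;> simp [Nat.mod_eq_of_lt h1]

/-- Code for expressions writes only to temporaries, which the abstract state does not show, so
evaluation leaves the abstract state alone. -/
theorem Config.view_congr {w n : ℕ} {c c' : Config w} (hr : ∀ r < numRegs, c'.reg r = c.reg r)
    (hm : c'.mem = c.mem) : c'.view n = c.view n := by
  ext r i
  · simp only [Config.view]
    split_ifs with h
    · rw [hr r h]
    · rfl
  · simp only [Config.view, hm]

theorem Config.view_reg {w n : ℕ} (c : Config w) {r : ℕ} (hr : r < numRegs) :
    (c.view n).v r = (c.reg r).toNat := by
  simp [Config.view, hr]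

theorem Config.view_mem {w n : ℕ} (c : Config w) {k i : ℕ} (hi : i < n)
    (hk : (k + 1) * n ≤ 2 ^ w) :
    (c.view n).a k i = (c.mem (BitVec.ofNat w (k * n + i))).toNat := by
  simp [Config.view, hi, hk]

theorem row_add_lt {w n k i : ℕ} (hi : i < n) (hk : (k + 1) * n ≤ 2 ^ w) : k * n + i < 2 ^ w := by
  rw [add_mul, one_mul] at hk
  omega

/-- The continuation form lets evaluations be chained without naming intermediate distributions.
Registers below `t` survive, so the first operand, held in `t`, is still there after the second has
been computed with temporaries from `t + 1` on. -/
theorem Expr.refines_code {w n : ℕ} {f : BoolFun n} {D : PMF (Cube n)} (hw : 0 < w) {β : Type}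
    {Φ : β → Config w → Prop} {μ : PMF β} (e : Expr) :
    ∀ (t : ℕ) (c : Config w) (ps : List Prog), numRegs ≤ t → c.todo = e.code t :: ps →
      e.Ok w n (c.view n) →
      (∀ c' : Config w, c'.todo = ps → c'.mem = c.mem → (∀ r < t, c'.reg r = c.reg r) →
        (c'.reg t).toNat = e.eval (c.view n) → c'.time = c.time + e.cost →
        c'.queries = c.queries → Refines f D Φ c' μ) →
      Refines f D Φ c μ := by
  induction e with
  | v r =>
    intro t c ps ht hc hok hk
    refine Refines.det (by simp only [step, hc, Expr.code]; rfl) ?_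
    refine Refines.det (by simp only [step]; rfl) ?_
    refine Refines.det (by simp only [step]; rfl) ?_
    have hr : r < numRegs := hok
    refine hk _ rfl rfl (fun s hs => ?_) ?_ (by simp [Expr.cost]) rfl
    · simp [Function.update_of_ne (show s ≠ t by omega),
        Function.update_of_ne (show s ≠ t + 1 by omega)]
    · have h1 : r ≠ t + 1 := by omega
      simp [Function.update_of_ne h1, WordOp.apply, Expr.eval, Config.view_reg _ hr]
  | c k =>
    intro t c ps ht hc hok hk
    refine Refines.det (by simp only [step, hc, Expr.code]; rfl) ?_
    refine hk _ rfl rfl (fun s hs => ?_) ?_ (by simp [Expr.cost]) rfl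
    · simp [Function.update_of_ne (show s ≠ t by omega)]
    · simpa [Expr.eval] using Nat.mod_eq_of_lt hok
  | op o e₁ e₂ ih₁ ih₂ =>
    intro t c ps ht hc hok hk
    refine Refines.det (by simp only [step, hc, Expr.code]; rfl) ?_
    refine ih₁ t _ _ ht rfl hok.1 ?_
    intro c₁ hc₁ hm₁ hr₁ hv₁ ht₁ hq₁
    have hview₁ : c₁.view n = c.view n :=
      Config.view_congr (fun r hr => hr₁ r (by omega)) hm₁
    refine Refines.det (by simp only [step, hc₁]; rfl) ?_
    refine ih₂ (t + 1) _ _ (by omega) rfl (by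
      show e₂.Ok w n (c₁.view n)
      rw [hview₁]; exact hok.2.1) ?_
    intro c₂ hc₂ hm₂ hr₂ hv₂ ht₂ hq₂
    refine Refines.det (by simp only [step, hc₂]; rfl) ?_
    have hv₂' : (c₂.reg (t + 1)).toNat = e₂.eval (c.view n) := by
      rw [hv₂, ← hview₁]; rfl
    have hv₁' : (c₂.reg t).toNat = e₁.eval (c.view n) := by
      rw [hr₂ t (by omega)]; exact hv₁
    refine hk _ rfl (by simp [hm₂, hm₁]) (fun s hs => ?_) ?_ ?_ ?_
    · simp only [Function.update_of_ne (show s ≠ t by omega)]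
      rw [hr₂ s (by omega)]
      exact hr₁ s hs
    · simp only [Function.update_self]
      rw [WordOp.toNat_apply hw _ _ _ (by rw [hv₁', hv₂']; exact hok.2.2), hv₁', hv₂']
      rfl
    · simp only [ht₂, ht₁, Expr.cost]; ring
    · simp only [hq₂, hq₁]
  | get k i ihk ihi =>
    intro t c ps ht hc hok hkk
    obtain ⟨hok₁, hok₂, hi, hk, h0⟩ := hok
    refine Refines.det (by simp only [step, hc, Expr.code]; rfl) ?_
    refine ihk t _ _ ht rfl hok₁ ?_
    intro c₁ hc₁ hm₁ hr₁ hv₁ ht₁ hq₁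
    have hview₁ : c₁.view n = c.view n :=
      Config.view_congr (fun r hr => hr₁ r (by omega)) hm₁
    refine Refines.det (by simp only [step, hc₁]; rfl) ?_
    refine ihi (t + 1) _ _ (by omega) rfl (by
      show i.Ok w n (c₁.view n)
      rw [hview₁]; exact hok₂) ?_
    intro c₂ hc₂ hm₂ hr₂ hv₂ ht₂ hq₂
    have hv₂' : (c₂.reg (t + 1)).toNat = i.eval (c.view n) := by
      rw [hv₂, ← hview₁]; rfl
    have hv₁' : (c₂.reg t).toNat = k.eval (c.view n) := by
      rw [hr₂ t (by omega)]; exact hv₁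
    have h0' : (c₂.reg 0).toNat = n := by
      have hp := numRegs_pos
      rw [hr₂ 0 (by omega), ← h0, Config.view_reg _ hp]
      exact congrArg _ (hr₁ 0 (by omega))
    have hne : t + 1 ≠ t := by omega
    have hlt := row_add_lt hi hk
    have hmul : (c₂.reg t * c₂.reg 0).toNat = k.eval (c.view n) * n := by
      rw [BitVec.toNat_mul, hv₁', h0', Nat.mod_eq_of_lt (by omega)]
    have haddr : (c₂.reg t * c₂.reg 0 + c₂.reg (t + 1)) =
        BitVec.ofNat w (k.eval (c.view n) * n + i.eval (c.view n)) := by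
      apply BitVec.eq_of_toNat_eq
      rw [BitVec.toNat_add, hmul, hv₂', BitVec.toNat_ofNat]
    refine Refines.det (by simp only [step, hc₂]; rfl) ?_
    refine Refines.det (by simp only [step]; rfl) ?_
    refine Refines.det (by simp only [step]; rfl) ?_
    refine Refines.det (by simp only [step]; rfl) ?_
    refine Refines.det (by simp only [step]; rfl) ?_
    refine hkk _ rfl (by simp [hm₂, hm₁]) (fun s hs => ?_) ?_ ?_ ?_
    · simp only [Function.update_of_ne (show s ≠ t by omega)]
      rw [hr₂ s (by omega)]
      exact hr₁ s hs
    · simp only [Function.update_self, WordOp.apply, Function.update_of_ne hne]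
      rw [haddr, hm₂]
      simp only [hm₁, Expr.eval]
      rw [Config.view_mem _ hi hk]
    · simp only [ht₂, ht₁, Expr.cost]; ring
    · simp only [hq₂, hq₁]

/-! ### A program logic -/

/-- Started in the abstract state `σ`, the program `p` ends after time at most `T` and at most `Q`
queries in a state related by `R` to an outcome that is distributed according to `μ`. -/
def Ref (w : ℕ) {n : ℕ} (f : BoolFun n) (D : PMF (Cube n)) {β : Type} (p : Prog) (σ : AbsState)
    (μ : PMF β) (R : β → AbsState → Prop) (T Q : ℕ) : Prop :=
  ∀ (c : Config w) (ps : List Prog), c.todo = p :: ps → c.view n = σ →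
    Refines f D (fun b c' => c'.todo = ps ∧ R b (c'.view n) ∧ c'.time ≤ c.time + T ∧
      c'.queries ≤ c.queries + Q) c μ

/-- `Ref` for programs without random choices. -/
abbrev Det (w : ℕ) {n : ℕ} (f : BoolFun n) (D : PMF (Cube n)) (p : Prog) (σ : AbsState)
    (R : AbsState → Prop) (T Q : ℕ) : Prop :=
  Ref w f D p σ (PMF.pure ()) (fun _ => R) T Q

infixr:60 " ;; " => Prog.seq

/-- `reg r := e` -/
def assign (r : ℕ) (e : Expr) : Prog :=
  e.code numRegs ;; .const (numRegs + 1) 0 ;; .arith .add r numRegs (numRegs + 1)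

/-- Write the value of `e` to the cell `I` of the row `K`. -/
def put (K I e : Expr) : Prog :=
  e.code numRegs ;; K.code (numRegs + 1) ;; I.code (numRegs + 2) ;;
    .arith .mul (numRegs + 1) (numRegs + 1) 0 ;;
    .arith .add (numRegs + 1) (numRegs + 1) (numRegs + 2) ;; .store (numRegs + 1) numRegs

/-- Black-box query at the row `K`. -/
def queryRow (r : ℕ) (K : Expr) : Prog :=
  K.code numRegs ;; .arith .mul numRegs numRegs 0 ;; .query r numRegs

/-- Random example query into the row `K`. -/
def sampleRow (r : ℕ) (K : Expr) : Prog :=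
  K.code numRegs ;; .arith .mul numRegs numRegs 0 ;; .sample r numRegs

/-- Conditional statement. -/
def cond (e : Expr) (p q : Prog) : Prog := e.code numRegs ;; .branch numRegs p q

/-- `for i = 0, …, b - 1 do p`, where the bound is the content of the register `b`. -/
def forLoop (i b : ℕ) (p : Prog) : Prog :=
  assign i (.c 0) ;; (Expr.op .lt (.v i) (.v b)).code numRegs ;;
    .loop numRegs (p ;; assign i (.v i + .c 1) ;; (Expr.op .lt (.v i) (.v b)).code numRegs)

/-- The distribution of the result of `m` steps, numbered from `k`, of a random process. -/
def loopP {β : Type} (ν : ℕ → β → PMF β) : ℕ → ℕ → β → PMF β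
  | _, 0, x => PMF.pure x
  | k, m + 1, x => (ν k x).bind (loopP ν (k + 1) m)

/-- Replace the row `k`. -/
def AbsState.setRow (σ : AbsState) (k : ℕ) (g : ℕ → ℕ) : AbsState :=
  { σ with a := Function.update σ.a k g }

@[simp] theorem AbsState.setRow_v (σ : AbsState) (k : ℕ) (g : ℕ → ℕ) : (σ.setRow k g).v = σ.v := rfl

theorem AbsState.setRow_a (σ : AbsState) (k : ℕ) (g : ℕ → ℕ) (k' : ℕ) :
    (σ.setRow k g).a k' = if k' = k then g else σ.a k' := by
  simp [AbsState.setRow, Function.update_apply]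

section Rules

variable {w n : ℕ} {f : BoolFun n} {D : PMF (Cube n)} {β β' : Type} {p q : Prog} {σ : AbsState}
  {μ : PMF β} {R : β → AbsState → Prop} {T T' Q Q' : ℕ}

theorem Ref.weaken {R' : β → AbsState → Prop} (h : Ref w f D p σ μ R T Q)
    (hT : T ≤ T') (hQ : Q ≤ Q') (hR : ∀ b σ', R b σ' → R' b σ') : Ref w f D p σ μ R' T' Q' := by
  intro c ps hc hv
  refine (h c ps hc hv).mono ?_
  rintro b c' ⟨h1, h2, h3, h4⟩
  exact ⟨h1, hR _ _ h2, by omega, by omega⟩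

theorem Ref.bound (h : Ref w f D p σ μ R T Q) (hT : T ≤ T') (hQ : Q ≤ Q') :
    Ref w f D p σ μ R T' Q' :=
  h.weaken hT hQ fun _ _ h => h

theorem Ref.map {R' : β' → AbsState → Prop} (h : Ref w f D p σ μ R T Q) (g : β → β')
    (hR : ∀ b σ', R b σ' → R' (g b) σ') : Ref w f D p σ (μ.map g) R' T Q := by
  intro c ps hc hv
  refine (h c ps hc hv).bind ?_
  rintro b c' ⟨h1, h2, h3, h4⟩
  exact Refines.here ⟨h1, hR _ _ h2, h3, h4⟩

theorem Ref.seq {R' : β' → AbsState → Prop} {ν : β → PMF β'} (h : Ref w f D p σ μ R T Q)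
    (h' : ∀ b σ', R b σ' → Ref w f D q σ' (ν b) R' T' Q') :
    Ref w f D (p ;; q) σ (μ.bind ν) R' (T + T' + 1) (Q + Q') := by
  intro c ps hc hv
  refine Refines.det (by simp only [step, hc]; rfl) ?_
  refine (h _ _ rfl (by exact hv)).bind ?_
  rintro b c' ⟨h1, h2, h3, h4⟩
  refine (h' b _ h2 c' ps h1 rfl).mono ?_
  rintro b' c'' ⟨h1', h2', h3', h4'⟩
  simp only at h3 h4
  exact ⟨h1', h2', by omega, by omega⟩

theorem Det.seq {R : AbsState → Prop} {R' : β → AbsState → Prop} (h : Det w f D p σ R T Q)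
    (h' : ∀ σ', R σ' → Ref w f D q σ' μ R' T' Q') :
    Ref w f D (p ;; q) σ μ R' (T + T' + 1) (Q + Q') := by
  have := Ref.seq (ν := fun _ => μ) h (fun _ σ' hσ => h' σ' hσ)
  rwa [PMF.pure_bind] at this

theorem Config.view_set {c : Config w} {r x : ℕ} (hr : r < numRegs) (b : BitVec w)
    (hb : b.toNat = x) {reg : ℕ → BitVec w}
    (hreg : ∀ s < numRegs, reg s = if s = r then b else c.reg s) (t : List Prog) (τ q : ℕ) :
    Config.view n { c with todo := t, reg := reg, time := τ, queries := q } =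
      (c.view n).set r x := by
  ext s i
  · rw [AbsState.set_v]
    simp only [Config.view]
    by_cases hs : s < numRegs
    · rw [if_pos hs, hreg s hs]
      by_cases hsr : s = r
      · simp [hsr, hb]
      · simp [hsr, hs]
    · rw [if_neg hs, if_neg (by omega), if_neg hs]
  · rfl

theorem Det.assign (hw : 0 < w) {r : ℕ} {e : Expr} (hr : r < numRegs) (he : e.Ok w n σ) :
    Det w f D (assign r e) σ (fun σ' => σ' = σ.set r (e.eval σ)) (e.cost + 4) 0 := by
  intro c ps hc hv
  refine Refines.det (by simp only [step, hc, DTTest.assign]; rfl) ?_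
  refine e.refines_code hw numRegs _ _ le_rfl rfl (by show e.Ok w n (c.view n); rwa [hv]) ?_
  intro c₁ hc₁ hm₁ hr₁ hv₁ ht₁ hq₁
  refine Refines.det (by simp only [step, hc₁]; rfl) ?_
  refine Refines.det (by simp only [step]; rfl) ?_
  refine Refines.det (by simp only [step]; rfl) ?_
  have hview : c₁.view n = σ := by
    rw [← hv]
    exact Config.view_congr (fun r hr => hr₁ r hr) hm₁
  refine Refines.here ⟨rfl, ?_, ?_, ?_⟩
  · rw [← hview]
    refine Config.view_set hr (c₁.reg numRegs) ?_ ?_ _ _ _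
    · rw [hv₁, hview, ← hv]; rfl
    · intro s hs
      by_cases hsr : s = r
      · subst hsr
        simp [WordOp.apply, numRegs]
      · simp [hsr, Function.update_of_ne (show s ≠ numRegs + 1 by omega)]
  · simp only [ht₁]; omega
  · simp only [hq₁]; omega

theorem Ref.assign_seq (hw : 0 < w) {r : ℕ} {e : Expr} (hr : r < numRegs) (he : e.Ok w n σ)
    (h : Ref w f D p (σ.set r (e.eval σ)) μ R T Q) :
    Ref w f D (DTTest.assign r e ;; p) σ μ R (e.cost + 4 + T + 1) (0 + Q) :=
  Det.seq (Det.assign hw hr he) fun _ hσ => hσ ▸ h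

/-- The guard `(k + 1) * n ≤ 2 ^ w` in `Config.view` exists for this: rows that fit do not wrap
around, so an address determines its row and cell by division with remainder. -/
theorem ofNat_row_inj {k i K I : ℕ} (hi : i < n) (hI : I < n) (hk : (k + 1) * n ≤ 2 ^ w)
    (hK : (K + 1) * n ≤ 2 ^ w) (h : BitVec.ofNat w (k * n + i) = BitVec.ofNat w (K * n + I)) :
    k = K ∧ i = I := by
  have h' := congrArg BitVec.toNat h
  rw [BitVec.toNat_ofNat, BitVec.toNat_ofNat, Nat.mod_eq_of_lt (row_add_lt hi hk),
    Nat.mod_eq_of_lt (row_add_lt hI hK)] at h'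
  have h1 : (k * n + i) / n = k := by
    rw [mul_comm, Nat.mul_add_div (by omega), Nat.div_eq_of_lt hi, add_zero]
  have h2 : (K * n + I) / n = K := by
    rw [mul_comm, Nat.mul_add_div (by omega), Nat.div_eq_of_lt hI, add_zero]
  have hkK : k = K := by rw [← h1, ← h2, h']
  subst hkK
  exact ⟨rfl, by omega⟩

theorem Det.put (hw : 0 < w) {K I e : Expr} (he : e.Ok w n σ) (hKo : K.Ok w n σ) (hIo : I.Ok w n σ)
    (hI : I.eval σ < n) (hK : (K.eval σ + 1) * n ≤ 2 ^ w) (h0 : σ.v 0 = n) :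
    Det w f D (DTTest.put K I e) σ (fun σ' => σ' = σ.put (K.eval σ) (I.eval σ) (e.eval σ))
      (e.cost + K.cost + I.cost + 8) 0 := by
  intro c ps hc hv
  refine Refines.det (by simp only [step, hc, DTTest.put]; rfl) ?_
  refine e.refines_code hw numRegs _ _ le_rfl rfl (by show e.Ok w n (c.view n); rwa [hv]) ?_
  intro c₁ hc₁ hm₁ hr₁ hv₁ ht₁ hq₁
  have hview₁ : c₁.view n = σ := by
    rw [← hv]
    exact Config.view_congr (fun r hr => hr₁ r hr) hm₁
  refine Refines.det (by simp only [step, hc₁]; rfl) ?_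
  refine K.refines_code hw (numRegs + 1) _ _ (by omega) rfl
    (by show K.Ok w n (c₁.view n); rwa [hview₁]) ?_
  intro c₂ hc₂ hm₂ hr₂ hv₂ ht₂ hq₂
  have hview₂ : c₂.view n = σ := by
    rw [← hview₁]
    exact Config.view_congr (fun r hr => hr₂ r (by omega)) hm₂
  refine Refines.det (by simp only [step, hc₂]; rfl) ?_
  refine I.refines_code hw (numRegs + 2) _ _ (by omega) rfl
    (by show I.Ok w n (c₂.view n); rwa [hview₂]) ?_
  intro c₃ hc₃ hm₃ hr₃ hv₃ ht₃ hq₃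
  have hview₃ : c₃.view n = σ := by
    rw [← hview₂]
    exact Config.view_congr (fun r hr => hr₃ r (by omega)) hm₃
  refine Refines.det (by simp only [step, hc₃]; rfl) ?_
  refine Refines.det (by simp only [step]; rfl) ?_
  refine Refines.det (by simp only [step]; rfl) ?_
  refine Refines.det (by simp only [step]; rfl) ?_
  refine Refines.det (by simp only [step]; rfl) ?_
  have e₁ : (c₃.reg numRegs).toNat = e.eval σ := by
    rw [hr₃ numRegs (by omega)]
    show (c₂.reg numRegs).toNat = _
    rw [hr₂ numRegs (by omega), ← hv]
    exact hv₁
  have e₂ : (c₃.reg (numRegs + 1)).toNat = K.eval σ := by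
    rw [hr₃ _ (by omega), ← hview₁]
    exact hv₂
  have e₃ : (c₃.reg (numRegs + 2)).toNat = I.eval σ := by
    rw [← hview₂]
    exact hv₃
  have e₀ : (c₃.reg 0).toNat = n := by
    rw [← h0, ← hview₃, Config.view_reg _ numRegs_pos]
  have haddr : c₃.reg (numRegs + 1) * c₃.reg 0 + c₃.reg (numRegs + 2) =
      BitVec.ofNat w (K.eval σ * n + I.eval σ) := by
    apply BitVec.eq_of_toNat_eq
    have hlt := row_add_lt hI hK
    rw [BitVec.toNat_add, BitVec.toNat_mul, e₂, e₃, e₀, BitVec.toNat_ofNat,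
      Nat.mod_eq_of_lt (a := K.eval σ * n) (by omega)]
  refine Refines.here ⟨rfl, ?_, ?_, ?_⟩
  · ext s i
    · rw [AbsState.put_v, ← hview₃]
      simp only [Config.view]
      split_ifs with hs
      · simp [Function.update_of_ne (show s ≠ numRegs + 1 by omega)]
      · rfl
    · rw [AbsState.put_a]
      have hn1 : numRegs ≠ numRegs + 1 := by omega
      have hn2 : numRegs + 2 ≠ numRegs + 1 := by omega
      simp only [Config.view, WordOp.apply, Function.update_self, Function.update_of_ne hn1,
        Function.update_of_ne hn2, haddr]
      by_cases hi : i < n ∧ (s + 1) * n ≤ 2 ^ w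
      · rw [if_pos hi, Function.update_apply]
        by_cases hsi : s = K.eval σ ∧ i = I.eval σ
        · rw [if_pos hsi, hsi.1, hsi.2, if_pos rfl, e₁]
        · rw [if_neg hsi, if_neg, ← hview₃, Config.view_mem _ hi.1 hi.2]
          intro h
          exact hsi (ofNat_row_inj hi.1 hI hi.2 hK h)
      · rw [if_neg hi, if_neg, ← hview₃]
        · simp only [Config.view, if_neg hi]
        · rintro ⟨rfl, rfl⟩
          exact hi ⟨hI, hK⟩
  · simp only [ht₃, ht₂, ht₁]; omega
  · simp only [hq₃, hq₂, hq₁]; omega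

theorem Det.queryRow (hw : 0 < w) {r : ℕ} {K : Expr} (hr : r < numRegs) (hKo : K.Ok w n σ)
    (hK : (K.eval σ + 1) * n ≤ 2 ^ w) (h0 : σ.v 0 = n) :
    Det w f D (DTTest.queryRow r K) σ
      (fun σ' => σ' = σ.set r (f fun i => decide (σ.a (K.eval σ) i ≠ 0)).toNat)
      (K.cost + n + 4) 1 := by
  intro c ps hc hv
  refine Refines.det (by simp only [step, hc, DTTest.queryRow]; rfl) ?_
  refine K.refines_code hw numRegs _ _ le_rfl rfl (by show K.Ok w n (c.view n); rwa [hv]) ?_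
  intro c₁ hc₁ hm₁ hr₁ hv₁ ht₁ hq₁
  have hview₁ : c₁.view n = σ := by
    rw [← hv]
    exact Config.view_congr (fun r hr => hr₁ r hr) hm₁
  refine Refines.det (by simp only [step, hc₁]; rfl) ?_
  refine Refines.det (by simp only [step]; rfl) ?_
  refine Refines.det (by simp only [step]; rfl) ?_
  have e₀ : (c₁.reg 0).toNat = n := by
    rw [← h0, ← hview₁, Config.view_reg _ numRegs_pos]
  have e₁ : (c₁.reg numRegs).toNat = K.eval σ := by rw [← hv]; exact hv₁
  have haddr : c₁.reg numRegs * c₁.reg 0 = BitVec.ofNat w (K.eval σ * n) := by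
    apply BitVec.eq_of_toNat_eq
    rw [BitVec.toNat_mul, e₁, e₀, BitVec.toNat_ofNat]
  refine Refines.here ⟨rfl, ?_, ?_, ?_⟩
  · rw [← hview₁]
    refine Config.view_set hr
      (bitWord w (f fun i => decide ((c₁.view n).a (K.eval (c₁.view n)) i ≠ 0))) ?_ ?_ _ _ _
    · have h1 : 1 < 2 ^ w := Nat.one_lt_two_pow hw.ne'
      cases f fun i => decide ((c₁.view n).a (K.eval (c₁.view n)) i ≠ 0) <;>
        simp [bitWord, Nat.mod_eq_of_lt h1]
    · intro s hs
      have hfun : (readVec n c₁.mem (c₁.reg numRegs * c₁.reg 0)) =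
          fun i : Fin n => decide ((c₁.view n).a (K.eval (c₁.view n)) i ≠ 0) := by
        funext i
        simp only [readVec, haddr, hview₁]
        rw [← hview₁, Config.view_mem _ i.2 (by rw [hview₁]; exact hK), hview₁, ← BitVec.ofNat_add]
        simp [← BitVec.toNat_inj]
      simp only [WordOp.apply, Function.update_self]
      by_cases hsr : s = r
      · subst hsr
        simp only [Function.update_self, if_true]
        rw [hfun]
      · simp [hsr, Function.update_of_ne (show s ≠ numRegs by omega)]
  · simp only [ht₁]; omega
  · simp only [hq₁]; omega

theorem Ref.sampleRow (hw : 0 < w) {r : ℕ} {K : Expr} (hr : r < numRegs) (hKo : K.Ok w n σ)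
    (hK : (K.eval σ + 1) * n ≤ 2 ^ w) (h0 : σ.v 0 = n) :
    Ref w f D (DTTest.sampleRow r K) σ D
      (fun x σ' => σ' = (σ.set r (f x).toNat).setRow (K.eval σ)
        (fun i => if h : i < n then (x ⟨i, h⟩).toNat else 0))
      (K.cost + n + 4) 1 := by
  intro c ps hc hv
  refine Refines.det (by simp only [step, hc, DTTest.sampleRow]; rfl) ?_
  refine K.refines_code hw numRegs _ _ le_rfl rfl (by show K.Ok w n (c.view n); rwa [hv]) ?_
  intro c₁ hc₁ hm₁ hr₁ hv₁ ht₁ hq₁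
  have hview₁ : c₁.view n = σ := by
    rw [← hv]
    exact Config.view_congr (fun r hr => hr₁ r hr) hm₁
  refine Refines.det (by simp only [step, hc₁]; rfl) ?_
  refine Refines.det (by simp only [step]; rfl) ?_
  have e₀ : (c₁.reg 0).toNat = n := by
    rw [← h0, ← hview₁, Config.view_reg _ numRegs_pos]
  have e₁ : (c₁.reg numRegs).toNat = K.eval σ := by rw [← hv]; exact hv₁
  have haddr : c₁.reg numRegs * c₁.reg 0 = BitVec.ofNat w (K.eval σ * n) := by
    apply BitVec.eq_of_toNat_eq
    rw [BitVec.toNat_mul, e₁, e₀, BitVec.toNat_ofNat]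
  have h1 : 1 < 2 ^ w := Nat.one_lt_two_pow hw.ne'
  have hbit : ∀ b : Bool, (bitWord w b).toNat = b.toNat := by
    intro b
    cases b <;> simp [bitWord, Nat.mod_eq_of_lt h1]
  refine Refines.step_self (by simp only [step]; rfl) (fun x => ?_)
  · refine ⟨rfl, ?_, ?_, ?_⟩
    · ext s i
      · rw [AbsState.setRow_v, AbsState.set_v, ← hview₁]
        simp only [Config.view]
        split_ifs with h2 h3 h3
        · subst h3
          simp [hbit]
        · simp [h3, Function.update_of_ne (show s ≠ numRegs by omega)]
        · omega
        · rfl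
      · have ha : σ.a = (c₁.view n).a := by rw [hview₁]
        rw [AbsState.setRow_a, AbsState.set_a, ha]
        simp only [Config.view, writeVec, WordOp.apply, Function.update_self, haddr]
        by_cases hs : s = K.eval σ
        · rw [if_pos hs]
          subst hs
          by_cases hi : i < n
          · have hsub : (BitVec.ofNat w (K.eval σ * n + i) - BitVec.ofNat w (K.eval σ * n)).toNat
                = i := by
              have hlt := row_add_lt hi hK
              rw [BitVec.ofNat_add, add_sub_cancel_left, BitVec.toNat_ofNat,
                Nat.mod_eq_of_lt (by omega)]
            simp [hi, hK, hsub, hbit]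
          · simp [hi]
        · rw [if_neg hs]
          by_cases hi : i < n ∧ (s + 1) * n ≤ 2 ^ w
          · simp only [if_pos hi]
            rw [dif_neg]
            rw [BitVec.toNat_sub, BitVec.toNat_ofNat, BitVec.toNat_ofNat,
              Nat.mod_eq_of_lt (row_add_lt hi.1 hi.2),
              Nat.mod_eq_of_lt (a := K.eval σ * n)
                (by have := row_add_lt hi.1 hK; omega)]
            have hK' := hK
            have hi2 := hi.2
            rw [add_mul, one_mul] at hK' hi2
            -- The offset of a foreign cell from the start of the sampled row is at least n. For an
            -- earlier row the subtraction wraps around, and the offset is still at least n because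
            -- the sampled row itself ends before 2^w.
            rcases lt_or_gt_of_ne hs with hlt | hlt
            · have : (s + 1) * n ≤ K.eval σ * n := Nat.mul_le_mul_right _ hlt
              rw [add_mul, one_mul] at this
              rw [Nat.mod_eq_of_lt (by omega)]
              omega
            · have : (K.eval σ + 1) * n ≤ s * n := Nat.mul_le_mul_right _ hlt
              rw [add_mul, one_mul] at this
              rw [show 2 ^ w - K.eval σ * n + (s * n + i) = 2 ^ w + (s * n + i - K.eval σ * n) by
                omega, Nat.add_mod_left, Nat.mod_eq_of_lt (by omega)]
              omega
          · simp only [if_neg hi]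
    · simp only [ht₁]; omega
    · simp only [hq₁]; omega

/-- A uniformly random bit. -/
def coinP : PMF (ZMod 2) := (PMF.uniformOfFintype Bool).map fun b => if b then 1 else 0

theorem Ref.coin (hw : 0 < w) {r : ℕ} (hr : r < numRegs) :
    Ref w f D (.coin r) σ coinP (fun b σ' => σ' = σ.set r b.val) 1 0 := by
  intro c ps hc hv
  have h1 : 1 < 2 ^ w := Nat.one_lt_two_pow hw.ne'
  refine Refines.step (by simp only [step, hc]; rfl) (fun b => Refines.here ?_)
  refine ⟨rfl, ?_, le_rfl, le_rfl⟩
  rw [← hv]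
  refine Config.view_set hr (bitWord w b) ?_ (fun s _ => Function.update_apply _ _ _ _) _ _ _
  cases b
  · simp [bitWord]
  · simp [bitWord, Nat.mod_eq_of_lt h1]
    rfl

theorem Ref.cond (hw : 0 < w) {e : Expr} (he : e.Ok w n σ)
    (hp : e.eval σ ≠ 0 → Ref w f D p σ μ R T Q) (hq : e.eval σ = 0 → Ref w f D q σ μ R T' Q') :
    Ref w f D (DTTest.cond e p q) σ μ R (max T T' + e.cost + 2) (max Q Q') := by
  intro c ps hc hv
  refine Refines.det (by simp only [step, hc, DTTest.cond]; rfl) ?_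
  refine e.refines_code hw numRegs _ _ le_rfl rfl (by show e.Ok w n (c.view n); rwa [hv]) ?_
  intro c₁ hc₁ hm₁ hr₁ hv₁ ht₁ hq₁
  have hview₁ : c₁.view n = σ := by
    rw [← hv]
    exact Config.view_congr (fun r hr => hr₁ r hr) hm₁
  have hv₁' : (c₁.reg numRegs).toNat = e.eval σ := by rw [← hv]; exact hv₁
  refine Refines.det (by simp only [step, hc₁]; rfl) ?_
  by_cases h : e.eval σ = 0
  · have hz : c₁.reg numRegs = 0 := by
      apply BitVec.eq_of_toNat_eq
      rw [hv₁', h]; simp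
    refine (hq h _ ps (by simp [hz]) (by exact hview₁)).mono ?_
    rintro b c' ⟨h1, h2, h3, h4⟩
    simp only [ht₁, hq₁] at h3 h4
    exact ⟨h1, h2, by omega, by omega⟩
  · have hz : c₁.reg numRegs ≠ 0 := by
      intro hz
      rw [hz] at hv₁'
      simp at hv₁'
      exact h hv₁'.symm
    refine (hp h _ ps (by simp only [ne_eq, hz, not_false_eq_true, if_true]) (by exact hview₁)).mono ?_
    rintro b c' ⟨h1, h2, h3, h4⟩
    simp only [ht₁, hq₁] at h3 h4
    exact ⟨h1, h2, by omega, by omega⟩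

/-- The invariant after the body is stated for the state with the counter already set to k + 1,
because the loop code increments it afterwards; the body must preserve the counter and the bound.
The proof is by induction on the number of remaining rounds, and the 30 extra time units per round
pay for the increment and the test. -/
theorem Ref.forLoop (hw : 0 < w) {i b N : ℕ} (hi : i < numRegs) (hb : b < numRegs) (hib : i ≠ b)
    (hN : N < 2 ^ w) {ν : ℕ → β → PMF β} {R : ℕ → β → AbsState → Prop} {x₀ : β}
    (hσ : σ.v b = N) (h₀ : R 0 x₀ (σ.set i 0))
    (hbody : ∀ k < N, ∀ x σ, σ.v i = k → σ.v b = N → R k x σ →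
      Ref w f D p σ (ν k x)
        (fun x' σ' => σ'.v i = k ∧ σ'.v b = N ∧ R (k + 1) x' (σ'.set i (k + 1))) T Q) :
    Ref w f D (DTTest.forLoop i b p) σ (loopP ν 0 N x₀) (fun x σ' => R N x σ')
      (N * (T + 30) + 30) (N * Q) := by
  set test : Expr := Expr.op .lt (.v i) (.v b) with htest
  have hok : ∀ σ : AbsState, test.Ok w n σ := fun σ => ⟨hi, hb, trivial⟩
  set bd : Prog := p ;; DTTest.assign i (.v i + .c 1) ;; test.code numRegs with hbd
  have main : ∀ m k x (c : Config w) ps, k + m = N → c.todo = .loop numRegs bd :: ps →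
      (c.view n).v i = k → (c.view n).v b = N →
      (c.reg numRegs).toNat = (if k < N then 1 else 0) → R k x (c.view n) →
      Refines f D (fun x c' => c'.todo = ps ∧ R N x (c'.view n) ∧
        c'.time ≤ c.time + (m * (T + 30) + 1) ∧ c'.queries ≤ c.queries + m * Q) c
        (loopP ν k m x) := by
    intro m
    induction m with
    | zero =>
      intro k x c ps hk hc hvi hvb hreg hR
      have hz : c.reg numRegs = 0 := by
        apply BitVec.eq_of_toNat_eq
        rw [hreg, if_neg (by omega)]; simp
      refine Refines.det (by simp only [step, hc]; rfl) ?_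
      refine Refines.here ⟨by simp [hz], ?_, by simp, by simp⟩
      obtain rfl : k = N := by omega
      exact hR
    | succ m ih =>
      intro k x c ps hk hc hvi hvb hreg hR
      have hz : c.reg numRegs ≠ 0 := by
        intro hz
        rw [hz, if_pos (by omega)] at hreg
        simp at hreg
      refine Refines.det (by simp only [step, hc]; rfl) ?_
      have hbody' := hbody k (by omega) x (c.view n) hvi hvb hR
      refine Refines.det (by simp only [step, hz, hbd, ne_eq, not_false_eq_true, if_true]; rfl) ?_
      refine (hbody' _ _ rfl (by rfl)).bind ?_
      rintro x' c₁ ⟨hc₁, ⟨hvi₁, hvb₁, hR₁⟩, ht₁, hq₁⟩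
      simp only at ht₁ hq₁
      refine Refines.det (by simp only [step, hc₁]; rfl) ?_
      have hok' : Expr.Ok w n (c₁.view n) (.v i + .c 1) := by
        refine ⟨hi, Nat.one_lt_two_pow hw.ne', ?_⟩
        show (c₁.view n).v i + 1 < 2 ^ w
        rw [hvi₁]; omega
      have hass := Det.assign (f := f) (D := D) hw hi hok'
      refine (PMF.pure_bind () (fun _ => loopP ν (k + 1) m x')) ▸
        (hass _ _ rfl (by rfl)).bind ?_
      rintro _ c₂ ⟨hc₂, hv₂, ht₂, hq₂⟩
      simp only at ht₂ hq₂
      have hev : Expr.eval (c₁.view n) (.v i + .c 1) = k + 1 := by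
        show (c₁.view n).v i + 1 = k + 1
        rw [hvi₁]
      rw [hev] at hv₂
      refine test.refines_code hw numRegs _ _ le_rfl hc₂ (hok _) ?_
      intro c₃ hc₃ hm₃ hr₃ hv₃ ht₃ hq₃
      have hview₃ : c₃.view n = (c₁.view n).set i (k + 1) := by
        rw [← hv₂]
        exact Config.view_congr (fun r hr => hr₃ r hr) hm₃
      refine (ih (k + 1) x' c₃ ps (by omega) hc₃ ?_ ?_ ?_ ?_).mono ?_
      · rw [hview₃, AbsState.set_v, if_pos rfl]
      · rw [hview₃, AbsState.set_v, if_neg (Ne.symm hib), hvb₁]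
      · rw [hv₃, hv₂]
        show (if ((c₁.view n).set i (k + 1)).v i < ((c₁.view n).set i (k + 1)).v b then 1 else 0)
          = _
        rw [AbsState.set_v, if_pos rfl, AbsState.set_v, if_neg (Ne.symm hib), hvb₁]
      · rw [hview₃]; exact hR₁
      · rintro y c' ⟨h1, h2, h3, h4⟩
        have hcost : test.cost = 9 := rfl
        have hcost' : Expr.cost (.v i + .c 1) = 7 := rfl
        rw [hcost'] at ht₂
        rw [hcost] at ht₃
        refine ⟨h1, h2, ?_, ?_⟩
        · have : (m + 1) * (T + 30) = m * (T + 30) + (T + 30) := by ring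
          omega
        · have : (m + 1) * Q = m * Q + Q := by ring
          omega
  intro c ps hc hv
  refine Refines.det (by simp only [step, hc, DTTest.forLoop]; rfl) ?_
  have hok0 : Expr.Ok w n (c.view n) (.c 0) := Nat.two_pow_pos w
  have hass := Det.assign (f := f) (D := D) hw hi hok0
  refine (PMF.pure_bind () (fun _ => loopP ν 0 N x₀)) ▸ (hass _ _ rfl (by rfl)).bind ?_
  rintro _ c₂ ⟨hc₂, hv₂, ht₂, hq₂⟩
  simp only at ht₂ hq₂
  refine Refines.det (by simp only [step, hc₂]; rfl) ?_
  refine test.refines_code hw numRegs _ _ le_rfl rfl (hok _) ?_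
  intro c₃ hc₃ hm₃ hr₃ hv₃ ht₃ hq₃
  have hview₃ : c₃.view n = σ.set i 0 := by
    rw [← hv, ← show c₂.view n = (c.view n).set i 0 from hv₂]
    exact Config.view_congr (fun r hr => hr₃ r hr) hm₃
  have hvb : (σ.set i 0).v b = N := by rw [AbsState.set_v, if_neg (Ne.symm hib), hσ]
  have hvi : (σ.set i 0).v i = 0 := by rw [AbsState.set_v, if_pos rfl]
  refine (main N 0 x₀ c₃ ps (by omega) hc₃ (by rw [hview₃, hvi]) (by rw [hview₃, hvb]) ?_
    (by rw [hview₃]; exact h₀)).mono ?_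
  · rw [hv₃]
    have hv₂' : c₂.view n = σ.set i 0 := by rw [← hv]; exact hv₂
    show (if (c₂.view n).v i < (c₂.view n).v b then 1 else 0) = _
    rw [hv₂', hvi, hvb]
  · rintro y c' ⟨h1, h2, h3, h4⟩
    have hcost : test.cost = 9 := rfl
    have hcost' : Expr.cost (.c 0) = 1 := rfl
    rw [hcost'] at ht₂
    rw [hcost] at ht₃
    simp only at ht₃ hq₃
    exact ⟨h1, h2, by omega, by omega⟩

theorem loopP_pure {ν : ℕ → β → PMF β} {g : ℕ → β → β} (h : ∀ k x, ν k x = PMF.pure (g k x))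
    (hg : ∀ k x, g k x = x) (k m : ℕ) (x : β) : loopP ν k m x = PMF.pure x := by
  induction m generalizing k with
  | zero => rfl
  | succ m ih => rw [loopP, h, PMF.pure_bind, hg, ih]

theorem Det.forLoop (hw : 0 < w) {i b N : ℕ} (hi : i < numRegs) (hb : b < numRegs) (hib : i ≠ b)
    (hN : N < 2 ^ w) {R : ℕ → AbsState → Prop}
    (hσ : σ.v b = N) (h₀ : R 0 (σ.set i 0))
    (hbody : ∀ k < N, ∀ σ, σ.v i = k → σ.v b = N → R k σ →
      Det w f D p σ (fun σ' => σ'.v i = k ∧ σ'.v b = N ∧ R (k + 1) (σ'.set i (k + 1))) T Q) :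
    Det w f D (DTTest.forLoop i b p) σ (fun σ' => R N σ') (N * (T + 30) + 30) (N * Q) := by
  have := Ref.forLoop (f := f) (D := D) (ν := fun _ _ => PMF.pure ()) (R := fun k _ => R k)
    (x₀ := ()) hw hi hb hib hN hσ h₀ (fun k hk _ σ h1 h2 h3 => hbody k hk σ h1 h2 h3)
  rwa [loopP_pure (g := fun _ x => x) (fun _ _ => rfl) (fun _ _ => rfl)] at this

end Rules

/-! ### Evaluation of expressions -/

/-- Equality test. -/
def Expr.eqE (a b : Expr) : Expr := .op .eq a b
/-- Order test. -/
def Expr.ltE (a b : Expr) : Expr := .op .lt a b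

section ExprSimp
variable (σ : AbsState) (w n : ℕ) (a b : Expr) (r k : ℕ)

@[simp] theorem Expr.eval_v : (Expr.v r).eval σ = σ.v r := rfl
@[simp] theorem Expr.eval_c : (Expr.c k).eval σ = k := rfl
@[simp] theorem Expr.eval_add : (a + b).eval σ = a.eval σ + b.eval σ := rfl
@[simp] theorem Expr.eval_mul : (a * b).eval σ = a.eval σ * b.eval σ := rfl
@[simp] theorem Expr.eval_div : (a / b).eval σ = a.eval σ / b.eval σ := rfl
@[simp] theorem Expr.eval_mod : (a % b).eval σ = a.eval σ % b.eval σ := rfl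
@[simp] theorem Expr.eval_eqE :
    (a.eqE b).eval σ = if a.eval σ = b.eval σ then 1 else 0 := rfl
@[simp] theorem Expr.eval_ltE :
    (a.ltE b).eval σ = if a.eval σ < b.eval σ then 1 else 0 := rfl
@[simp] theorem Expr.eval_get : (Expr.get a b).eval σ = σ.a (a.eval σ) (b.eval σ) := rfl

@[simp] theorem Expr.ok_v : (Expr.v r).Ok w n σ ↔ r < numRegs := Iff.rfl
@[simp] theorem Expr.ok_c : (Expr.c k).Ok w n σ ↔ k < 2 ^ w := Iff.rfl
@[simp] theorem Expr.ok_add :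
    (a + b).Ok w n σ ↔ a.Ok w n σ ∧ b.Ok w n σ ∧ a.eval σ + b.eval σ < 2 ^ w := Iff.rfl
@[simp] theorem Expr.ok_mul :
    (a * b).Ok w n σ ↔ a.Ok w n σ ∧ b.Ok w n σ ∧ a.eval σ * b.eval σ < 2 ^ w := Iff.rfl
@[simp] theorem Expr.ok_div : (a / b).Ok w n σ ↔ a.Ok w n σ ∧ b.Ok w n σ := by
  show _ ∧ _ ∧ True ↔ _
  simp
@[simp] theorem Expr.ok_mod : (a % b).Ok w n σ ↔ a.Ok w n σ ∧ b.Ok w n σ := by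
  show _ ∧ _ ∧ True ↔ _
  simp
@[simp] theorem Expr.ok_eqE : (a.eqE b).Ok w n σ ↔ a.Ok w n σ ∧ b.Ok w n σ := by
  show _ ∧ _ ∧ True ↔ _
  simp
@[simp] theorem Expr.ok_ltE : (a.ltE b).Ok w n σ ↔ a.Ok w n σ ∧ b.Ok w n σ := by
  show _ ∧ _ ∧ True ↔ _
  simp
@[simp] theorem Expr.ok_get : (Expr.get a b).Ok w n σ ↔ a.Ok w n σ ∧ b.Ok w n σ ∧
    b.eval σ < n ∧ (a.eval σ + 1) * n ≤ 2 ^ w ∧ σ.v 0 = n := Iff.rfl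

@[simp] theorem Expr.cost_v : (Expr.v r).cost = 3 := rfl
@[simp] theorem Expr.cost_c : (Expr.c k).cost = 1 := rfl
@[simp] theorem Expr.cost_add : (a + b).cost = a.cost + b.cost + 3 := rfl
@[simp] theorem Expr.cost_mul : (a * b).cost = a.cost + b.cost + 3 := rfl
@[simp] theorem Expr.cost_div : (a / b).cost = a.cost + b.cost + 3 := rfl
@[simp] theorem Expr.cost_mod : (a % b).cost = a.cost + b.cost + 3 := rfl
@[simp] theorem Expr.cost_eqE : (a.eqE b).cost = a.cost + b.cost + 3 := rfl
@[simp] theorem Expr.cost_ltE : (a.ltE b).cost = a.cost + b.cost + 3 := rfl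
@[simp] theorem Expr.cost_get : (Expr.get a b).cost = a.cost + b.cost + 7 := rfl

end ExprSimp

/-- The registers below `r₀` and the rows outside `S` are unchanged. -/
def Keep (r₀ : ℕ) (S : Set ℕ) (σ σ' : AbsState) : Prop :=
  (∀ r < r₀, σ'.v r = σ.v r) ∧ ∀ k, k ∉ S → σ'.a k = σ.a k

section Keep
variable {r₀ r₁ : ℕ} {S S' : Set ℕ} {σ σ' σ'' : AbsState}

theorem Keep.refl : Keep r₀ S σ σ := ⟨fun _ _ => rfl, fun _ _ => rfl⟩

theorem Keep.set (h : Keep r₀ S σ σ') {r x : ℕ} (hr : r₀ ≤ r) : Keep r₀ S σ (σ'.set r x) :=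
  ⟨fun s hs => by rw [AbsState.set_v, if_neg (by omega), h.1 s hs], h.2⟩

theorem Keep.put (h : Keep r₀ S σ σ') {k i x : ℕ} (hk : k ∈ S) : Keep r₀ S σ (σ'.put k i x) :=
  ⟨h.1, fun s hs => by
    funext j
    rw [AbsState.put_a, if_neg (by rintro ⟨rfl, _⟩; exact hs hk), h.2 s hs]⟩

theorem Keep.trans (h : Keep r₀ S σ σ') (h' : Keep r₁ S' σ' σ'') (hr : r₀ ≤ r₁) (hS : S' ⊆ S) :
    Keep r₀ S σ σ'' :=
  ⟨fun r hr' => (h'.1 r (by omega)).trans (h.1 r hr'),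
    fun k hk => (h'.2 k fun hh => hk (hS hh)).trans (h.2 k hk)⟩

end Keep

/-! ### The quantities computed by the tester -/

/-- Bit vectors, as vectors over the field with two elements. -/
abbrev Vec (n : ℕ) : Type := Fin n → ZMod 2

/-- Every variable carries a label: `0` and `1` mean that the variable is fixed to this value, `2` that
it is free, and `2 ^ (j + 2)` that it belongs to the class `j`. -/
abbrev Lab (n : ℕ) : Type := Fin n → ℕ

/-- The bit vector of a point of the cube. -/
def toVec {n : ℕ} (x : Cube n) : Vec n := fun i => if x i then 1 else 0

/-- A Boolean function, as a function over the field with two elements. -/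
def fZ {n : ℕ} (f : BoolFun n) (y : Vec n) : ZMod 2 := if f fun i => decide (y i ≠ 0) then 1 else 0

/-- The point at which the free variables and those labelled `skip` have the values given by `base`,
and the class `j` has the value of the bit `j + 2` of `a`. -/
def pointOf {n : ℕ} (lab : Lab n) (skip a : ℕ) (base : Vec n) : Vec n :=
  fun i => if lab i = 2 ∨ lab i = skip then base i else ((a / lab i : ℕ) : ZMod 2)

/-- The sum of `f` over all values of the classes `0, …, s - 1`, without the class labelled `skip`;
`skip = 2` stands for no class. -/
def classSum {n : ℕ} (f : BoolFun n) (lab : Lab n) (s skip : ℕ) (base : Vec n) : ZMod 2 :=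
  ∑ a ∈ Finset.range (2 ^ s),
    if (4 * a + 1) / skip % 2 = 0 then fZ f (pointOf lab skip (4 * a + 1) base) else 0

/-- The row `K` holds the vector `y`. -/
def HoldsVec {n : ℕ} (σ : AbsState) (K : ℕ) (y : Vec n) : Prop := ∀ i : Fin n, σ.a K i = (y i).val

/-- The label row holds `lab`. -/
def HoldsLab {n : ℕ} (σ : AbsState) (lab : Lab n) : Prop := ∀ i : Fin n, σ.a 20 i = lab i

theorem HoldsVec.of_keep {n r₀ K : ℕ} {S : Set ℕ} {σ σ' : AbsState} {y : Vec n}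
    (h : HoldsVec σ K y) (hk : Keep r₀ S σ σ') (hK : K ∉ S) : HoldsVec σ' K y :=
  fun i => by rw [hk.2 K hK, h i]

theorem HoldsLab.of_keep {n r₀ : ℕ} {S : Set ℕ} {σ σ' : AbsState} {lab : Lab n}
    (h : HoldsLab σ lab) (hk : Keep r₀ S σ σ') (hK : 20 ∉ S) : HoldsLab σ' lab :=
  fun i => by rw [hk.2 20 hK, h i]

/-- Code that computes the point of `classSum` for the current value of the classes. -/
def pointCode : Prog :=
  forLoop 43 0 (
    assign 44 (.get (.c 20) (.v 43)) ;;
    cond ((Expr.v 44).eqE (.c 2) + (Expr.v 44).eqE (.v 30))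
      (put (.c 0) (.v 43) (.get (.v 31) (.v 43)))
      (put (.c 0) (.v 43) (.v 42 / .v 44 % .c 2)))

/-- Code that computes `classSum` into the register `40`; the register `16` holds `2 ^ s`, the
register `30` holds `skip`, and the register `31` the number of the row of the base point. -/
def sumCode : Prog :=
  assign 40 (.c 0) ;;
  forLoop 41 16 (
    assign 42 (.c 4 * .v 41 + .c 1) ;;
    cond (.v 42 / .v 30 % .c 2) (assign 40 (.v 40))
      (pointCode ;; queryRow 46 (.c 0) ;; assign 40 ((.v 40 + .v 46) % .c 2)))

/-- The words are long enough for the input size and for memory rows up to the number `rows`. -/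
structure Fits (w n rows : ℕ) : Prop where
  hw : 6 ≤ w
  rows_mul_le : (rows + 1) * n ≤ 2 ^ w
  le_rows : 24 ≤ rows
  lt : n < 2 ^ w

section Eval

variable {w n : ℕ} {f : BoolFun n} {D : PMF (Cube n)} {σ : AbsState}

theorem Fits.pos {rows : ℕ} (h : Fits w n rows) : 0 < w := by have := h.hw; omega

theorem Fits.le_two_pow {rows : ℕ} (h : Fits w n rows) : 64 ≤ 2 ^ w :=
  calc 64 = 2 ^ 6 := by norm_num
    _ ≤ 2 ^ w := Nat.pow_le_pow_right (by norm_num) h.hw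

theorem Fits.row {rows : ℕ} (h : Fits w n rows) {k : ℕ} (hk : k ≤ rows) : (k + 1) * n ≤ 2 ^ w :=
  (Nat.mul_le_mul_right n (by omega)).trans h.rows_mul_le

theorem Det.put_eq (hw : 0 < w) {K I e : Expr} {kk ii x : ℕ} (he : e.Ok w n σ) (hKo : K.Ok w n σ)
    (hIo : I.Ok w n σ) (hKv : K.eval σ = kk) (hIv : I.eval σ = ii) (hev : e.eval σ = x)
    (hI : ii < n) (hK : (kk + 1) * n ≤ 2 ^ w) (h0 : σ.v 0 = n) :
    Det w f D (DTTest.put K I e) σ (fun σ' => σ' = σ.put kk ii x)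
      (e.cost + K.cost + I.cost + 8) 0 := by
  subst hKv hIv hev
  exact Det.put hw he hKo hIo hI hK h0

theorem Det.assign_eq (hw : 0 < w) {r : ℕ} {e : Expr} {x : ℕ} (hr : r < numRegs)
    (he : e.Ok w n σ) (hx : e.eval σ = x) :
    Det w f D (DTTest.assign r e) σ (fun σ' => σ' = σ.set r x) (e.cost + 4) 0 := by
  subst hx
  exact Det.assign hw hr he

/-- Division serves all labels at once. For the values 4b + 1 that `sumCode` supplies, the quotient
by label 0 is 0, by label 1 it is odd, and by label 4 * 2^j its last bit is the bit j of b. -/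
theorem pointCode_spec {lab : Lab n} {skip a K rows : ℕ} {base : Vec n} (hF : Fits w n rows)
    (h0 : σ.v 0 = n)
    (h30 : σ.v 30 = skip) (h31 : σ.v 31 = K) (h42 : σ.v 42 = a) (hK : K ≤ rows) (hK0 : K ≠ 0)
    (hlab : HoldsLab σ lab) (hbase : HoldsVec σ K base) :
    Det w f D pointCode σ (fun σ' => HoldsVec σ' 0 (pointOf lab skip a base) ∧ Keep 43 {0} σ σ')
      (n * 130 + 30) 0 := by
  have hw0 := hF.pos
  have h64 := hF.le_two_pow
  have hrow : ∀ k ≤ rows, (k + 1) * n ≤ 2 ^ w := fun k hk => hF.row hk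
  have hrows' := hF.le_rows
  have hn := hF.lt
  have key := Det.forLoop (f := f) (D := D) (σ := σ) (i := 43) (b := 0) (N := n) (T := 100) (Q := 0)
    (w := w) (n := n)
    (p := assign 44 (.get (.c 20) (.v 43)) ;;
      cond ((Expr.v 44).eqE (.c 2) + (Expr.v 44).eqE (.v 30))
        (put (.c 0) (.v 43) (.get (.v 31) (.v 43)))
        (put (.c 0) (.v 43) (.v 42 / .v 44 % .c 2)))
    (R := fun k σ' => (∀ i : Fin n, (i : ℕ) < k → σ'.a 0 i = (pointOf lab skip a base i).val) ∧
      Keep 43 {0} σ σ')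
    hw0 (by norm_num [numRegs]) (by norm_num [numRegs]) (by norm_num) hn h0
    ⟨fun i hi => by omega, Keep.refl.set (by norm_num)⟩ ?_
  · refine key.weaken (by omega) (by omega) ?_
    rintro _ σ' ⟨h1, h2⟩
    exact ⟨fun i => h1 i i.2, h2⟩
  intro k hk σ₁ hi hb ⟨hR, hkeep⟩
  have e0 : σ₁.v 0 = n := hb
  have e30 : σ₁.v 30 = skip := by rw [hkeep.1 30 (by norm_num), h30]
  have e31 : σ₁.v 31 = K := by rw [hkeep.1 31 (by norm_num), h31]
  have e42 : σ₁.v 42 = a := by rw [hkeep.1 42 (by norm_num), h42]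
  have eL : σ₁.a 20 k = lab ⟨k, hk⟩ := by
    rw [hkeep.2 20 (by simp)]; exact hlab ⟨k, hk⟩
  have ebase : σ₁.a K k = (base ⟨k, hk⟩).val := by
    rw [hkeep.2 K (by simpa using hK0)]; exact hbase ⟨k, hk⟩
  have r20 := hrow 20 (by omega)
  have r0 := hrow 0 (by omega)
  have rK := hrow K hK
  refine Ref.bound (Ref.assign_seq hw0 (by norm_num [numRegs]) ?_
    (Ref.cond hw0 (T := 50) (T' := 50) (Q := 0) (Q' := 0) ?_ ?_ ?_)) ?_ ?_
  · simp [numRegs, hi, e0, hk, r20]; omega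
  · simp only [Expr.ok_add, Expr.ok_eqE, Expr.ok_v, Expr.ok_c, Expr.eval_eqE]
    refine ⟨⟨by norm_num [numRegs], by omega⟩, ⟨by norm_num [numRegs], by norm_num [numRegs]⟩, ?_⟩
    split_ifs <;> omega
  · intro hcond
    refine (Det.put hw0 ?_ ?_ ?_ ?_ ?_ ?_).weaken ?_ ?_ ?_
    · simp [numRegs, AbsState.set_v, hi, e0, hk, rK, e31]
    · simp
    · simp [numRegs]
    · simpa [AbsState.set_v, hi] using hk
    · simpa using r0
    · simpa [AbsState.set_v] using e0
    · simp
    · simp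
    · rintro _ σ' rfl
      simp [AbsState.set_v, hi, eL, e30] at hcond
      simp only [Expr.eval_c, Expr.eval_v, Expr.eval_get, AbsState.set_v, AbsState.set_a]
      simp only [AbsState.put_v, AbsState.set_v]
      norm_num [hi, e0, e31, ebase]
      refine ⟨?_, (((hkeep.set (by norm_num)).put (by simp)).set (by norm_num))⟩
      intro i hik
      rw [AbsState.put_a]
      by_cases h : (i : ℕ) = k
      · have : i = ⟨k, hk⟩ := Fin.ext h
        subst this
        have : lab ⟨k, hk⟩ = 2 ∨ lab ⟨k, hk⟩ = skip := by
          by_contra hcon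
          push Not at hcon
          simp [hcon.1, hcon.2] at hcond
        simp [pointOf, this]
      · rw [if_neg (by tauto)]
        exact hR i (by omega)
  · intro hcond
    refine (Det.put hw0 ?_ ?_ ?_ ?_ ?_ ?_).weaken ?_ ?_ ?_
    · simp [numRegs]; omega
    · simp
    · simp [numRegs]
    · simpa [AbsState.set_v, hi] using hk
    · simpa using r0
    · simpa [AbsState.set_v] using e0
    · simp
    · simp
    · rintro _ σ' rfl
      simp [AbsState.set_v, hi, eL, e30] at hcond
      simp only [Expr.eval_c, Expr.eval_v, Expr.eval_get, AbsState.set_v, AbsState.set_a,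
        Expr.eval_div, Expr.eval_mod]
      simp only [AbsState.put_v, AbsState.set_v]
      norm_num [hi, e0, eL, e42]
      refine ⟨?_, (((hkeep.set (by norm_num)).put (by simp)).set (by norm_num))⟩
      intro i hik
      rw [AbsState.put_a]
      by_cases h : (i : ℕ) = k
      · have : i = ⟨k, hk⟩ := Fin.ext h
        subst this
        have : ¬ (lab ⟨k, hk⟩ = 2 ∨ lab ⟨k, hk⟩ = skip) := by tauto
        simp only [pointOf, if_neg this, ZMod.val_natCast]
        simp
      · rw [if_neg (by tauto)]
        exact hR i (by omega)
  · simp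
  · simp

/-- Values of the classes whose bit for `skip` is set contribute nothing and cost no query. For
`skip = 2` the quotient of 4a + 1 is 2a, which is even, so no value is left out. -/
theorem sumCode_spec {lab : Lab n} {s skip K rows : ℕ} {base : Vec n} (hF : Fits w n rows)
    (hs : 4 * 2 ^ s < 2 ^ w) (h0 : σ.v 0 = n) (h16 : σ.v 16 = 2 ^ s)
    (h30 : σ.v 30 = skip) (h31 : σ.v 31 = K) (hK : K ≤ rows) (hK0 : K ≠ 0)
    (hlab : HoldsLab σ lab) (hbase : HoldsVec σ K base) :
    Det w f D sumCode σ (fun σ' => σ'.v 40 = (classSum f lab s skip base).val ∧ Keep 40 {0} σ σ')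
      (2 ^ s * (n * 131 + 200) + 40) (2 ^ s) := by
  have hw0 := hF.pos
  have h64 := hF.le_two_pow
  have hrows' := hF.le_rows
  refine Ref.bound (Ref.assign_seq hw0 (by norm_num [numRegs]) (by simp) (Ref.weaken
    (Det.forLoop (i := 41) (b := 16) (N := 2 ^ s) (T := n * 131 + 170) (Q := 1)
    (R := fun k σ' => σ'.v 40 = (∑ a ∈ Finset.range k, if (4 * a + 1) / skip % 2 = 0 then
        fZ f (pointOf lab skip (4 * a + 1) base) else 0).val ∧ Keep 40 {0} σ σ')
    hw0 (by norm_num [numRegs]) (by norm_num [numRegs]) (by norm_num) (by omega) ?_ ?_ ?_)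
    le_rfl le_rfl ?_)) ?_ ?_
  · simpa [AbsState.set_v] using h16
  · refine ⟨by simp [AbsState.set_v], (Keep.refl.set (by norm_num)).set (by norm_num)⟩
  · intro k hk σ₁ hi hb ⟨hR, hkeep⟩
    have e0 : σ₁.v 0 = n := by rw [hkeep.1 0 (by norm_num), h0]
    have e30 : σ₁.v 30 = skip := by rw [hkeep.1 30 (by norm_num), h30]
    have e31 : σ₁.v 31 = K := by rw [hkeep.1 31 (by norm_num), h31]
    refine Ref.bound (Ref.assign_seq hw0 (by norm_num [numRegs]) ?_
      (Ref.cond hw0 (T := 7) (T' := n * 131 + 80) (Q := 0) (Q' := 1) ?_ ?_ ?_)) ?_ ?_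
    · simp [numRegs, hi]; omega
    · simp [numRegs]; omega
    · intro hcond
      refine (Det.assign hw0 (by norm_num [numRegs]) (by simp [numRegs])).weaken (by simp) le_rfl ?_
      rintro _ σ' rfl
      simp [AbsState.set_v, hi, e30] at hcond
      simp [AbsState.set_v, hi, hb]
      refine ⟨?_, (((hkeep.set (by norm_num)).set (by norm_num)).set (by norm_num))⟩
      rw [hR, Finset.sum_range_succ, if_neg (by omega), add_zero]
    · intro hcond
      simp [AbsState.set_v, hi, e30] at hcond
      set σ₂ := σ₁.set 42 (4 * k + 1) with hσ₂
      have hσ₂' : σ₁.set 42 ((Expr.c 4 * Expr.v 41 + Expr.c 1).eval σ₁) = σ₂ := by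
        simp [hσ₂, hi]
      rw [hσ₂']
      have hk2 : Keep 40 {0} σ σ₂ := hkeep.set (by norm_num)
      refine Ref.bound (Det.seq (pointCode_spec hF (lab := lab) (skip := skip) (a := 4 * k + 1)
        (K := K) (base := base) ?_ ?_ ?_ ?_ hK hK0 (hlab.of_keep hk2 (by simp))
        (hbase.of_keep hk2 (by simpa using hK0))) (T' := n + 40) (Q' := 1) ?_) (by omega) (by omega)
      · simp [hσ₂, AbsState.set_v, e0]
      · simp [hσ₂, AbsState.set_v, e30]
      · simp [hσ₂, AbsState.set_v, e31]
      · simp [hσ₂, AbsState.set_v]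
      · intro σ₃ ⟨hpt, hk3⟩
        have e0' : σ₃.v 0 = n := by rw [hk3.1 0 (by norm_num)]; simp [hσ₂, AbsState.set_v, e0]
        refine Ref.bound (Det.seq (Det.queryRow hw0 (by norm_num [numRegs]) (by simp)
          (by simpa using hF.row (Nat.zero_le _)) e0') (T' := 20) (Q' := 0) ?_) ?_ ?_
        · rintro σ₄ rfl
          have e40 : σ₃.v 40 = σ₁.v 40 := by
            rw [hk3.1 40 (by norm_num)]; simp [hσ₂, AbsState.set_v]
          have hlt : σ₁.v 40 < 2 := by rw [hR]; exact ZMod.val_lt _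
          have hlt' : ∀ b : Bool, b.toNat < 2 := by decide
          refine (Det.assign hw0 (by norm_num [numRegs]) ?_).weaken (by simp) le_rfl ?_
          · simp [numRegs, AbsState.set_v, e40]
            have hb : ∀ b : Bool, σ₁.v 40 + b.toNat < 2 ^ w := fun b => by
              have := hlt' b
              omega
            exact ⟨hb _, by omega⟩
          · rintro _ σ' rfl
            have hq : (f fun i => decide (σ₃.a 0 i ≠ 0)).toNat =
                (fZ f (pointOf lab skip (4 * k + 1) base)).val := by
              have : (fun i : Fin n => decide (σ₃.a 0 i ≠ 0)) =
                  fun i => decide (pointOf lab skip (4 * k + 1) base i ≠ 0) := by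
                funext i
                rw [hpt i, decide_eq_decide, ne_eq, ZMod.val_eq_zero]
              rw [this, fZ]
              cases f fun i => decide (pointOf lab skip (4 * k + 1) base i ≠ 0) <;> rfl
            have e41 : σ₃.v 41 = k := by
              rw [hk3.1 41 (by norm_num)]; simp [hσ₂, AbsState.set_v, hi]
            have e16 : σ₃.v 16 = 2 ^ s := by
              rw [hk3.1 16 (by norm_num)]; simp [hσ₂, AbsState.set_v, hb]
            simp only [Expr.eval_mod, Expr.eval_add, Expr.eval_v, Expr.eval_c, AbsState.set_v]
            norm_num [e40, e41, e16]
            refine ⟨?_, ?_⟩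
            · rw [Finset.sum_range_succ, if_pos hcond, ZMod.val_add, hR]
              congr 2
            · refine Keep.set (Keep.set (Keep.set ?_ (by norm_num)) (by norm_num)) (by norm_num)
              exact hk2.trans hk3 (by norm_num) le_rfl
        · simp; omega
        · simp
    · simp; omega
    · simp
  · rintro _ σ' ⟨h1, h2⟩
    exact ⟨h1, h2⟩
  · simp
    have : 2 ^ s * (n * 131 + 170 + 30) = 2 ^ s * (n * 131 + 200) := by ring
    omega
  · simp

end Eval

/-! ### Scanning the table and searching for a relevant block -/

/-- The last index below `m` at which `classSum` differs from its value at the first row of the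
table, and `0` if there is none. -/
def scanIdx {n : ℕ} (f : BoolFun n) (lab : Lab n) (s : ℕ) (tab : ℕ → Vec n) : ℕ → ℕ
  | 0 => 0
  | k + 1 => if classSum f lab s 2 (tab k) = classSum f lab s 2 (tab 0) then scanIdx f lab s tab k
      else k

/-- The vector that agrees with `P` on the blocks below `t` and with `Q` elsewhere. -/
def hybrid {n : ℕ} (h : Fin n → ℕ) (t : ℕ) (P Q : Vec n) : Vec n :=
  fun i => if h i < t then P i else Q i

/-- Binary search for a block at which `classSum` changes between hybrids of `P` and `Q`. -/
def searchBlock {n : ℕ} (f : BoolFun n) (lab : Lab n) (s : ℕ) (h : Fin n → ℕ) (P Q : Vec n)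
    (R : ℕ) : ℕ → ℕ
  | 0 => 0
  | k + 1 =>
    if classSum f lab s 2 (hybrid h (searchBlock f lab s h P Q R k + R / 2 ^ (k + 1)) P Q) =
        classSum f lab s 2 Q then
      searchBlock f lab s h P Q R k + R / 2 ^ (k + 1)
    else searchBlock f lab s h P Q R k

/-- Make the block `t` the class `s`. -/
def addClass {n : ℕ} (lab : Lab n) (h : Fin n → ℕ) (t s : ℕ) : Lab n :=
  fun i => if h i = t then 4 * 2 ^ s else lab i

/-- A crude bound, which serves only to exclude overflow during the search. -/
theorem searchBlock_le {n : ℕ} (f : BoolFun n) (lab : Lab n) (s : ℕ) (h : Fin n → ℕ) (P Q : Vec n)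
    (R k : ℕ) : searchBlock f lab s h P Q R k ≤ k * R := by
  induction k with
  | zero => simp [searchBlock]
  | succ k ih =>
    have h1 : R / 2 ^ (k + 1) ≤ R := Nat.div_le_self _ _
    have h2 : (k + 1) * R = k * R + R := by ring
    rw [searchBlock]
    split_ifs <;> omega

theorem scanIdx_lt {n : ℕ} (f : BoolFun n) (lab : Lab n) (s : ℕ) (tab : ℕ → Vec n) (m : ℕ)
    (hm : 0 < m) : scanIdx f lab s tab m < m := by
  induction m with
  | zero => omega
  | succ k ih =>
    rw [scanIdx]
    split_ifs
    · rcases Nat.eq_zero_or_pos k with rfl | hk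
      · simp [scanIdx]
      · have := ih hk; omega
    · omega

/-- The table rows hold the first `m` vectors of `tab`. -/
def HoldsTab {n : ℕ} (σ : AbsState) (m : ℕ) (tab : ℕ → Vec n) : Prop :=
  ∀ j < m, HoldsVec σ (23 + j) (tab j)

/-- The row `22` holds the block numbers. -/
def HoldsHash {n : ℕ} (σ : AbsState) (h : Fin n → ℕ) : Prop := ∀ i : Fin n, σ.a 22 i = h i

theorem HoldsTab.of_keep {n r₀ m : ℕ} {S : Set ℕ} {σ σ' : AbsState} {tab : ℕ → Vec n}
    (h : HoldsTab σ m tab) (hk : Keep r₀ S σ σ') (hS : ∀ k ∈ S, k < 23) : HoldsTab σ' m tab :=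
  fun j hj => (h j hj).of_keep hk fun hh => by have := hS _ hh; omega

theorem HoldsHash.of_keep {n r₀ : ℕ} {S : Set ℕ} {σ σ' : AbsState} {g : Fin n → ℕ}
    (h : HoldsHash σ g) (hk : Keep r₀ S σ σ') (hS : 22 ∉ S) : HoldsHash σ' g :=
  fun i => by rw [hk.2 22 hS, h i]

/-- Code for `scanIdx`. -/
def scanCode : Prog :=
  assign 30 (.c 2) ;; assign 31 (.c 23) ;; sumCode ;; assign 20 (.v 40) ;; assign 21 (.c 0) ;;
  forLoop 22 17 (
    assign 31 (.c 23 + .v 22) ;; sumCode ;;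
    cond ((Expr.v 40).eqE (.v 20)) (assign 21 (.v 21)) (assign 21 (.v 22)))

/-- Code for a hybrid of the rows `21` and `0` of the table. -/
def hybridCode : Prog :=
  forLoop 26 0 (
    cond ((Expr.get (.c 22) (.v 26)).ltE (.v 23 + .v 24))
      (put (.c 1) (.v 26) (.get (.c 23 + .v 21) (.v 26)))
      (put (.c 1) (.v 26) (.get (.c 23) (.v 26))))

/-- Code for `addClass`. -/
def addClassCode : Prog :=
  forLoop 26 0 (
    cond ((Expr.get (.c 22) (.v 26)).eqE (.v 23))
      (put (.c 20) (.v 26) (.c 4 * .v 16)) (assign 40 (.c 0)))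

/-- Code for `searchBlock`. -/
def searchCode : Prog :=
  assign 23 (.c 0) ;; assign 24 (.v 5) ;;
  forLoop 25 6 (
    assign 24 (.v 24 / .c 2) ;; hybridCode ;; assign 30 (.c 2) ;; assign 31 (.c 1) ;; sumCode ;;
    cond ((Expr.v 40).eqE (.v 20)) (assign 23 (.v 23 + .v 24)) (assign 23 (.v 23)))

section Search

variable {w n : ℕ} {f : BoolFun n} {D : PMF (Cube n)} {σ : AbsState}

/-- The body may assume that the cells from k on still have their old contents; this is what permits
the in-place updates of the label row by `addClassCode` and `collapseCode`. -/
theorem Det.fillRow {rows i K T : ℕ} {g : ℕ → ℕ} {p : Prog} (hF : Fits w n rows) (hi : i < numRegs)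
    (hi0 : 0 < i) (h0 : σ.v 0 = n)
    (hbody : ∀ k < n, ∀ σ₁ : AbsState, σ₁.v i = k → Keep i {K} σ σ₁ →
      (∀ j ≥ k, σ₁.a K j = σ.a K j) →
      Det w f D p σ₁ (fun σ' => σ'.a K k = g k ∧ (∀ j ≠ k, σ'.a K j = σ₁.a K j) ∧
        Keep (i + 1) {K} σ₁ σ') T 0) :
    Det w f D (DTTest.forLoop i 0 p) σ (fun σ' => (∀ j < n, σ'.a K j = g j) ∧ Keep i {K} σ σ')
      (n * (T + 30) + 30) 0 := by
  refine (Det.forLoop (i := i) (b := 0) (N := n) (T := T) (Q := 0)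
    (R := fun k σ' => (∀ j < k, σ'.a K j = g j) ∧ (∀ j ≥ k, σ'.a K j = σ.a K j) ∧ Keep i {K} σ σ')
    hF.pos hi numRegs_pos hi0.ne' hF.lt h0 ⟨by simp, by simp, Keep.refl.set le_rfl⟩ ?_).weaken
    le_rfl (by simp) ?_
  · intro k hk σ₁ h1 h2 ⟨hR, hR', hkeep⟩
    refine (hbody k hk σ₁ h1 hkeep hR').weaken le_rfl le_rfl ?_
    rintro _ σ' ⟨h3, h4, h5⟩
    refine ⟨by rw [h5.1 i (by omega), h1], by rw [h5.1 0 (by omega), h2], ?_, ?_, ?_⟩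
    · intro j hj
      rw [AbsState.set_a]
      by_cases hjk : j = k
      · rw [hjk, h3]
      · rw [h4 j hjk, hR j (by omega)]
    · intro j hj
      rw [AbsState.set_a, h4 j (by omega), hR' j (by omega)]
    · exact (hkeep.trans h5 (by omega) le_rfl).set le_rfl
  · rintro _ σ' ⟨h1, _, h3⟩
    exact ⟨h1, h3⟩

theorem scanCode_spec {lab : Lab n} {s m M rows : ℕ} {tab : ℕ → Vec n} (hF : Fits w n rows)
    (hM : 22 + M ≤ rows) (hmM : m ≤ M) (hM0 : 0 < M) (hm : m < 2 ^ w) (hM2 : 23 + M < 2 ^ w)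
    (hs : 4 * 2 ^ s < 2 ^ w) (h0 : σ.v 0 = n) (h16 : σ.v 16 = 2 ^ s) (h17 : σ.v 17 = m)
    (hlab : HoldsLab σ lab) (htab : HoldsTab σ M tab) :
    Det w f D scanCode σ (fun σ' => σ'.v 20 = (classSum f lab s 2 (tab 0)).val ∧
        σ'.v 21 = scanIdx f lab s tab m ∧ σ'.v 30 = 2 ∧ Keep 20 {0} σ σ')
      ((m + 1) * (2 ^ s * (n * 131 + 200) + 200)) ((m + 1) * 2 ^ s) := by
  have hw0 := hF.pos
  have h64 := hF.le_two_pow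
  refine Ref.bound (Ref.assign_seq hw0 (by norm_num [numRegs]) (by simp; omega)
    (Ref.assign_seq hw0 (by norm_num [numRegs]) (by simp; omega)
    (Det.seq (sumCode_spec hF (lab := lab) (s := s) (skip := 2) (K := 23) (base := tab 0) hs ?_ ?_
      ?_ ?_ (by omega) (by omega) ?_ ?_)
      (T' := m * (2 ^ s * (n * 131 + 200) + 150) + 60) (Q' := m * 2 ^ s) ?_))) ?_ ?_
  · simp [AbsState.set_v, h0]
  · simp [AbsState.set_v, h16]
  · simp [AbsState.set_v]
  · simp [AbsState.set_v]
  · exact hlab.of_keep (((Keep.refl (r₀ := 20) (S := {0})).set (by norm_num)).set (by norm_num))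
      (by simp)
  · exact (htab 0 hM0).of_keep
      (((Keep.refl (r₀ := 20) (S := {0})).set (by norm_num)).set (by norm_num)) (by simp)
  · rintro σ₁ ⟨h40, hk1⟩
    have hk : Keep 20 {0} σ σ₁ := (((Keep.refl (r₀ := 20) (S := {0})).set (by norm_num)).set
      (by norm_num)).trans hk1 (by norm_num) le_rfl
    have e30 : σ₁.v 30 = 2 := by rw [hk1.1 30 (by norm_num)]; simp [AbsState.set_v]
    refine Ref.bound (Ref.assign_seq hw0 (by norm_num [numRegs]) (by simp [numRegs])
      (Ref.assign_seq hw0 (by norm_num [numRegs]) (by simp)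
      (Det.forLoop (i := 22) (b := 17) (N := m) (T := 2 ^ s * (n * 131 + 200) + 120) (Q := 2 ^ s)
      (R := fun k σ' => σ'.v 20 = (classSum f lab s 2 (tab 0)).val ∧
        σ'.v 21 = scanIdx f lab s tab k ∧ σ'.v 30 = 2 ∧ Keep 20 {0} σ σ')
      hw0 (by norm_num [numRegs]) (by norm_num [numRegs]) (by norm_num) hm ?_ ?_ ?_))) ?_ ?_
    · simp [AbsState.set_v, hk.1 17, h17]
    · refine ⟨by simp [AbsState.set_v, h40], by simp [AbsState.set_v, scanIdx],
        by simp [AbsState.set_v, e30],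
        ((hk.set (by norm_num)).set (by norm_num)).set (by norm_num)⟩
    · intro k hk' σ₂ hi hb ⟨h20, h21, h30, hkeep⟩
      have kk : Keep 20 {0} σ (σ₂.set 31 (23 + k)) := hkeep.set (by norm_num)
      refine Ref.bound (Det.seq (Det.assign_eq hw0 (x := 23 + k) (by norm_num [numRegs])
        (by simp [numRegs, hi]; omega) (by simp [hi])) (T' := 2 ^ s * (n * 131 + 200) + 80)
        (Q' := 2 ^ s) ?_) (by simp; omega) (by simp)
      rintro σ₃ rfl
      refine Ref.bound (Det.seq (sumCode_spec hF (lab := lab) (s := s) (skip := 2) (K := 23 + k)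
        (base := tab k) hs ?_ ?_ ?_ ?_ (by omega) (by omega) (hlab.of_keep kk (by simp))
        ((htab k (by omega)).of_keep kk (by simp))) (T' := 30) (Q' := 0) ?_) (by omega) (by simp)
      · rw [kk.1 0 (by norm_num), h0]
      · rw [kk.1 16 (by norm_num), h16]
      · simp [AbsState.set_v, h30]
      · simp [AbsState.set_v]
      rintro σ₄ ⟨e40, k4⟩
      have e20 : σ₄.v 20 = (classSum f lab s 2 (tab 0)).val := by
        rw [k4.1 20 (by norm_num)]; simp [AbsState.set_v, h20]
      have e21 : σ₄.v 21 = scanIdx f lab s tab k := by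
        rw [k4.1 21 (by norm_num)]; simp [AbsState.set_v, h21]
      have e22 : σ₄.v 22 = k := by
        rw [k4.1 22 (by norm_num)]; simp [AbsState.set_v, hi]
      have e30 : σ₄.v 30 = 2 := by
        rw [k4.1 30 (by norm_num)]; simp [AbsState.set_v, h30]
      have e17 : σ₄.v 17 = m := by
        rw [k4.1 17 (by norm_num)]; simp [AbsState.set_v, hb]
      have kk4 : Keep 20 {0} σ σ₄ := kk.trans k4 (by norm_num) le_rfl
      refine Ref.bound (Ref.cond hw0 (T := 7) (T' := 7) (Q := 0) (Q' := 0) (by simp [numRegs])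
        (fun hc => ?_) (fun hc => ?_)) (by simp) (by simp)
      · refine (Det.assign hw0 (by norm_num [numRegs]) (by simp [numRegs])).weaken (by simp) le_rfl ?_
        rintro _ σ' rfl
        simp [e40, e20, (ZMod.val_injective 2).eq_iff] at hc
        simp [AbsState.set_v, e22, e17, e20, e21, e30, scanIdx, hc]
        exact ((kk4.set (by norm_num)).set (by norm_num))
      · refine (Det.assign hw0 (by norm_num [numRegs]) (by simp [numRegs])).weaken (by simp) le_rfl ?_
        rintro _ σ' rfl
        simp [e40, e20, (ZMod.val_injective 2).eq_iff] at hc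
        simp [AbsState.set_v, e22, e17, e20, e30, scanIdx, hc]
        exact ((kk4.set (by norm_num)).set (by norm_num))
    · simp
      have : m * (2 ^ s * (n * 131 + 200) + 120 + 30) = m * (2 ^ s * (n * 131 + 200) + 150) := by
        ring
      omega
    · simp
  · simp
    nlinarith
  · simp
    nlinarith

theorem hybridCode_spec {h : Fin n → ℕ} {t M j rows : ℕ} {tab : ℕ → Vec n} (hF : Fits w n rows)
    (hM : 22 + M ≤ rows) (hj : j < M) (hM2 : 23 + M < 2 ^ w) (ht : t < 2 ^ w)
    (h0 : σ.v 0 = n) (h21 : σ.v 21 = j) (ht' : σ.v 23 + σ.v 24 = t)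
    (hhash : HoldsHash σ h) (htab : HoldsTab σ M tab) :
    Det w f D hybridCode σ (fun σ' => HoldsVec σ' 1 (hybrid h t (tab j) (tab 0)) ∧ Keep 26 {1} σ σ')
      (n * 130 + 30) 0 := by
  have hw0 := hF.pos
  have h64 := hF.le_two_pow
  have h24 := hF.le_rows
  refine (Det.fillRow (i := 26) (T := 100) (K := 1) (g := fun i => if hi : i < n then
    (hybrid h t (tab j) (tab 0) ⟨i, hi⟩).val else 0) hF (by norm_num [numRegs]) (by norm_num) h0
    ?_).weaken (by omega) le_rfl ?_
  · intro k hk σ₁ hi hkeep _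
    have e0 : σ₁.v 0 = n := by rw [hkeep.1 0 (by norm_num), h0]
    have e21 : σ₁.v 21 = j := by rw [hkeep.1 21 (by norm_num), h21]
    have et : σ₁.v 23 + σ₁.v 24 = t := by
      rw [hkeep.1 23 (by norm_num), hkeep.1 24 (by norm_num), ht']
    have eh : σ₁.a 22 k = h ⟨k, hk⟩ := by rw [hkeep.2 22 (by simp)]; exact hhash ⟨k, hk⟩
    have ej : σ₁.a (23 + j) k = (tab j ⟨k, hk⟩).val := by
      rw [hkeep.2 (23 + j) (by simp; omega)]; exact htab j hj ⟨k, hk⟩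
    have ez : σ₁.a 23 k = (tab 0 ⟨k, hk⟩).val := by
      rw [hkeep.2 23 (by simp)]; exact htab 0 (by omega) ⟨k, hk⟩
    have r22 := hF.row (k := 22) (by omega)
    have r1 := hF.row (k := 1) (by omega)
    have r23 := hF.row (k := 23) (by omega)
    have rj := hF.row (k := 23 + j) (by omega)
    refine Ref.bound (Ref.cond hw0 (T := 50) (T' := 50) (Q := 0) (Q' := 0) ?_ (fun hc => ?_)
      (fun hc => ?_)) (by simp) (by simp)
    · simp [numRegs, hi, e0, hk, r22, et, ht]; omega
    · refine (Det.put_eq hw0 (kk := 1) (ii := k) (x := (tab j ⟨k, hk⟩).val) ?_ (by simp; omega)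
        (by simp [numRegs]) (by simp) (by simp [hi]) (by simp [hi, e21, ej]) hk r1 e0).weaken
        (by simp) le_rfl ?_
      · simp [numRegs, hi, e0, hk, e21, rj]; omega
      · rintro _ σ' rfl
        simp [hi, eh, et] at hc
        refine ⟨?_, ?_, Keep.refl.put (by simp)⟩
        · rw [AbsState.put_a, if_pos ⟨rfl, rfl⟩, dif_pos hk, hybrid, if_pos hc]
        · intro i hik
          rw [AbsState.put_a, if_neg (by tauto)]
    · refine (Det.put_eq hw0 (kk := 1) (ii := k) (x := (tab 0 ⟨k, hk⟩).val) ?_ (by simp; omega)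
        (by simp [numRegs]) (by simp) (by simp [hi]) (by simp [hi, ez]) hk r1 e0).weaken
        (by simp) le_rfl ?_
      · simp [numRegs, hi, e0, hk, r23]; omega
      · rintro _ σ' rfl
        simp [hi, eh, et] at hc
        refine ⟨?_, ?_, Keep.refl.put (by simp)⟩
        · rw [AbsState.put_a, if_pos ⟨rfl, rfl⟩, dif_pos hk, hybrid, if_neg (by omega)]
        · intro i hik
          rw [AbsState.put_a, if_neg (by tauto)]
  · rintro _ σ' ⟨h1, h2⟩
    exact ⟨fun i => by rw [h1 i i.2, dif_pos i.2], h2⟩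

theorem addClassCode_spec {h : Fin n → ℕ} {lab : Lab n} {t s rows : ℕ} (hF : Fits w n rows)
    (hs : 4 * 2 ^ s < 2 ^ w) (h0 : σ.v 0 = n) (h16 : σ.v 16 = 2 ^ s) (h23 : σ.v 23 = t)
    (hhash : HoldsHash σ h) (hlab : HoldsLab σ lab) :
    Det w f D addClassCode σ (fun σ' => HoldsLab σ' (addClass lab h t s) ∧ Keep 26 {20} σ σ')
      (n * 130 + 30) 0 := by
  have hw0 := hF.pos
  have h64 := hF.le_two_pow
  have h24 := hF.le_rows
  refine (Det.fillRow (i := 26) (T := 100) (K := 20) (g := fun i => if hi : i < n then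
    addClass lab h t s ⟨i, hi⟩ else 0) hF (by norm_num [numRegs]) (by norm_num) h0
    ?_).weaken (by omega) le_rfl ?_
  · intro k hk σ₁ hi hkeep hold
    have e0 : σ₁.v 0 = n := by rw [hkeep.1 0 (by norm_num), h0]
    have e16 : σ₁.v 16 = 2 ^ s := by rw [hkeep.1 16 (by norm_num), h16]
    have e23 : σ₁.v 23 = t := by rw [hkeep.1 23 (by norm_num), h23]
    have eh : σ₁.a 22 k = h ⟨k, hk⟩ := by rw [hkeep.2 22 (by simp)]; exact hhash ⟨k, hk⟩
    have el : σ₁.a 20 k = lab ⟨k, hk⟩ := by rw [hold k le_rfl]; exact hlab ⟨k, hk⟩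
    have r22 := hF.row (k := 22) (by omega)
    have r20 := hF.row (k := 20) (by omega)
    refine Ref.bound (Ref.cond hw0 (T := 50) (T' := 50) (Q := 0) (Q' := 0) ?_ (fun hc => ?_)
      (fun hc => ?_)) (by simp) (by simp)
    · simp [numRegs, hi, e0, hk, r22]; omega
    · refine (Det.put_eq hw0 (kk := 20) (ii := k) (x := 4 * 2 ^ s) ?_ (by simp; omega)
        (by simp [numRegs]) (by simp) (by simp [hi]) (by simp [e16]) hk r20 e0).weaken
        (by simp) le_rfl ?_
      · simp [numRegs, e16]; omega
      · rintro _ σ' rfl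
        simp [hi, eh, e23] at hc
        refine ⟨?_, ?_, Keep.refl.put (by simp)⟩
        · rw [AbsState.put_a, if_pos ⟨rfl, rfl⟩, dif_pos hk, addClass, if_pos hc]
        · intro i hik
          rw [AbsState.put_a, if_neg (by tauto)]
    · refine (Det.assign hw0 (by norm_num [numRegs]) (by simp)).weaken (by simp) le_rfl ?_
      rintro _ σ' rfl
      simp [hi, eh, e23] at hc
      refine ⟨?_, by simp, Keep.refl.set (by norm_num)⟩
      rw [AbsState.set_a, el, dif_pos hk, addClass, if_neg hc]
  · rintro _ σ' ⟨h1, h2⟩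
    exact ⟨fun i => by rw [h1 i i.2, dif_pos i.2], h2⟩

theorem searchCode_spec {h : Fin n → ℕ} {lab : Lab n} {s R ell M j rows : ℕ} {tab : ℕ → Vec n}
    (hF : Fits w n rows) (hM : 22 + M ≤ rows) (hj : j < M) (hM2 : 23 + M < 2 ^ w)
    (hR : (ell + 1) * R < 2 ^ w) (hell : ell < 2 ^ w) (hs : 4 * 2 ^ s < 2 ^ w) (h0 : σ.v 0 = n)
    (h5 : σ.v 5 = R) (h6 : σ.v 6 = ell) (h16 : σ.v 16 = 2 ^ s)
    (h20 : σ.v 20 = (classSum f lab s 2 (tab 0)).val) (h21 : σ.v 21 = j)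
    (hhash : HoldsHash σ h) (hlab : HoldsLab σ lab) (htab : HoldsTab σ M tab) :
    Det w f D searchCode σ (fun σ' =>
        σ'.v 23 = searchBlock f lab s h (tab j) (tab 0) R ell ∧ Keep 23 {0, 1} σ σ')
      (ell * (2 ^ s * (n * 131 + 200) + n * 130 + 300) + 100) (ell * 2 ^ s) := by
  have hw0 := hF.pos
  have h64 := hF.le_two_pow
  have h24 := hF.le_rows
  refine Ref.bound (Ref.assign_seq hw0 (by norm_num [numRegs]) (by simp)
    (Ref.assign_seq hw0 (by norm_num [numRegs]) (by simp [numRegs])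
    (Ref.weaken (Det.forLoop (i := 25) (b := 6) (N := ell)
      (T := 2 ^ s * (n * 131 + 200) + n * 130 + 270) (Q := 2 ^ s)
      (R := fun k σ' => σ'.v 23 = searchBlock f lab s h (tab j) (tab 0) R k ∧
        σ'.v 24 = R / 2 ^ k ∧ Keep 23 {0, 1} σ σ')
      hw0 (by norm_num [numRegs]) (by norm_num [numRegs]) (by norm_num) hell ?_ ?_ ?_)
      le_rfl le_rfl ?_))) ?_ ?_
  · simp [AbsState.set_v, h6]
  · refine ⟨by simp [AbsState.set_v, searchBlock], by simp [AbsState.set_v, h5],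
      ((Keep.refl.set (by norm_num)).set (by norm_num)).set (by norm_num)⟩
  · intro k hk σ₁ hi hb ⟨h23, h24', hkeep⟩
    have hlo := searchBlock_le f lab s h (tab j) (tab 0) R k
    have hsz : R / 2 ^ (k + 1) ≤ R := Nat.div_le_self _ _
    have hlt : searchBlock f lab s h (tab j) (tab 0) R k + R / 2 ^ (k + 1) < 2 ^ w := by
      have : (k + 1) * R ≤ (ell + 1) * R := Nat.mul_le_mul_right _ (by omega)
      rw [add_mul, one_mul] at this
      omega
    refine Ref.bound (Det.seq (Det.assign_eq hw0 (x := R / 2 ^ (k + 1)) (by norm_num [numRegs])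
        (by simp [numRegs]; omega) (by simp [h24', Nat.div_div_eq_div_mul, pow_succ]))
        (T' := 2 ^ s * (n * 131 + 200) + n * 130 + 230) (Q' := 2 ^ s) ?_) (by simp; omega) (by simp)
    rintro σ₂ rfl
    have k2 : Keep 23 {0, 1} σ (σ₁.set 24 (R / 2 ^ (k + 1))) := hkeep.set (by norm_num)
    refine Ref.bound (Det.seq (hybridCode_spec hF hM hj hM2 hlt (by rw [k2.1 0 (by norm_num), h0])
      (by rw [k2.1 21 (by norm_num), h21]) (by simp [AbsState.set_v, h23])
      (hhash.of_keep k2 (by simp)) (htab.of_keep k2 (by simp)))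
      (T' := 2 ^ s * (n * 131 + 200) + 190) (Q' := 2 ^ s) ?_) (by omega) (by simp)
    rintro σ₃ ⟨hhyb, k3⟩
    have k3' : Keep 23 {0, 1} σ σ₃ := k2.trans k3 (by norm_num) (by simp)
    refine Ref.bound (Det.seq (Det.assign_eq hw0 (x := 2) (by norm_num [numRegs])
        (by simp; omega) (by simp))
        (T' := 2 ^ s * (n * 131 + 200) + 170) (Q' := 2 ^ s) ?_) (by simp; omega) (by simp)
    rintro σ₄ rfl
    refine Ref.bound (Det.seq (Det.assign_eq hw0 (x := 1) (by norm_num [numRegs])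
        (by simp; omega) (by simp))
        (T' := 2 ^ s * (n * 131 + 200) + 150) (Q' := 2 ^ s) ?_) (by simp; omega) (by simp)
    rintro σ₄ rfl
    have k4' : Keep 26 {0, 1} σ₃ ((σ₃.set 30 2).set 31 1) :=
      (Keep.refl.set (by norm_num)).set (by norm_num)
    have k4 := k3'.trans k4' (by norm_num) le_rfl
    refine Ref.bound (Det.seq (sumCode_spec hF (lab := lab) (s := s) (skip := 2) (K := 1)
        (base := hybrid h (searchBlock f lab s h (tab j) (tab 0) R k + R / 2 ^ (k + 1))
          (tab j) (tab 0)) hs ?_ ?_ ?_ ?_ (by omega) (by omega) (hlab.of_keep k4 (by simp))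
        hhyb) (T' := 60) (Q' := 0) ?_) (by omega) (by simp)
    · rw [k4.1 0 (by norm_num), h0]
    · rw [k4.1 16 (by norm_num), h16]
    · simp [AbsState.set_v]
    · simp [AbsState.set_v]
    rintro σ₅ ⟨e40, k5⟩
    have kk5 : Keep 23 {0, 1} σ σ₅ := k4.trans k5 (by norm_num) (by simp)
    have k35 : Keep 26 {0, 1} σ₃ σ₅ := k4'.trans k5 (by norm_num) (by simp)
    have e20 : σ₅.v 20 = (classSum f lab s 2 (tab 0)).val := by rw [kk5.1 20 (by norm_num), h20]
    have e6 : σ₅.v 6 = ell := by rw [kk5.1 6 (by norm_num), h6]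
    have e23 : σ₅.v 23 = searchBlock f lab s h (tab j) (tab 0) R k := by
      rw [k35.1 23 (by norm_num), k3.1 23 (by norm_num)]; simp [AbsState.set_v, h23]
    have e24 : σ₅.v 24 = R / 2 ^ (k + 1) := by
      rw [k35.1 24 (by norm_num), k3.1 24 (by norm_num)]; simp [AbsState.set_v]
    have e25 : σ₅.v 25 = k := by
      rw [k35.1 25 (by norm_num), k3.1 25 (by norm_num)]; simp [AbsState.set_v, hi]
    refine Ref.bound (Ref.cond hw0 (T := 20) (T' := 20) (Q := 0) (Q' := 0) (by simp [numRegs])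
      (fun hc => ?_) (fun hc => ?_)) (by simp) (by simp)
    · refine (Det.assign_eq hw0 (by norm_num [numRegs])
        (x := searchBlock f lab s h (tab j) (tab 0) R k + R / 2 ^ (k + 1))
        (by simp [numRegs, e23, e24, hlt]) (by simp [e23, e24])).weaken (by simp) le_rfl ?_
      rintro _ σ' rfl
      simp [e40, e20, (ZMod.val_injective 2).eq_iff] at hc
      simp [AbsState.set_v, e25, e6, e24, searchBlock, hc]
      exact ((kk5.set (by norm_num)).set (by norm_num))
    · refine (Det.assign_eq hw0 (by norm_num [numRegs])
        (x := searchBlock f lab s h (tab j) (tab 0) R k)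
        (by simp [numRegs]) (by simp [e23])).weaken (by simp) le_rfl ?_
      rintro _ σ' rfl
      simp [e40, e20, (ZMod.val_injective 2).eq_iff] at hc
      simp [AbsState.set_v, e25, e6, e24, searchBlock, hc]
      exact ((kk5.set (by norm_num)).set (by norm_num))
  · rintro _ σ' ⟨h1, _, h3⟩
    exact ⟨h1, h3⟩
  · simp
    have : ell * (2 ^ s * (n * 131 + 200) + n * 130 + 270 + 30) =
      ell * (2 ^ s * (n * 131 + 200) + n * 130 + 300) := by ring
    omega
  · simp

end Search

/-! ### Reading the classes -/

/-- The process that fills a vector with independent samples. -/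
def fillP {β : Type} [Inhabited β] (ν : PMF β) (N : ℕ) : PMF (Fin N → β) :=
  loopP (fun k g => ν.map fun b i => if (i : ℕ) = k then b else g i) 0 N fun _ => default

/-- Three independent random bits. -/
def coin3P : PMF (ZMod 2 × ZMod 2 × ZMod 2) :=
  coinP.bind fun u => coinP.bind fun v => coinP.map fun z => (u, v, z)

/-- Restriction to the variables labelled `l`. -/
def mask {n : ℕ} (lab : Lab n) (l : ℕ) (u : Vec n) : Vec n := fun i => if lab i = l then u i else 0

/-- The function tested to be a literal of the class labelled `l`. -/
def classFun {n : ℕ} (f : BoolFun n) (lab : Lab n) (s l : ℕ) (u : Vec n) : ZMod 2 :=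
  classSum f lab s l (mask lab l u)

/-- The consistency test for reading the variable that a function depends on. -/
def LiteralTest {n : ℕ} (φ : Vec n → ZMod 2) (x u v z : Vec n) : Prop :=
  φ u + φ v + φ (u + v) + φ 0 = 0 ∧ φ z + φ (z + u * v) = (φ u + φ 0) * (φ v + φ 0) ∧
    φ z + φ (z + 1) = 1 ∧ φ z + φ (z + x) = φ x + φ 0

instance {n : ℕ} (φ : Vec n → ZMod 2) (x u v z : Vec n) : Decidable (LiteralTest φ x u v z) :=
  inferInstanceAs (Decidable (_ ∧ _ ∧ _ ∧ _))

/-- The points at which `LiteralTest` evaluates the function. -/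
def testVec {n : ℕ} (x u v z : Vec n) : ℕ → Vec n
  | 0 => u
  | 1 => v
  | 2 => u + v
  | 3 => 0
  | 4 => z
  | 5 => z + u * v
  | 6 => z + 1
  | 7 => z + x
  | _ => x

/-- Test the class `j` and record the bit read from it. -/
def readStep {n : ℕ} (f : BoolFun n) (lab : Lab n) (s : ℕ) (x : Vec n) (j : ℕ) (q : Bool × ℕ) :
    PMF (Bool × ℕ) :=
  (fillP coin3P n).map fun g =>
    (q.1 && decide (LiteralTest (classFun f lab s (4 * 2 ^ j)) x (fun i => (g i).1)
        (fun i => (g i).2.1) fun i => (g i).2.2),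
      q.2 + 4 * 2 ^ j *
        (classFun f lab s (4 * 2 ^ j) x + classFun f lab s (4 * 2 ^ j) 0).val)

/-- Fix the class variables to the bits of `A`. -/
def collapse {n : ℕ} (lab : Lab n) (A : ℕ) : Lab n :=
  fun i => if lab i = 2 then 2 else A / lab i % 2

/-- Code that draws the test vectors of the class labelled by the register `29`. -/
def drawCode : Prog :=
  forLoop 26 0 (
    .coin 32 ;; .coin 33 ;; .coin 34 ;;
    assign 35 ((Expr.get (.c 20) (.v 26)).eqE (.v 29)) ;;
    assign 32 (.v 32 * .v 35) ;; assign 33 (.v 33 * .v 35) ;; assign 34 (.v 34 * .v 35) ;;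
    assign 38 (.get (.c 21) (.v 26) * .v 35) ;;
    put (.c 2) (.v 26) (.v 32) ;; put (.c 3) (.v 26) (.v 33) ;;
    put (.c 4) (.v 26) ((.v 32 + .v 33) % .c 2) ;; put (.c 5) (.v 26) (.c 0) ;;
    put (.c 6) (.v 26) (.v 34) ;; put (.c 7) (.v 26) ((.v 34 + .v 32 * .v 33) % .c 2) ;;
    put (.c 8) (.v 26) ((.v 34 + .v 35) % .c 2) ;; put (.c 9) (.v 26) ((.v 34 + .v 38) % .c 2) ;;
    put (.c 10) (.v 26) (.v 38))

/-- Code that evaluates the function at the test vectors. -/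
def evalTestCode : Prog :=
  assign 30 (.v 29) ;; assign 37 (.c 9) ;;
  forLoop 36 37 (
    assign 31 (.c 2 + .v 36) ;; sumCode ;; put (.c 11 + .v 36) (.c 0) (.v 40))

/-- The value at the test vector `e`. -/
def testVal (e : ℕ) : Expr := .get (.c (11 + e)) (.c 0)

/-- Code for the verdict of `LiteralTest` and for the bit read. -/
def verdictCode : Prog :=
  assign 13 (.v 13 * ((testVal 0 + testVal 1 + testVal 2 + testVal 3) % .c 2).eqE (.c 0)) ;;
  assign 13 (.v 13 * ((testVal 4 + testVal 5) % .c 2).eqE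
    ((testVal 0 + testVal 3) % .c 2 * ((testVal 1 + testVal 3) % .c 2))) ;;
  assign 13 (.v 13 * ((testVal 4 + testVal 6) % .c 2).eqE (.c 1)) ;;
  assign 13 (.v 13 * ((testVal 4 + testVal 7) % .c 2).eqE ((testVal 8 + testVal 3) % .c 2)) ;;
  assign 27 (.v 27 + .v 29 * ((testVal 8 + testVal 3) % .c 2)) ;;
  assign 29 (.v 29 * .c 2)

/-- Code for `collapse`. -/
def collapseCode : Prog :=
  forLoop 28 0 (
    cond ((Expr.get (.c 20) (.v 28)).eqE (.c 2)) (assign 40 (.c 0))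
      (put (.c 20) (.v 28) (.v 27 / .get (.c 20) (.v 28) % .c 2)))

/-- Code that reads all classes and collapses them. -/
def readCode : Prog :=
  assign 27 (.c 1) ;; assign 29 (.c 4) ;;
  forLoop 28 15 (drawCode ;; evalTestCode ;; verdictCode) ;; collapseCode

section Read

variable {w n : ℕ} {f : BoolFun n} {D : PMF (Cube n)} {σ : AbsState} {β : Type} {p : Prog}

theorem Det.ret {R : β → AbsState → Prop} {T Q : ℕ} (b : β) (h : Det w f D p σ (R b) T Q) :
    Ref w f D p σ (PMF.pure b) R T Q := by
  have := Ref.map (R' := R) h (fun _ => b) (fun _ _ h => h)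
  rwa [PMF.pure_map] at this

theorem drawCode_spec {lab : Lab n} {l rows : ℕ} {x : Vec n} (hF : Fits w n rows)
    (h0 : σ.v 0 = n) (h29 : σ.v 29 = l) (hlab : HoldsLab σ lab) (hx : HoldsVec σ 21 x) :
    Ref w f D drawCode σ (fillP coin3P n) (fun g σ' =>
      (∀ e < 9, HoldsVec σ' (2 + e) (mask lab l (testVec x (fun i => (g i).1)
        (fun i => (g i).2.1) (fun i => (g i).2.2) e))) ∧
      (∀ r < 32, r ≠ 26 → σ'.v r = σ.v r) ∧ ∀ k, k ∉ Set.Ico 2 11 → σ'.a k = σ.a k)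
      (n * 1000 + 30) 0 := by
  have hw0 := hF.pos
  have h64 := hF.le_two_pow
  have h24 := hF.le_rows
  refine (Ref.forLoop (i := 26) (b := 0) (N := n) (T := 900) (Q := 0)
    (R := fun k g σ' => (∀ i : Fin n, (i : ℕ) < k → ∀ e < 9, σ'.a (2 + e) i =
      (mask lab l (testVec x (fun i => (g i).1)
        (fun i => (g i).2.1) (fun i => (g i).2.2) e) i).val) ∧
      (∀ r < 32, r ≠ 26 → σ'.v r = σ.v r) ∧ ∀ k, k ∉ Set.Ico 2 11 → σ'.a k = σ.a k)
    hw0 (by norm_num [numRegs]) (by norm_num [numRegs]) (by norm_num) hF.lt h0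
    ⟨by simp, fun r hr hr' => by simp [AbsState.set_v, hr'], by simp⟩ ?_).weaken (by omega)
      (by simp) ?_
  · intro k hk g σ₁ hi hb ⟨hR, hkr, hka⟩
    have eL : σ₁.a 20 k = lab ⟨k, hk⟩ := by rw [hka 20 (by simp)]; exact hlab ⟨k, hk⟩
    have eX : σ₁.a 21 k = (x ⟨k, hk⟩).val := by rw [hka 21 (by simp)]; exact hx ⟨k, hk⟩
    have e29 : σ₁.v 29 = l := by rw [hkr 29 (by norm_num) (by norm_num), h29]
    have hrow : ∀ j ≤ 21, (j + 1) * n ≤ 2 ^ w := fun j hj => hF.row (by omega)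
    have r20 := hrow 20 (by norm_num)
    have r21 := hrow 21 (by norm_num)
    have hmap : (coin3P.map fun b (i : Fin n) => if (i : ℕ) = k then b else g i) =
        coinP.bind fun u => coinP.bind fun v => coinP.bind fun z =>
          PMF.pure (fun i : Fin n => if (i : ℕ) = k then (u, v, z) else g i) := by
      simp only [coin3P, PMF.map_bind, PMF.map_comp]
      rfl
    rw [hmap]
    refine Ref.bound (Ref.seq (Ref.coin hw0 (by norm_num [numRegs])) (T' := 800) (Q' := 0)
      fun u σ₂ hσ₂ => Ref.bound (Ref.seq (Ref.coin hw0 (by norm_num [numRegs])) (T' := 790) (Q' := 0)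
      fun v σ₃ hσ₃ => Ref.bound (Ref.seq (Ref.coin hw0 (by norm_num [numRegs])) (T' := 780) (Q' := 0)
      fun z σ₄ hσ₄ => Det.ret _ ?_) (by norm_num) (by norm_num)) (by norm_num) (by norm_num))
      (by norm_num) (by norm_num)
    subst hσ₂ hσ₃ hσ₄
    -- The bit `c` indicates whether the current variable belongs to the class; masking a vector
    -- multiplies the entry by `c`.
    obtain ⟨c, hc⟩ : ∃ c : ZMod 2, c = if lab ⟨k, hk⟩ = l then 1 else 0 := ⟨_, rfl⟩
    have hone : (1 : ZMod 2).val = 1 := rfl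
    have hcval : (if σ₁.a 20 k = l then 1 else 0) = c.val := by
      rw [eL, hc]
      split_ifs <;> rfl
    have hlt : ∀ a : ZMod 2, a.val < 2 := fun a => ZMod.val_lt a
    have hmulval : ∀ a b : ZMod 2, a.val * b.val = (a * b).val := by decide
    have haddval : ∀ a b : ZMod 2, (a.val + b.val) % 2 = (a + b).val := by decide
    have hmad : ∀ a b d : ZMod 2, (d.val + a.val * b.val) % 2 = (d + a * b).val := by decide
    have hmul2 : ∀ a b : ZMod 2, a.val * b.val < 2 := fun a b => by rw [hmulval]; exact hlt _
    refine Ref.bound (Det.seq (Det.assign_eq hw0 (x := c.val) (by norm_num [numRegs]) ?_ ?_)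
      (T' := 740) (Q' := 0) ?_) (by simp) (by simp)
    · simp [numRegs, AbsState.set_v, hi, hb, hk, r20]; omega
    · simp [AbsState.set_v, hi, e29, hcval]
    rintro σ₂ rfl
    refine Ref.bound (Det.seq (Det.assign_eq hw0 (x := (u * c).val) (by norm_num [numRegs]) ?_ ?_)
      (T' := 720) (Q' := 0) ?_) (by simp) (by simp)
    · simp [numRegs, AbsState.set_v]
      have := hmul2 u c
      omega
    · simp [AbsState.set_v, hmulval]
    rintro σ₂ rfl
    refine Ref.bound (Det.seq (Det.assign_eq hw0 (x := (v * c).val) (by norm_num [numRegs]) ?_ ?_)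
      (T' := 700) (Q' := 0) ?_) (by simp) (by simp)
    · simp [numRegs, AbsState.set_v]
      have := hmul2 v c
      omega
    · simp [AbsState.set_v, hmulval]
    rintro σ₂ rfl
    refine Ref.bound (Det.seq (Det.assign_eq hw0 (x := (z * c).val) (by norm_num [numRegs]) ?_ ?_)
      (T' := 680) (Q' := 0) ?_) (by simp) (by simp)
    · simp [numRegs, AbsState.set_v]
      have := hmul2 z c
      omega
    · simp [AbsState.set_v, hmulval]
    rintro σ₂ rfl
    refine Ref.bound (Det.seq (Det.assign_eq hw0 (x := (x ⟨k, hk⟩ * c).val) (by norm_num [numRegs])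
      ?_ ?_) (T' := 640) (Q' := 0) ?_) (by simp) (by simp)
    · simp [numRegs, AbsState.set_v, hi, hb, hk, r21, eX]
      have := hmul2 (x ⟨k, hk⟩) c
      omega
    · simp [AbsState.set_v, hi, eX, hmulval]
    rintro σ₂ rfl
    generalize hS : (((((((σ₁.set 32 u.val).set 33 v.val).set 34 z.val).set 35 c.val).set 32
      (u * c).val).set 33 (v * c).val).set 34 (z * c).val).set 38 (x ⟨k, hk⟩ * c).val = S
    have s0 : S.v 0 = n := by rw [← hS]; simp [AbsState.set_v, hb]
    have s26 : S.v 26 = k := by rw [← hS]; simp [AbsState.set_v, hi]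
    have s32 : S.v 32 = (u * c).val := by rw [← hS]; simp [AbsState.set_v]
    have s33 : S.v 33 = (v * c).val := by rw [← hS]; simp [AbsState.set_v]
    have s34 : S.v 34 = (z * c).val := by rw [← hS]; simp [AbsState.set_v]
    have s35 : S.v 35 = c.val := by rw [← hS]; simp [AbsState.set_v]
    have s38 : S.v 38 = (x ⟨k, hk⟩ * c).val := by rw [← hS]; simp [AbsState.set_v]
    have sreg : ∀ r < 32, S.v r = σ₁.v r := by
      intro r hr
      rw [← hS]
      simp only [AbsState.set_v]
      repeat rw [if_neg (by omega)]
    have sa : S.a = σ₁.a := by rw [← hS]; rfl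
    clear hS
    have hputs : ∀ {K : ℕ} {e : Expr} {y : ℕ} {p : Prog} {σ' : AbsState}
        {R : Unit → AbsState → Prop} {T : ℕ}, K ≤ 21 → σ'.v = S.v → e.Ok w n σ' → e.eval σ' = y →
        Ref w f D p (σ'.put K k y) (PMF.pure ()) R T 0 →
        Ref w f D (put (.c K) (.v 26) e ;; p) σ' (PMF.pure ()) R (T + e.cost + 20) 0 := by
      intro K e y p σ' R T hK hv he hy h
      refine Ref.bound (Det.seq (Det.put_eq hw0 (kk := K) (ii := k) (x := y) he (by simp; omega)
        (by simp [numRegs]) (by simp) (by simp [hv, s26]) hy hk (hrow K hK) (by rw [hv, s0]))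
        (T' := T) (Q' := 0) ?_) (by simp; omega) (by simp)
      rintro σ₂ rfl
      exact h
    refine Ref.bound (hputs (y := (u * c).val) (by norm_num) rfl (by simp [numRegs]) (by simp [s32])
      (hputs (y := (v * c).val) (by norm_num) rfl (by simp [numRegs]) (by simp [s33])
      (hputs (y := (u * c + v * c).val) (by norm_num) rfl ?_ (by simp [s32, s33, haddval])
      (hputs (y := 0) (by norm_num) rfl (by simp) (by simp)
      (hputs (y := (z * c).val) (by norm_num) rfl (by simp [numRegs]) (by simp [s34])
      (hputs (y := (z * c + (u * c) * (v * c)).val) (by norm_num) rfl ?_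
        (by simp [s34, s32, s33, hmad])
      (hputs (y := (z * c + c).val) (by norm_num) rfl ?_ (by simp [s34, s35, haddval])
      (hputs (y := (z * c + x ⟨k, hk⟩ * c).val) (by norm_num) rfl ?_ (by simp [s34, s38, haddval])
      (Ref.weaken (Det.put_eq hw0 (kk := 10) (ii := k) (x := (x ⟨k, hk⟩ * c).val) (by simp [numRegs])
        (by simp; omega) (by simp [numRegs]) (by simp) (by simp [s26]) (by simp [s38]) hk
        (hrow 10 (by norm_num)) (by simp [s0])) (T' := 30) ?_ le_rfl ?_)))))))))
      (by simp) le_rfl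
    · have := hlt (u * c)
      have := hlt (v * c)
      simp [numRegs, s32, s33]; omega
    · have := hlt (z * c)
      have := hmul2 (u * c) (v * c)
      simp [numRegs, s34, s32, s33]; omega
    · have := hlt (z * c)
      have := hlt c
      simp [numRegs, s34, s35]; omega
    · have := hlt (z * c)
      have := hlt (x ⟨k, hk⟩ * c)
      simp [numRegs, s34, s38]; omega
    · simp
    · rintro _ σ' rfl
      simp only [AbsState.put_v]
      refine ⟨s26, s0, ?_, ?_, ?_⟩
      · intro i hik e he
        rw [AbsState.set_a]
        by_cases h : (i : ℕ) = k
        · have hi' : i = ⟨k, hk⟩ := Fin.ext h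
          subst hi'
          have hmask : ∀ y : Vec n, mask lab l y ⟨k, hk⟩ = y ⟨k, hk⟩ * c := by
            intro y
            rw [mask, hc]
            split_ifs <;> simp
          -- Idempotence makes masking compatible with the pointwise product, so the code may mask u
          -- and v first and multiply afterwards.
          have hcc : c * c = c := by
            rw [hc]
            split_ifs <;> simp
          rw [hmask]
          simp only [AbsState.put_a]
          interval_cases e <;> simp [testVec, add_mul]
          rw [show u * c * (v * c) = u * v * (c * c) by ring, hcc]
        · have h1 : (mask lab l (testVec x (fun i : Fin n => (if (i : ℕ) = k then (u, v, z) else g i).1)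
              (fun i => (if (i : ℕ) = k then (u, v, z) else g i).2.1)
              (fun i => (if (i : ℕ) = k then (u, v, z) else g i).2.2) e) i).val =
              (mask lab l (testVec x (fun i => (g i).1) (fun i => (g i).2.1)
                (fun i => (g i).2.2) e) i).val := by
            unfold mask testVec
            split_ifs
            · split <;> simp [h]
            · rfl
          rw [h1, ← hR i (by omega) e he]
          simp [AbsState.put_a, h, sa]
      · intro r hr hr'
        rw [AbsState.set_v, if_neg hr']
        simp only [AbsState.put_v]
        rw [sreg r hr, hkr r hr hr']
      · intro j hj
        funext i
        have hj' : ∀ q, 2 ≤ q → q < 11 → j ≠ q := by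
          rintro q h1 h2 rfl
          exact hj ⟨h1, h2⟩
        simp only [AbsState.set_a, AbsState.put_a, hj' 2 (by norm_num) (by norm_num),
          hj' 3 (by norm_num) (by norm_num), hj' 4 (by norm_num) (by norm_num),
          hj' 5 (by norm_num) (by norm_num), hj' 6 (by norm_num) (by norm_num),
          hj' 7 (by norm_num) (by norm_num), hj' 8 (by norm_num) (by norm_num),
          hj' 9 (by norm_num) (by norm_num), hj' 10 (by norm_num) (by norm_num), false_and,
          if_false, sa]
        rw [hka j hj]
  · rintro g σ' ⟨h1, h2, h3⟩
    exact ⟨fun e he i => h1 i i.2 e he, h2, h3⟩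

theorem evalTestCode_spec {lab : Lab n} {s l rows : ℕ} {base : ℕ → Vec n} (hF : Fits w n rows)
    (hn : 0 < n) (hs : 4 * 2 ^ s < 2 ^ w)
    (h0 : σ.v 0 = n) (h16 : σ.v 16 = 2 ^ s) (h29 : σ.v 29 = l) (hlab : HoldsLab σ lab)
    (hbase : ∀ e < 9, HoldsVec σ (2 + e) (base e)) :
    Det w f D evalTestCode σ (fun σ' => (∀ e < 9, σ'.a (11 + e) 0 =
        (classSum f lab s l (base e)).val) ∧ Keep 30 (insert 0 (Set.Ico 11 20)) σ σ')
      (9 * (2 ^ s * (n * 131 + 200) + 150) + 70) (9 * 2 ^ s) := by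
  have hw0 := hF.pos
  have h64 := hF.le_two_pow
  have h24 := hF.le_rows
  refine Ref.bound (Ref.assign_seq hw0 (by norm_num [numRegs]) (by simp [numRegs])
    (Ref.assign_seq hw0 (by norm_num [numRegs]) (by simp; omega)
    (Ref.weaken (Det.forLoop (i := 36) (b := 37) (N := 9)
      (T := 2 ^ s * (n * 131 + 200) + 120) (Q := 2 ^ s)
      (R := fun k σ' => (∀ e < k, σ'.a (11 + e) 0 = (classSum f lab s l (base e)).val) ∧
        σ'.v 30 = l ∧ Keep 30 (insert 0 (Set.Ico 11 20)) σ σ')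
      hw0 (by norm_num [numRegs]) (by norm_num [numRegs]) (by norm_num) (by omega) ?_ ?_ ?_)
      le_rfl le_rfl ?_))) ?_ ?_
  · simp [AbsState.set_v]
  · refine ⟨by simp, by simp [AbsState.set_v, h29],
      ((Keep.refl.set (by norm_num)).set (by norm_num)).set (by norm_num)⟩
  · intro k hk σ₁ hi hb ⟨hR, h30, hkeep⟩
    refine Ref.bound (Det.seq (Det.assign_eq hw0 (x := 2 + k) (by norm_num [numRegs])
        (by simp [numRegs, hi]; omega) (by simp [hi]))
        (T' := 2 ^ s * (n * 131 + 200) + 100) (Q' := 2 ^ s) ?_) (by simp; omega) (by simp)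
    rintro σ₂ rfl
    have k2 : Keep 30 (insert 0 (Set.Ico 11 20)) σ (σ₁.set 31 (2 + k)) := hkeep.set (by norm_num)
    refine Ref.bound (Det.seq (sumCode_spec hF (lab := lab) (s := s) (skip := l) (K := 2 + k)
        (base := base k) hs ?_ ?_ ?_ ?_ (by omega) (by omega) (hlab.of_keep k2 (by simp))
        ((hbase k hk).of_keep k2 (by simp; omega))) (T' := 40) (Q' := 0) ?_) (by omega) (by simp)
    · rw [k2.1 0 (by norm_num), h0]
    · rw [k2.1 16 (by norm_num), h16]
    · simp [AbsState.set_v, h30]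
    · simp [AbsState.set_v]
    rintro σ₃ ⟨e40, k3⟩
    have kk3 : Keep 30 (insert 0 (Set.Ico 11 20)) σ σ₃ := k2.trans k3 (by norm_num) (by simp)
    have e36 : σ₃.v 36 = k := by rw [k3.1 36 (by norm_num)]; simp [AbsState.set_v, hi]
    have e37 : σ₃.v 37 = 9 := by rw [k3.1 37 (by norm_num)]; simp [AbsState.set_v, hb]
    have e30 : σ₃.v 30 = l := by rw [k3.1 30 (by norm_num)]; simp [AbsState.set_v, h30]
    refine (Det.put_eq hw0 (kk := 11 + k) (ii := 0) (x := (classSum f lab s l (base k)).val)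
      (by simp [numRegs]) (by simp [numRegs, e36]; omega) (by simp) (by simp [e36]) (by simp)
      (by simp [e40]) hn (hF.row (by omega)) (by rw [kk3.1 0 (by norm_num), h0])).weaken (by simp)
      le_rfl ?_
    rintro _ σ' rfl
    refine ⟨by simpa using e36, by simpa using e37, ?_, by simp [AbsState.set_v, e30],
      (kk3.put (by simp; omega)).set (by norm_num)⟩
    intro e he
    rw [AbsState.set_a, AbsState.put_a]
    by_cases hek : e = k
    · subst hek; simp
    · rw [if_neg (by omega), k3.2 (11 + e) (by simp)]
      exact hR e (by omega)
  · rintro _ σ' ⟨h1, _, h3⟩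
    exact ⟨h1, h3⟩
  · simp; omega
  · simp

theorem verdictCode_spec {l A rows : ℕ} {acc : Bool} {y : ℕ → ZMod 2} (hF : Fits w n rows)
    (hn : 0 < n) (hl : l * 2 < 2 ^ w) (hA : A + l < 2 ^ w) (h0 : σ.v 0 = n)
    (h13 : σ.v 13 = acc.toNat) (h27 : σ.v 27 = A) (h29 : σ.v 29 = l)
    (hy : ∀ e < 9, σ.a (11 + e) 0 = (y e).val) :
    Det w f D verdictCode σ (fun σ' =>
        σ'.v 13 = (acc && decide (y 0 + y 1 + y 2 + y 3 = 0 ∧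
          y 4 + y 5 = (y 0 + y 3) * (y 1 + y 3) ∧ y 4 + y 6 = 1 ∧ y 4 + y 7 = y 8 + y 3)).toNat ∧
        σ'.v 27 = A + l * (y 8 + y 3).val ∧ σ'.v 29 = l * 2 ∧
        (∀ r, r ≠ 13 → r ≠ 27 → r ≠ 29 → σ'.v r = σ.v r) ∧ σ'.a = σ.a)
      600 0 := by
  have hw0 := hF.pos
  have h64 := hF.le_two_pow
  have h24 := hF.le_rows
  have hlt : ∀ a : ZMod 2, a.val < 2 := fun a => ZMod.val_lt a
  have hadd : ∀ a b : ZMod 2, (a.val + b.val) % 2 = (a + b).val := by decide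
  have hmul : ∀ a b : ZMod 2, a.val * b.val = (a * b).val := by decide
  have hadd4 : ∀ a b c d : ZMod 2, (a.val + b.val + c.val + d.val) % 2 = (a + b + c + d).val := by
    decide
  have hone : ∀ a : ZMod 2, a.val = 1 ↔ a = 1 := by decide
  have hb2 : ∀ b : Bool, b.toNat < 2 := by decide
  have hinj : ∀ a b : ZMod 2, a.val = b.val ↔ a = b := fun a b => (ZMod.val_injective 2).eq_iff
  have hite : ∀ (b : Bool) (P : Prop) [Decidable P],
      b.toNat * (if P then 1 else 0) = (b && decide P).toNat := by
    intro b P _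
    by_cases h : P <;> simp [h]
  have hok : ∀ e < 9, ∀ σ' : AbsState, σ'.v 0 = n → (testVal e).Ok w n σ' := by
    intro e he σ' h
    have := hF.row (k := 11 + e) (by omega)
    simp only [testVal, Expr.ok_get, Expr.ok_c, Expr.eval_c]
    exact ⟨by omega, by omega, hn, this, h⟩
  have hset : ∀ (e r x : ℕ) (σ' : AbsState),
      (testVal e).eval (σ'.set r x) = (testVal e).eval σ' := fun _ _ _ _ => rfl
  have hev : ∀ e < 9, (testVal e).eval σ = (y e).val := by
    intro e he
    simp only [testVal, Expr.eval_get, Expr.eval_c, hy e he]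
  have hc : ∀ e, (testVal e).cost = 9 := fun e => rfl
  have hboolmul : ∀ (b : Bool) (P : Prop) [Decidable P],
      b.toNat * (if P then 1 else 0) < 2 ^ w := by
    intro b P _
    rw [hite]
    have := hb2 (b && decide P)
    omega
  have l0 := hlt (y 0)
  have l1 := hlt (y 1)
  have l2 := hlt (y 2)
  have l3 := hlt (y 3)
  have l4 := hlt (y 4)
  have l5 := hlt (y 5)
  have l6 := hlt (y 6)
  have l7 := hlt (y 7)
  have l8 := hlt (y 8)
  refine Ref.bound (Det.seq (Det.assign_eq hw0
    (x := (acc && decide (y 0 + y 1 + y 2 + y 3 = 0)).toNat) (by norm_num [numRegs]) ?_ ?_)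
    (T' := 500) (Q' := 0) ?_) (by simp [hc]) (by simp)
  · simp [numRegs, hok, hev, h0, h13, -mul_ite, hboolmul]
    omega
  · simp [hev, h13, -mul_ite, hite, hadd4, ZMod.val_eq_zero]
  rintro σ₁ rfl
  refine Ref.bound (Det.seq (Det.assign_eq hw0
    (x := (acc && decide (y 0 + y 1 + y 2 + y 3 = 0) &&
      decide (y 4 + y 5 = (y 0 + y 3) * (y 1 + y 3))).toNat) (by norm_num [numRegs]) ?_ ?_)
    (T' := 400) (Q' := 0) ?_) (by simp [hc]) (by simp)
  · have := hlt ((y 0 + y 3) * (y 1 + y 3))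
    simp [numRegs, hok, hev, hset, h0, AbsState.set_v, -mul_ite, hboolmul, hadd, hmul]
    omega
  · simp [hev, hset, AbsState.set_v, -mul_ite, hite, hadd, hmul, hinj]
  rintro σ₁ rfl
  refine Ref.bound (Det.seq (Det.assign_eq hw0
    (x := (acc && decide (y 0 + y 1 + y 2 + y 3 = 0) &&
      decide (y 4 + y 5 = (y 0 + y 3) * (y 1 + y 3)) && decide (y 4 + y 6 = 1)).toNat)
    (by norm_num [numRegs]) ?_ ?_)
    (T' := 300) (Q' := 0) ?_) (by simp [hc]) (by simp)
  · simp [numRegs, hok, hev, hset, h0, AbsState.set_v, -mul_ite, hboolmul]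
    omega
  · simp [hev, hset, AbsState.set_v, -mul_ite, hite, hadd, hone]
  rintro σ₁ rfl
  refine Ref.bound (Det.seq (Det.assign_eq hw0
    (x := (acc && decide (y 0 + y 1 + y 2 + y 3 = 0) &&
      decide (y 4 + y 5 = (y 0 + y 3) * (y 1 + y 3)) && decide (y 4 + y 6 = 1) &&
      decide (y 4 + y 7 = y 8 + y 3)).toNat)
    (by norm_num [numRegs]) ?_ ?_)
    (T' := 200) (Q' := 0) ?_) (by simp [hc]) (by simp)
  · simp [numRegs, hok, hev, hset, h0, AbsState.set_v, -mul_ite, hboolmul]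
    omega
  · simp [hev, hset, AbsState.set_v, -mul_ite, hite, hadd, hinj]
  rintro σ₁ rfl
  have hl8 : l * (y 8 + y 3).val ≤ l := by
    have := hlt (y 8 + y 3)
    calc l * (y 8 + y 3).val ≤ l * 1 := Nat.mul_le_mul_left _ (by omega)
      _ = l := mul_one l
  refine Ref.bound (Det.seq (Det.assign_eq hw0 (x := A + l * (y 8 + y 3).val)
    (by norm_num [numRegs]) ?_ ?_) (T' := 50) (Q' := 0) ?_) (by simp [hc]) (by simp)
  · simp [numRegs, hok, hev, hset, h0, h27, h29, AbsState.set_v, hadd]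
    omega
  · simp [hev, hset, AbsState.set_v, h27, h29, hadd]
  rintro σ₁ rfl
  refine (Det.assign_eq hw0 (x := l * 2) (by norm_num [numRegs]) ?_ ?_).weaken (by simp) le_rfl ?_
  · simp [numRegs, h29, AbsState.set_v, hl]; omega
  · simp [AbsState.set_v, h29]
  rintro _ σ' rfl
  refine ⟨?_, by simp [AbsState.set_v], by simp [AbsState.set_v], ?_, rfl⟩
  · simp [AbsState.set_v, Bool.and_assoc]
  · intro r h1 h2 h3
    simp [AbsState.set_v, h1, h2, h3]

end Read

section ReadAll

variable {w n : ℕ} {f : BoolFun n} {D : PMF (Cube n)} {σ : AbsState}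

theorem collapseCode_spec {lab : Lab n} {A rows : ℕ} (hF : Fits w n rows)
    (h0 : σ.v 0 = n) (h27 : σ.v 27 = A) (hlab : HoldsLab σ lab) :
    Det w f D collapseCode σ (fun σ' => HoldsLab σ' (collapse lab A) ∧ Keep 28 {20} σ σ')
      (n * 130 + 30) 0 := by
  have hw0 := hF.pos
  have h64 := hF.le_two_pow
  have h24 := hF.le_rows
  refine (Det.fillRow (i := 28) (T := 100) (K := 20) (g := fun i => if hi : i < n then
    collapse lab A ⟨i, hi⟩ else 0) hF (by norm_num [numRegs]) (by norm_num) h0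
    ?_).weaken (by omega) le_rfl ?_
  · intro k hk σ₁ hi hkeep hold
    have e0 : σ₁.v 0 = n := by rw [hkeep.1 0 (by norm_num), h0]
    have e27 : σ₁.v 27 = A := by rw [hkeep.1 27 (by norm_num), h27]
    have el : σ₁.a 20 k = lab ⟨k, hk⟩ := by rw [hold k le_rfl]; exact hlab ⟨k, hk⟩
    have r20 := hF.row (k := 20) (by omega)
    refine Ref.bound (Ref.cond hw0 (T := 50) (T' := 50) (Q := 0) (Q' := 0) ?_ (fun hc => ?_)
      (fun hc => ?_)) (by simp) (by simp)
    · simp [numRegs, hi, e0, hk, r20]; omega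
    · refine (Det.assign hw0 (by norm_num [numRegs]) (by simp)).weaken (by simp) le_rfl ?_
      rintro _ σ' rfl
      simp [hi, el] at hc
      refine ⟨?_, by simp, Keep.refl.set (by norm_num)⟩
      rw [AbsState.set_a, el, dif_pos hk, collapse, if_pos hc, hc]
    · refine (Det.put_eq hw0 (kk := 20) (ii := k) (x := A / lab ⟨k, hk⟩ % 2) ?_ (by simp; omega)
        (by simp [numRegs]) (by simp) (by simp [hi]) (by simp [e27, hi, el]) hk r20 e0).weaken
        (by simp) le_rfl ?_
      · simp [numRegs, hi, e0, hk, r20]; omega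
      · rintro _ σ' rfl
        simp [hi, el] at hc
        refine ⟨?_, ?_, Keep.refl.put (by simp)⟩
        · rw [AbsState.put_a, if_pos ⟨rfl, rfl⟩, dif_pos hk, collapse, if_neg hc]
        · intro i hik
          rw [AbsState.put_a, if_neg (by tauto)]
  · rintro _ σ' ⟨h1, h2⟩
    exact ⟨fun i => by rw [h1 i i.2, dif_pos i.2], h2⟩

/-- The accumulator starts at 1 and the class labels at 4, so the bits read form a number 4B + 1.
Dividing it by an old label then also reproduces the variables fixed earlier, as in `pointOf`. The
invariant that the accumulator stays below 4 * 2^k after k classes excludes overflow. -/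
theorem readCode_spec {lab : Lab n} {s rows : ℕ} {x : Vec n} {acc : Bool} (hF : Fits w n rows)
    (hn : 0 < n) (hs : 8 * 2 ^ s < 2 ^ w) (h0 : σ.v 0 = n) (h13 : σ.v 13 = acc.toNat)
    (h15 : σ.v 15 = s) (h16 : σ.v 16 = 2 ^ s) (hlab : HoldsLab σ lab) (hx : HoldsVec σ 21 x) :
    Ref w f D readCode σ (loopP (readStep f lab s x) 0 s (acc, 1)) (fun q σ' =>
        σ'.v 13 = q.1.toNat ∧ HoldsLab σ' (collapse lab q.2) ∧
        (∀ r < 20, r ≠ 13 → σ'.v r = σ.v r) ∧ ∀ k, 21 ≤ k → σ'.a k = σ.a k)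
      (s * (9 * (2 ^ s * (n * 131 + 200)) + n * 1000 + 3000) + n * 130 + 200)
      (s * (9 * 2 ^ s)) := by
  have hw0 := hF.pos
  have h64 := hF.le_two_pow
  have h24 := hF.le_rows
  have hs2 : s < 2 ^ w := by
    have : s < 2 ^ s := Nat.lt_two_pow_self
    omega
  rw [← PMF.bind_pure (loopP (readStep f lab s x) 0 s (acc, 1))]
  refine Ref.bound (Ref.assign_seq hw0 (by norm_num [numRegs]) (by simp; omega)
    (Ref.assign_seq hw0 (by norm_num [numRegs]) (by simp; omega)
    (Ref.seq (ν := PMF.pure) (Ref.forLoop (x₀ := (acc, 1)) (ν := readStep f lab s x)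
      (i := 28) (b := 15) (N := s)
      (T := 9 * (2 ^ s * (n * 131 + 200)) + n * 1000 + 2950) (Q := 9 * 2 ^ s)
      (R := fun k (q : Bool × ℕ) σ' => σ'.v 13 = q.1.toNat ∧ σ'.v 27 = q.2 ∧ q.2 < 4 * 2 ^ k ∧
        σ'.v 29 = 4 * 2 ^ k ∧ (∀ r < 20, r ≠ 13 → σ'.v r = σ.v r) ∧
        ∀ k, 20 ≤ k → σ'.a k = σ.a k)
      hw0 (by norm_num [numRegs]) (by norm_num [numRegs]) (by norm_num) hs2 ?_ ?_ ?_)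
      (T' := n * 130 + 100) (Q' := 0) ?_))) ?_ ?_
  · simp [AbsState.set_v, h15]
  · refine ⟨by simp [AbsState.set_v, h13], by simp [AbsState.set_v], by norm_num,
      by simp [AbsState.set_v], ?_, by simp⟩
    intro r hr hr'
    simp only [AbsState.set_v]
    repeat rw [if_neg (by omega)]
  · rintro k hk ⟨acc', A⟩ σ₁ hi hb ⟨e13, e27, hA, e29, hkr, hka⟩
    simp only at e13 e27 hA
    have e0 : σ₁.v 0 = n := by rw [hkr 0 (by norm_num) (by norm_num), h0]
    have e16 : σ₁.v 16 = 2 ^ s := by rw [hkr 16 (by norm_num) (by norm_num), h16]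
    have hpow : 4 * 2 ^ k * 2 ≤ 4 * 2 ^ s := by
      have : 2 ^ (k + 1) ≤ 2 ^ s := Nat.pow_le_pow_right (by norm_num) hk
      rw [pow_succ] at this
      omega
    have elab' : HoldsLab σ₁ lab := fun i => by rw [hka 20 le_rfl, hlab i]
    refine Ref.bound (Ref.seq (ν := fun g => PMF.pure _) (drawCode_spec hF (lab := lab) (l := 4 * 2 ^ k) (x := x)
      e0 e29 elab' fun i => by rw [hka 21 (by norm_num), hx i])
      (T' := 9 * (2 ^ s * (n * 131 + 200)) + 2900) (Q' := 9 * 2 ^ s) ?_) (by omega) (by omega)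
    rintro g σ₂ ⟨hvec, hkr2, hka2⟩
    refine Det.ret _ ?_
    refine Ref.bound (Det.seq (evalTestCode_spec hF (lab := lab) (s := s) (l := 4 * 2 ^ k)
      (base := fun e => mask lab (4 * 2 ^ k) (testVec x (fun i => (g i).1) (fun i => (g i).2.1)
        (fun i => (g i).2.2) e)) hn (by omega) ?_ ?_ ?_ ?_ hvec) (T' := 1400) (Q' := 0) ?_)
      (by omega) (by omega)
    · rw [hkr2 0 (by norm_num) (by norm_num), e0]
    · rw [hkr2 16 (by norm_num) (by norm_num), e16]
    · rw [hkr2 29 (by norm_num) (by norm_num), e29]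
    · exact fun i => by rw [hka2 20 (by simp), elab' i]
    rintro σ₃ ⟨hval, k3⟩
    have hr3 : ∀ r < 30, r ≠ 26 → σ₃.v r = σ₁.v r := fun r hr hr' => by
      rw [k3.1 r hr, hkr2 r (by omega) hr']
    refine (verdictCode_spec hF (l := 4 * 2 ^ k) (A := A) (acc := acc')
      (y := fun e => classFun f lab s (4 * 2 ^ k) (testVec x (fun i => (g i).1) (fun i => (g i).2.1)
        (fun i => (g i).2.2) e)) hn (by omega) (by omega) ?_ ?_ ?_ ?_ hval).weaken (by norm_num)
        le_rfl ?_
    · rw [hr3 0 (by norm_num) (by norm_num), e0]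
    · rw [hr3 13 (by norm_num) (by norm_num), e13]
    · rw [hr3 27 (by norm_num) (by norm_num), e27]
    · rw [hr3 29 (by norm_num) (by norm_num), e29]
    rintro _ σ₄ ⟨v13, v27, v29, vr, va⟩
    refine ⟨?_, ?_, ?_, ?_, ?_, ?_, ?_, ?_⟩
    · rw [vr 28 (by norm_num) (by norm_num) (by norm_num), hr3 28 (by norm_num) (by norm_num), hi]
    · rw [vr 15 (by norm_num) (by norm_num) (by norm_num), hr3 15 (by norm_num) (by norm_num), hb]
    · simp only [AbsState.set_v]
      norm_num
      rw [v13]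
      rfl
    · simp only [AbsState.set_v]
      norm_num
      rw [v27]
      rfl
    · have : (classFun f lab s (4 * 2 ^ k) x + classFun f lab s (4 * 2 ^ k) 0).val < 2 :=
        ZMod.val_lt _
      have h2 : 4 * 2 ^ k * (classFun f lab s (4 * 2 ^ k) x + classFun f lab s (4 * 2 ^ k) 0).val
          ≤ 4 * 2 ^ k * 1 := Nat.mul_le_mul_left _ (by omega)
      simp only [pow_succ]
      omega
    · simp only [AbsState.set_v]
      norm_num
      rw [v29, pow_succ]
      ring
    · intro r hr hr'
      rw [AbsState.set_v, if_neg (by omega), vr r hr' (by omega) (by omega), hr3 r (by omega)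
        (by omega), hkr r hr hr']
    · intro j hj
      rw [AbsState.set_a, va, k3.2 j (by simp; omega), hka2 j (by simp; omega), hka j hj]
  · rintro ⟨acc', A⟩ σ₁ ⟨e13, e27, _, _, hkr, hka⟩
    refine Det.ret _ ?_
    refine (collapseCode_spec hF (lab := lab) (A := A) ?_ e27 ?_).weaken (by omega) le_rfl ?_
    · rw [hkr 0 (by norm_num) (by norm_num), h0]
    · exact fun i => by rw [hka 20 le_rfl, hlab i]
    rintro _ σ' ⟨h1, h2⟩
    refine ⟨?_, h1, ?_, ?_⟩
    · rw [h2.1 13 (by norm_num), e13]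
    · intro r hr hr'
      rw [h2.1 r (by omega), hkr r hr hr']
    · intro j hj
      rw [h2.2 j (by simp; omega), hka j (by omega)]
  · simp
    have : s * (9 * (2 ^ s * (n * 131 + 200)) + n * 1000 + 2950 + 30) ≤
      s * (9 * (2 ^ s * (n * 131 + 200)) + n * 1000 + 3000) := Nat.mul_le_mul_left _ (by omega)
    omega
  · simp

end ReadAll

/-! ### One step of the tester -/

/-- The number of bits of a block number. -/
def blockBits (d : ℕ) : ℕ := 2 * d + 4
/-- The number of blocks. -/
def numBlocks (d : ℕ) : ℕ := 2 ^ blockBits d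
/-- The factor by which the number of table rows exceeds `2 ^ d`. -/
def rowFactor (d : ℕ) : ℕ := 8 * (d + 1) ^ 3
/-- The number of table rows. -/
def numRows (d : ℕ) : ℕ := 2 ^ d * rowFactor d

/-- The state while an example is processed: whether no test has failed so far, and, unless the
processing has ended, the labels and the number of classes. -/
abbrev WalkState (n : ℕ) : Type := Bool × Option (Lab n × ℕ)

/-- One step: either the function looks constant and the classes are read, or a class is added. -/
def walkStep {n : ℕ} (f : BoolFun n) (d : ℕ) (h : Fin n → ℕ) (tab : ℕ → Vec n) (x : Vec n) :
    WalkState n → PMF (WalkState n)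
  | (acc, none) => PMF.pure (acc, none)
  | (acc, some (lab, s)) =>
    if scanIdx f lab s tab (2 ^ d / 2 ^ s * rowFactor d) = 0 then
      if s = 0 then PMF.pure (acc && decide (classSum f lab s 2 (tab 0) = fZ f x), none)
      else if classSum f lab s 2 (tab 0) = 0 then PMF.pure (false, none)
      else (loopP (readStep f lab s x) 0 s (acc, 1)).map fun q => (q.1, some (collapse lab q.2, 0))
    else if s < d then
      PMF.pure (acc, some (addClass lab h (searchBlock f lab s h
        (tab (scanIdx f lab s tab (2 ^ d / 2 ^ s * rowFactor d))) (tab 0) (numBlocks d)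
        (blockBits d)) s, s + 1))
    else PMF.pure (false, none)

/-- Reject and end the processing of the example. -/
def failCode : Prog := assign 13 (.c 0) ;; assign 14 (.c 1)

/-- Code for `walkStep`. -/
def walkCode : Prog :=
  cond (.v 14) (assign 40 (.c 0))
    (scanCode ;; cond (.v 21)
      (cond ((Expr.v 15).ltE (.v 1))
        (searchCode ;; addClassCode ;; assign 15 (.v 15 + .c 1) ;; assign 16 (.v 16 * .c 2) ;;
          assign 17 (.v 3 / .v 16 * .v 4))
        failCode)
      (cond (.v 15)
        (cond (.v 20)
          (readCode ;; assign 15 (.c 0) ;; assign 16 (.c 1) ;; assign 17 (.v 7)) failCode)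
        (assign 14 (.c 1) ;; assign 13 (.v 13 * (Expr.v 20).eqE (.v 10)))))

/-- The words are long enough for all numbers of the tester. -/
structure Big (w n d E : ℕ) : Prop where
  fits : Fits w n (22 + numRows d)
  rows_lt : 23 + numRows d < 2 ^ w
  blocks_lt : (blockBits d + 1) * numBlocks d < 2 ^ w
  pow_lt : 8 * 2 ^ d < 2 ^ w
  steps_lt : (d + 1) ^ 2 < 2 ^ w
  samples_lt : 80 * E < 2 ^ w

/-- The constants of the tester are in their registers, and the tables in their rows. -/
structure Consts {n : ℕ} (d : ℕ) (h : Fin n → ℕ) (tab : ℕ → Vec n) (σ : AbsState) : Prop where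
  v0 : σ.v 0 = n
  v1 : σ.v 1 = d
  v3 : σ.v 3 = 2 ^ d
  v4 : σ.v 4 = rowFactor d
  v5 : σ.v 5 = numBlocks d
  v6 : σ.v 6 = blockBits d
  v7 : σ.v 7 = numRows d
  hash : HoldsHash σ h
  table : HoldsTab σ (numRows d) tab

/-- The current state is represented in the registers `13` to `17` and in the label row. -/
def WalkRel {n : ℕ} (d : ℕ) (q : WalkState n) (σ : AbsState) : Prop :=
  σ.v 13 = q.1.toNat ∧ match q.2 with
    | none => σ.v 14 = 1
    | some (lab, s) => σ.v 14 = 0 ∧ σ.v 15 = s ∧ s ≤ d ∧ σ.v 16 = 2 ^ s ∧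
        σ.v 17 = 2 ^ d / 2 ^ s * rowFactor d ∧ HoldsLab σ lab

/-- The registers below `13` and the rows above `20` are unchanged. -/
def Stable (σ σ' : AbsState) : Prop := Keep 13 (Set.Iio 21) σ σ'

theorem Consts.stable {n d : ℕ} {h : Fin n → ℕ} {tab : ℕ → Vec n} {σ σ' : AbsState}
    (hc : Consts d h tab σ) (hs : Stable σ σ') : Consts d h tab σ' where
  v0 := by rw [hs.1 0 (by norm_num), hc.v0]
  v1 := by rw [hs.1 1 (by norm_num), hc.v1]
  v3 := by rw [hs.1 3 (by norm_num), hc.v3]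
  v4 := by rw [hs.1 4 (by norm_num), hc.v4]
  v5 := by rw [hs.1 5 (by norm_num), hc.v5]
  v6 := by rw [hs.1 6 (by norm_num), hc.v6]
  v7 := by rw [hs.1 7 (by norm_num), hc.v7]
  hash := hc.hash.of_keep hs (by simp)
  table := hc.table.of_keep hs (by simp; omega)

theorem numRows_pos (d : ℕ) : 8 ≤ numRows d := by
  have h1 : 1 ≤ 2 ^ d := Nat.one_le_two_pow
  have h2 : 1 ≤ (d + 1) ^ 3 := Nat.one_le_pow _ _ (by omega)
  unfold numRows rowFactor
  nlinarith

theorem div_mul_rowFactor_le {d s : ℕ} : 2 ^ d / 2 ^ s * rowFactor d ≤ numRows d :=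
  Nat.mul_le_mul_right _ (Nat.div_le_self _ _)

/-- The balance behind the query bound: 2^(d-s) * `rowFactor d` rows at 2^s queries each cost the
same for every s. Fewer rows suffice for larger s because the class sum has smaller degree. -/
theorem div_mul_rowFactor_mul {d s : ℕ} (hs : s ≤ d) :
    2 ^ d / 2 ^ s * rowFactor d * 2 ^ s = numRows d := by
  rw [mul_right_comm, Nat.div_mul_cancel (pow_dvd_pow 2 hs), numRows]

/-- A bound for the time of a step. -/
def stepTime (n d : ℕ) : ℕ := 12000 * (2 ^ d * (d + 1) ^ 3 * (n + 1))
/-- A bound for the number of queries of a step. -/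
def stepQueries (d : ℕ) : ℕ := 20 * (2 ^ d * (d + 1) ^ 3)

/-! ### Time and query bounds for one step. -/

section Bounds
variable {n d s : ℕ}

theorem le_cube (d : ℕ) : d + 1 ≤ (d + 1) ^ 3 := Nat.le_self_pow (by norm_num) _

theorem monomials_le (n d : ℕ) :
    2 ^ d * (d + 1) * (n + 1) ≤ 2 ^ d * (d + 1) ^ 3 * (n + 1) ∧
    2 ^ d * (n + 1) ≤ 2 ^ d * (d + 1) ^ 3 * (n + 1) ∧
    2 ^ d * (d + 1) ^ 3 ≤ 2 ^ d * (d + 1) ^ 3 * (n + 1) ∧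
    (d + 1) * (n + 1) ≤ 2 ^ d * (d + 1) ^ 3 * (n + 1) ∧
    n + 1 ≤ 2 ^ d * (d + 1) ^ 3 * (n + 1) := by
  have h1 : 1 ≤ 2 ^ d := Nat.one_le_two_pow
  have h3 := le_cube d
  have h2 : 1 ≤ (d + 1) ^ 3 := by omega
  refine ⟨?_, ?_, ?_, ?_, ?_⟩
  · gcongr
  · calc 2 ^ d * (n + 1) = 2 ^ d * 1 * (n + 1) := by ring
      _ ≤ _ := by gcongr
  · calc 2 ^ d * (d + 1) ^ 3 = 2 ^ d * (d + 1) ^ 3 * 1 := by ring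
      _ ≤ _ := by gcongr; omega
  · calc (d + 1) * (n + 1) = 1 * (d + 1) * (n + 1) := by ring
      _ ≤ _ := by gcongr
  · calc (n + 1) = 1 * 1 * (n + 1) := by ring
      _ ≤ _ := by gcongr

theorem classSum_time_le (hs : s ≤ d) : 2 ^ s * (n * 131 + 200) ≤ 200 * (2 ^ d * (n + 1)) :=
  calc 2 ^ s * (n * 131 + 200) ≤ 2 ^ d * (200 * (n + 1)) := by
        gcongr
        · norm_num
        · omega
    _ = _ := by ring

theorem scan_time_le (hs : s ≤ d) :
    (2 ^ d / 2 ^ s * rowFactor d + 1) * (2 ^ s * (n * 131 + 200) + 200) ≤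
      3700 * (2 ^ d * (d + 1) ^ 3 * (n + 1)) := by
  obtain ⟨h1, h2, h3, h4, h5⟩ := monomials_le n d
  have e1 := classSum_time_le (n := n) hs
  have e2 := div_mul_rowFactor_mul hs
  have e3 := div_mul_rowFactor_le (d := d) (s := s)
  have e5 : numRows d * (n * 131 + 200) ≤ 1600 * (2 ^ d * (d + 1) ^ 3 * (n + 1)) :=
    calc numRows d * (n * 131 + 200) ≤ numRows d * (200 * (n + 1)) := by gcongr; omega
      _ = _ := by rw [numRows, rowFactor]; ring
  have e6 : numRows d = 8 * (2 ^ d * (d + 1) ^ 3) := by rw [numRows, rowFactor]; ring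
  generalize 2 ^ d / 2 ^ s * rowFactor d = m at *
  have e4 : (m + 1) * (2 ^ s * (n * 131 + 200) + 200) =
      m * 2 ^ s * (n * 131 + 200) + m * 200 + (2 ^ s * (n * 131 + 200) + 200) := by ring
  rw [e4, e2]
  clear e4 e2
  generalize 2 ^ d * (d + 1) ^ 3 * (n + 1) = X at *
  generalize 2 ^ d * (d + 1) ^ 3 = Y at *
  generalize numRows d * (n * 131 + 200) = Z at *
  generalize 2 ^ s * (n * 131 + 200) = V at *
  generalize 2 ^ d * (n + 1) = U at *
  clear h1 h4
  omega

theorem search_time_le (hs : s ≤ d) :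
    blockBits d * (2 ^ s * (n * 131 + 200) + n * 130 + 300) + 100 ≤
      2200 * (2 ^ d * (d + 1) ^ 3 * (n + 1)) := by
  obtain ⟨h1, -, -, h4, h5⟩ := monomials_le n d
  have e1 := classSum_time_le (n := n) hs
  have : blockBits d * (2 ^ s * (n * 131 + 200) + n * 130 + 300) ≤
      4 * (d + 1) * (200 * (2 ^ d * (n + 1)) + 300 * (n + 1)) := by
    apply Nat.mul_le_mul
    · unfold blockBits; clear e1 h1 h4 h5; omega
    · linarith
  have e : 4 * (d + 1) * (200 * (2 ^ d * (n + 1)) + 300 * (n + 1)) =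
    800 * (2 ^ d * (d + 1) * (n + 1)) + 1200 * ((d + 1) * (n + 1)) := by ring
  rw [e] at this
  clear e e1
  generalize 2 ^ d * (d + 1) ^ 3 * (n + 1) = X at *
  generalize 2 ^ d * (d + 1) * (n + 1) = Y at *
  generalize (d + 1) * (n + 1) = Z at *
  linarith

theorem read_time_le (hs : s ≤ d) :
    s * (9 * (2 ^ s * (n * 131 + 200)) + n * 1000 + 3000) + n * 130 + 200 ≤
      5200 * (2 ^ d * (d + 1) ^ 3 * (n + 1)) := by
  obtain ⟨h1, -, -, h4, h5⟩ := monomials_le n d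
  have e1 := classSum_time_le (n := n) hs
  have : s * (9 * (2 ^ s * (n * 131 + 200)) + n * 1000 + 3000) ≤
      (d + 1) * (1800 * (2 ^ d * (n + 1)) + 3000 * (n + 1)) := by
    apply Nat.mul_le_mul
    · clear e1 h1 h4 h5; omega
    · linarith
  have e : (d + 1) * (1800 * (2 ^ d * (n + 1)) + 3000 * (n + 1)) =
    1800 * (2 ^ d * (d + 1) * (n + 1)) + 3000 * ((d + 1) * (n + 1)) := by ring
  rw [e] at this
  clear e e1
  generalize 2 ^ d * (d + 1) ^ 3 * (n + 1) = X at *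
  generalize 2 ^ d * (d + 1) * (n + 1) = Y at *
  generalize (d + 1) * (n + 1) = Z at *
  linarith

theorem scan_queries_le (hs : s ≤ d) :
    (2 ^ d / 2 ^ s * rowFactor d + 1) * 2 ^ s ≤ 9 * (2 ^ d * (d + 1) ^ 3) := by
  have e2 := div_mul_rowFactor_mul hs
  rw [add_mul, one_mul, e2, numRows, rowFactor]
  have : 2 ^ s ≤ 2 ^ d * (d + 1) ^ 3 :=
    calc 2 ^ s ≤ 2 ^ d := Nat.pow_le_pow_right (by norm_num) hs
      _ = 2 ^ d * 1 := by ring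
      _ ≤ _ := by gcongr; have := le_cube d; omega
  nlinarith

theorem search_queries_le (hs : s ≤ d) : blockBits d * 2 ^ s ≤ 4 * (2 ^ d * (d + 1) ^ 3) :=
  calc blockBits d * 2 ^ s ≤ 4 * (d + 1) ^ 3 * 2 ^ d := by
        apply Nat.mul_le_mul
        · have := le_cube d
          unfold blockBits
          omega
        · exact Nat.pow_le_pow_right (by norm_num) hs
    _ = _ := by ring

theorem read_queries_le (hs : s ≤ d) : s * (9 * 2 ^ s) ≤ 9 * (2 ^ d * (d + 1) ^ 3) :=
  calc s * (9 * 2 ^ s) ≤ (d + 1) ^ 3 * (9 * 2 ^ d) := by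
        apply Nat.mul_le_mul
        · have := le_cube d
          omega
        · gcongr
          norm_num
    _ = _ := by ring

end Bounds

section Walk

variable {w n : ℕ} {f : BoolFun n} {D : PMF (Cube n)} {σ : AbsState}

theorem failCode_spec (hw : 0 < w) {d : ℕ} :
    Det w f D failCode σ (fun σ' => WalkRel (n := n) d (false, none) σ' ∧ Stable σ σ') 20 0 := by
  have h1 : 1 < 2 ^ w := Nat.one_lt_two_pow hw.ne'
  refine Ref.bound (Ref.assign_seq hw (by norm_num [numRegs]) (by simp)
    (Ref.weaken (Det.assign hw (by norm_num [numRegs]) (by simpa using h1)) le_rfl le_rfl ?_))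
    (by simp) (by simp)
  rintro _ σ' rfl
  exact ⟨⟨by simp [AbsState.set_v], by simp [AbsState.set_v]⟩,
    (Keep.refl.set (by norm_num)).set (by norm_num)⟩

theorem walkCode_spec {d E : ℕ} {h : Fin n → ℕ} {tab : ℕ → Vec n} {x : Vec n} {q : WalkState n}
    (hB : Big w n d E) (hn : 0 < n) (hC : Consts d h tab σ) (hx : HoldsVec σ 21 x)
    (h10 : σ.v 10 = (fZ f x).val) (hq : WalkRel d q σ) :
    Ref w f D walkCode σ (walkStep f d h tab x q) (fun q' σ' => WalkRel d q' σ' ∧ Stable σ σ')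
      (stepTime n d) (stepQueries d) := by
  have hF := hB.fits
  have hw0 := hF.pos
  have h64 := hF.le_two_pow
  obtain ⟨hm1, hm2, hm3, hm4, hm5⟩ := monomials_le n d
  obtain ⟨acc, st⟩ := q
  obtain ⟨h13, hst⟩ := hq
  simp only at h13 hst
  rcases st with _ | ⟨lab, s⟩
  · simp only at hst
    refine Ref.bound (Ref.cond hw0 (T := 5) (T' := 0) (Q := 0) (Q' := 0) (by simp [numRegs])
      (fun _ => Det.ret _ ?_) (fun hc => ?_)) (by simp [stepTime]; omega) (by simp)
    · refine (Det.assign hw0 (by norm_num [numRegs]) (by simp)).weaken (by simp) le_rfl ?_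
      rintro _ σ' rfl
      exact ⟨⟨by simp [AbsState.set_v, h13], by simp [AbsState.set_v, hst]⟩,
        Keep.refl.set (by norm_num)⟩
    · simp [hst] at hc
  obtain ⟨h14, h15, hsd, h16, h17, hlab⟩ := hst
  have hpow : 2 ^ s ≤ 2 ^ d := Nat.pow_le_pow_right (by norm_num) hsd
  have hBpow := hB.pow_lt
  have hBrows := hB.rows_lt
  have hmle := div_mul_rowFactor_le (d := d) (s := s)
  set m := 2 ^ d / 2 ^ s * rowFactor d with hm
  have hm0 : 0 < m := by
    rw [hm]
    have h1 : 0 < 2 ^ d / 2 ^ s := Nat.div_pos hpow (by positivity)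
    have h2 : 0 < rowFactor d := by unfold rowFactor; positivity
    positivity
  have hR := numRows_pos d
  have hscan := scanCode_spec (f := f) (D := D) (σ := σ) hF (M := numRows d) (m := m) (s := s)
    (lab := lab) (tab := tab)
    (by omega) hmle (by omega) (by omega) (by omega) (by omega) hC.v0 h16 h17 hlab hC.table
  -- The scan takes 3700 units. What follows is either a reading with 5200 or a search with 2200 and
  -- an update of the labels, so 6000 suffices for it; both fit into the 12000 of `stepTime`.
  refine Ref.bound (T := (5 + (3700 * (2 ^ d * (d + 1) ^ 3 * (n + 1)) +
      6000 * (2 ^ d * (d + 1) ^ 3 * (n + 1)) + 1)) + 3 + 2)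
      (Q := 0 + (9 * (2 ^ d * (d + 1) ^ 3) + 9 * (2 ^ d * (d + 1) ^ 3)))
    ?_ (by unfold stepTime; omega) (by unfold stepQueries; omega)
  refine Ref.bound (Ref.cond hw0 (T := 0) (Q := 0) (by simp [numRegs])
    (fun hc => ?_) (fun _ => Det.seq (hscan.bound (scan_time_le hsd) (scan_queries_le hsd))
      (T' := 6000 * (2 ^ d * (d + 1) ^ 3 * (n + 1))) (Q' := 9 * (2 ^ d * (d + 1) ^ 3)) ?_))
    (by simp) (by simp)
  · simp [h14] at hc
  rintro σ₁ ⟨e20, e21, e30, k1⟩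
  have st1 : Stable σ σ₁ := k1.trans Keep.refl (r₁ := 20) (S' := {0}) le_rfl le_rfl |> fun h =>
    ⟨fun r hr => h.1 r (by omega), fun k hk => h.2 k (by simp at hk ⊢; omega)⟩
  have hC1 := hC.stable st1
  have hx1 : HoldsVec σ₁ 21 x := hx.of_keep k1 (by simp)
  have hlab1 : HoldsLab σ₁ lab := hlab.of_keep k1 (by simp)
  have e10 : σ₁.v 10 = (fZ f x).val := by rw [k1.1 10 (by norm_num), h10]
  have e13 : σ₁.v 13 = acc.toNat := by rw [k1.1 13 (by norm_num), h13]
  have e14 : σ₁.v 14 = 0 := by rw [k1.1 14 (by norm_num), h14]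
  have e15 : σ₁.v 15 = s := by rw [k1.1 15 (by norm_num), h15]
  have e16 : σ₁.v 16 = 2 ^ s := by rw [k1.1 16 (by norm_num), h16]
  have hstab : ∀ σ', Stable σ₁ σ' → Stable σ σ' := fun σ' h => st1.trans h le_rfl le_rfl
  simp only [walkStep, ← hm]
  by_cases hidx : scanIdx f lab s tab m = 0
  · rw [if_pos hidx]
    refine Ref.bound (Ref.cond hw0 (T := 0) (Q := 0) (T' := 5500 * (2 ^ d * (d + 1) ^ 3 * (n + 1)))
      (Q' := 9 * (2 ^ d * (d + 1) ^ 3)) (by simp [numRegs])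
      (fun hc => absurd (by simp [e21, hidx]) hc) (fun _ => ?_)) (by simp; omega) (by simp)
    by_cases hs0 : s = 0
    · rw [if_pos hs0]
      refine Ref.bound (Ref.cond hw0 (T := 0) (Q := 0) (T' := 100) (Q' := 0) (by simp [numRegs])
        (fun hc => absurd (by simp [e15, hs0]) hc) (fun _ => Det.ret _ ?_)) (by simp; omega)
        (by simp)
      have hite : ∀ (b : Bool) (P : Prop) [Decidable P],
          b.toNat * (if P then 1 else 0) = (b && decide P).toNat := by
        intro b P _
        by_cases h : P <;> simp [h]
      have hb2 : ∀ b : Bool, b.toNat < 2 := by decide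
      refine Ref.bound (Det.seq (Det.assign_eq hw0 (x := 1) (by norm_num [numRegs])
        (by simp; omega) (by simp)) (T' := 50) (Q' := 0) ?_) (by simp) (by simp)
      rintro σ₂ rfl
      refine (Det.assign_eq hw0
        (x := (acc && decide (classSum f lab s 2 (tab 0) = fZ f x)).toNat) (by norm_num [numRegs])
        ?_ ?_).weaken (by simp) le_rfl ?_
      · simp [numRegs, AbsState.set_v, e13, e20, e10, -mul_ite, hite]
        have := hb2 (acc && decide ((classSum f lab s 2 (tab 0)).val = (fZ f x).val))
        omega
      · simp [AbsState.set_v, e13, e20, e10, -mul_ite, hite, (ZMod.val_injective 2).eq_iff]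
      rintro _ σ' rfl
      exact ⟨⟨by simp [AbsState.set_v], by simp [AbsState.set_v]⟩,
        hstab _ ((Keep.refl.set (by norm_num)).set (by norm_num))⟩
    · rw [if_neg hs0]
      refine Ref.bound (Ref.cond hw0 (T := 5400 * (2 ^ d * (d + 1) ^ 3 * (n + 1)))
        (Q := 9 * (2 ^ d * (d + 1) ^ 3)) (T' := 0) (Q' := 0) (by simp [numRegs])
        (fun _ => ?_) (fun hc => absurd hc (by simp [e15, hs0]))) (by simp; omega) (by simp)
      by_cases hz : classSum f lab s 2 (tab 0) = 0
      · rw [if_pos hz]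
        refine Ref.bound (Ref.cond hw0 (T := 0) (Q := 0) (T' := 20) (Q' := 0) (by simp [numRegs])
          (fun hc => absurd (by simp [e20, hz]) hc) (fun _ => Det.ret _ ?_)) (by simp; omega)
          (by simp)
        refine (failCode_spec hw0 (d := d)).weaken le_rfl le_rfl ?_
        rintro _ σ' ⟨h1, h2⟩
        exact ⟨h1, hstab _ h2⟩
      · rw [if_neg hz]
        refine Ref.bound (Ref.cond hw0 (T := 5300 * (2 ^ d * (d + 1) ^ 3 * (n + 1)))
          (Q := 9 * (2 ^ d * (d + 1) ^ 3)) (T' := 0) (Q' := 0) (by simp [numRegs])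
          (fun _ => ?_) (fun hc => absurd hc (by simp [e20, hz]))) (by simp; omega) (by simp)
        refine Ref.bound (Ref.seq ((readCode_spec hF hn (by omega) hC1.v0 e13 e15 e16 hlab1
          hx1).bound (read_time_le hsd) (read_queries_le hsd)) (ν := fun q => PMF.pure _)
          (T' := 50) (Q' := 0) ?_) (by omega) (by simp)
        rintro ⟨acc', A⟩ σ₂ ⟨v13, vlab, vr, va⟩
        refine Det.ret _ ?_
        refine Ref.bound (Ref.assign_seq hw0 (by norm_num [numRegs]) (by simp)
          (Ref.assign_seq hw0 (by norm_num [numRegs]) (by simp; omega)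
          (Ref.weaken (Det.assign hw0 (by norm_num [numRegs]) (by simp [numRegs]))
            le_rfl le_rfl ?_))) (by simp) (by simp)
        rintro _ σ' rfl
        have v7 : σ₂.v 7 = numRows d := by rw [vr 7 (by norm_num) (by norm_num), hC1.v7]
        have v14 : σ₂.v 14 = 0 := by rw [vr 14 (by norm_num) (by norm_num), e14]
        refine ⟨⟨by simpa [AbsState.set_v] using v13, ?_⟩, ?_⟩
        · refine ⟨by simp [AbsState.set_v, v14], by simp [AbsState.set_v], Nat.zero_le _,
            by simp [AbsState.set_v], ?_, vlab⟩
          simp [AbsState.set_v, v7, numRows]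
        · refine hstab _ (Keep.set (Keep.set (Keep.set ?_ (by norm_num)) (by norm_num))
            (by norm_num))
          exact ⟨fun r hr => vr r (by omega) (by omega), fun k hk => va k (by simpa using hk)⟩
  · rw [if_neg hidx]
    refine Ref.bound (Ref.cond hw0 (T := 5500 * (2 ^ d * (d + 1) ^ 3 * (n + 1)))
      (Q := 9 * (2 ^ d * (d + 1) ^ 3)) (T' := 0) (Q' := 0) (by simp [numRegs])
      (fun _ => ?_) (fun hc => absurd hc (by simp [e21, hidx]))) (by simp; omega) (by simp)
    by_cases hlt : s < d
    · rw [if_pos hlt]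
      refine Ref.bound (Ref.cond hw0 (T := 5400 * (2 ^ d * (d + 1) ^ 3 * (n + 1)))
        (Q := 9 * (2 ^ d * (d + 1) ^ 3)) (T' := 0) (Q' := 0) (by simp [numRegs])
        (fun _ => Det.ret _ ?_) (fun hc => absurd hc (by simp [e15, hC1.v1, hlt])))
        (by simp; omega) (by simp)
      have hidxlt : scanIdx f lab s tab m < numRows d :=
        lt_of_lt_of_le (scanIdx_lt f lab s tab m hm0) hmle
      have hbits : blockBits d < 2 ^ w := by
        have h1 := hB.blocks_lt
        have h2 : 1 ≤ numBlocks d := Nat.one_le_two_pow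
        nlinarith
      refine Ref.bound (Det.seq ((searchCode_spec (f := f) (D := D) (σ := σ₁) hF (M := numRows d)
        (j := scanIdx f lab s tab m) (s := s) (lab := lab) (tab := tab) (h := h)
        (R := numBlocks d) (ell := blockBits d) (by omega) hidxlt (by omega) hB.blocks_lt hbits
        (by omega) hC1.v0 hC1.v5 hC1.v6 e16 e20 e21 hC1.hash hlab1 hC1.table).bound
        (search_time_le hsd) (search_queries_le hsd))
        (T' := 400 * (2 ^ d * (d + 1) ^ 3 * (n + 1))) (Q' := 0) ?_) (by omega) (by omega)
      rintro σ₂ ⟨v23, k2⟩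
      have st2 : Stable σ₁ σ₂ :=
        ⟨fun r hr => k2.1 r (by omega), fun k hk => k2.2 k (by simp at hk ⊢; omega)⟩
      have hC2 := hC1.stable st2
      have f13 : σ₂.v 13 = acc.toNat := by rw [k2.1 13 (by norm_num), e13]
      have f14 : σ₂.v 14 = 0 := by rw [k2.1 14 (by norm_num), e14]
      have f15 : σ₂.v 15 = s := by rw [k2.1 15 (by norm_num), e15]
      have f16 : σ₂.v 16 = 2 ^ s := by rw [k2.1 16 (by norm_num), e16]
      refine Ref.bound (Det.seq (addClassCode_spec hF (s := s) (lab := lab) (h := h) (by omega)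
        hC2.v0 f16 v23 hC2.hash (hlab1.of_keep k2 (by simp)))
        (T' := 100) (Q' := 0) ?_) (by omega) (by omega)
      rintro σ₃ ⟨vlab, k3⟩
      have hC3 := hC2.stable (σ' := σ₃)
        ⟨fun r hr => k3.1 r (by omega), fun k hk => k3.2 k (by simp at hk ⊢; omega)⟩
      have g13 : σ₃.v 13 = acc.toNat := by rw [k3.1 13 (by norm_num), f13]
      have g14 : σ₃.v 14 = 0 := by rw [k3.1 14 (by norm_num), f14]
      have g15 : σ₃.v 15 = s := by rw [k3.1 15 (by norm_num), f15]
      have g16 : σ₃.v 16 = 2 ^ s := by rw [k3.1 16 (by norm_num), f16]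
      have hsw : s < 2 ^ s := Nat.lt_two_pow_self
      have hmle' := div_mul_rowFactor_le (d := d) (s := s + 1)
      refine Ref.bound (Det.seq (Det.assign_eq hw0 (x := s + 1) (by norm_num [numRegs])
        (by simp [numRegs, g15]; omega) (by simp [g15])) (T' := 70) (Q' := 0) ?_) (by simp)
        (by simp)
      rintro σ₄ rfl
      refine Ref.bound (Det.seq (Det.assign_eq hw0 (x := 2 ^ (s + 1)) (by norm_num [numRegs])
        (by simp [numRegs, AbsState.set_v, g16]; omega)
        (by simp [AbsState.set_v, g16, pow_succ])) (T' := 40) (Q' := 0) ?_) (by simp)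
        (by simp)
      rintro σ₄ rfl
      refine (Det.assign_eq hw0 (x := 2 ^ d / 2 ^ (s + 1) * rowFactor d) (by norm_num [numRegs])
        ?_ ?_).weaken (by simp) le_rfl ?_
      · simp [numRegs, AbsState.set_v, hC3.v3, hC3.v4]; omega
      · simp [AbsState.set_v, hC3.v3, hC3.v4]
      rintro _ σ' rfl
      refine ⟨⟨by simp [AbsState.set_v, g13], ?_⟩, ?_⟩
      · exact ⟨by simp [AbsState.set_v, g14], by simp [AbsState.set_v], hlt,
          by simp [AbsState.set_v], by simp [AbsState.set_v], vlab⟩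
      · refine hstab _ (Keep.set (Keep.set (Keep.set ?_ (by norm_num)) (by norm_num))
            (by norm_num))
        exact st2.trans k3 (by norm_num) (by simp)
    · rw [if_neg hlt]
      refine Ref.bound (Ref.cond hw0 (T := 0) (Q := 0) (T' := 20) (Q' := 0) (by simp [numRegs])
        (fun hc => absurd (by simp [e15, hC1.v1]; omega) hc) (fun _ => Det.ret _ ?_))
        (by simp; omega) (by simp)
      refine (failCode_spec hw0 (d := d)).weaken le_rfl le_rfl ?_
      rintro _ σ' ⟨h1, h2⟩
      exact ⟨h1, hstab _ h2⟩

end Walk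

/-! ### The whole tester -/

/-- The number with the binary digits `g 0, …, g (k - 1)`, most significant digit first. -/
def digitsVal {N : ℕ} (g : Fin N → ZMod 2) : ℕ → ℕ
  | 0 => 0
  | k + 1 => 2 * digitsVal g k + if h : k < N then (g ⟨k, h⟩).val else 0

theorem digitsVal_lt {N : ℕ} (g : Fin N → ZMod 2) (k : ℕ) : digitsVal g k < 2 ^ k := by
  induction k with
  | zero => simp [digitsVal]
  | succ k ih =>
    rw [digitsVal, pow_succ]
    split_ifs with h
    · have : (g ⟨k, h⟩).val < 2 := ZMod.val_lt _
      omega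
    · omega

theorem digitsVal_congr {N : ℕ} {g g' : Fin N → ZMod 2} {k : ℕ}
    (h : ∀ i : Fin N, (i : ℕ) < k → g i = g' i) : digitsVal g k = digitsVal g' k := by
  induction k with
  | zero => rfl
  | succ k ih =>
    rw [digitsVal, digitsVal, ih fun i hi => h i (by omega)]
    split_ifs with hk
    · rw [h ⟨k, hk⟩ (by simp)]
    · rfl

/-- The block numbers with the given binary digits. -/
def blockOf {n N : ℕ} (g : Fin n → Fin N → ZMod 2) (i : Fin n) : ℕ := digitsVal (g i) N

/-- The table with the given rows. -/
def tableOf {n N : ℕ} (g : Fin N → Vec n) (j : ℕ) : Vec n := if h : j < N then g ⟨j, h⟩ else 0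

/-- The processing of one example. -/
def sampleStep {n : ℕ} (f : BoolFun n) (D : PMF (Cube n)) (d : ℕ) (h : Fin n → ℕ) (tab : ℕ → Vec n)
    (acc : Bool) : PMF Bool :=
  D.bind fun x => (loopP (fun _ => walkStep f d h tab (toVec x)) 0 ((d + 1) ^ 2)
    (acc, some (fun _ => 2, 0))).map fun r => r.1 && r.2.isNone

/-- The verdict of the tester. -/
def verdictP {n : ℕ} (f : BoolFun n) (D : PMF (Cube n)) (d E : ℕ) : PMF Bool :=
  (fillP (fillP coinP (blockBits d)) n).bind fun hb =>
    (fillP (fillP coinP n) (numRows d)).bind fun tb =>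
      loopP (fun _ => sampleStep f D d (blockOf hb) (tableOf tb)) 0 (80 * E) true

/-- Code that computes the constants. -/
def constCode : Prog :=
  assign 3 (.c 1) ;; forLoop 12 1 (assign 3 (.v 3 * .c 2)) ;;
  assign 4 (.c 8 * ((.v 1 + .c 1) * (.v 1 + .c 1) * (.v 1 + .c 1))) ;;
  assign 5 (.c 16 * (.v 3 * .v 3)) ;; assign 6 (.c 2 * .v 1 + .c 4) ;; assign 7 (.v 3 * .v 4) ;;
  assign 8 ((.v 1 + .c 1) * (.v 1 + .c 1)) ;; assign 9 (.c 40 * (.c 2 * .v 2))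

/-- Code that draws the block numbers. -/
def hashCode : Prog :=
  forLoop 20 0 (assign 23 (.c 0) ;;
    forLoop 25 6 (.coin 32 ;; assign 23 (.c 2 * .v 23 + .v 32)) ;; put (.c 22) (.v 20) (.v 23))

/-- Code that draws the table. -/
def tableCode : Prog :=
  forLoop 20 7 (forLoop 21 0 (.coin 32 ;; put (.c 23 + .v 20) (.v 21) (.v 32)))

/-- Code for the processing of one example. -/
def sampleCode : Prog :=
  sampleRow 10 (.c 21) ;; forLoop 26 0 (put (.c 20) (.v 26) (.c 2)) ;; assign 14 (.c 0) ;;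
  assign 15 (.c 0) ;; assign 16 (.c 1) ;; assign 17 (.v 7) ;; forLoop 12 8 walkCode ;;
  cond (.v 14) (assign 40 (.c 0)) (assign 13 (.c 0))

/-- The tester. -/
def testerCode : Prog :=
  cond (.v 0)
    (constCode ;; hashCode ;; tableCode ;; assign 13 (.c 1) ;; forLoop 11 9 sampleCode ;;
      assign 0 (.v 13))
    (assign 0 (.c 1))

section Tester

variable {w n : ℕ} {f : BoolFun n} {D : PMF (Cube n)} {σ : AbsState} {β : Type} {p : Prog}
  {T Q : ℕ}

/-- The form of the loop rule used for drawing independent samples: each round only has to account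
for one fresh sample, which becomes the coordinate k. -/
theorem Ref.fillLoop [Inhabited β] (hw : 0 < w) {i b N : ℕ} (hi : i < numRegs) (hb : b < numRegs)
    (hib : i ≠ b) (hN : N < 2 ^ w) {ν : PMF β} {R : ℕ → (Fin N → β) → AbsState → Prop}
    (hσ : σ.v b = N) (h₀ : R 0 (fun _ => default) (σ.set i 0))
    (hbody : ∀ k < N, ∀ g σ, σ.v i = k → σ.v b = N → R k g σ →
      Ref w f D p σ ν (fun y σ' => σ'.v i = k ∧ σ'.v b = N ∧
        R (k + 1) (fun j => if (j : ℕ) = k then y else g j) (σ'.set i (k + 1))) T Q) :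
    Ref w f D (DTTest.forLoop i b p) σ (fillP ν N) (R N) (N * (T + 30) + 30) (N * Q) :=
  Ref.forLoop hw hi hb hib hN hσ h₀ fun k hk g σ h1 h2 h3 =>
    Ref.map (hbody k hk g σ h1 h2 h3) _ fun _ _ h => h

theorem constCode_spec {d E : ℕ} (hB : Big w n d E) (h1 : σ.v 1 = d) (h2 : σ.v 2 = E) :
    Det w f D constCode σ (fun σ' => σ'.v 0 = σ.v 0 ∧ σ'.v 1 = d ∧ σ'.v 3 = 2 ^ d ∧
      σ'.v 4 = rowFactor d ∧ σ'.v 5 = numBlocks d ∧ σ'.v 6 = blockBits d ∧ σ'.v 7 = numRows d ∧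
      σ'.v 8 = (d + 1) ^ 2 ∧ σ'.v 9 = 80 * E) (d * 50 + 300) 0 := by
  have hw0 := hB.fits.pos
  have h64 := hB.fits.le_two_pow
  have hd : d < 2 ^ d := Nat.lt_two_pow_self
  have hpow := hB.pow_lt
  have hsteps := hB.steps_lt
  have hrows := hB.rows_lt
  have hsam := hB.samples_lt
  have hblk : numBlocks d < 2 ^ w := by
    have h1 := hB.blocks_lt
    nlinarith
  have hb16 : 16 * (2 ^ d * 2 ^ d) = numBlocks d := by
    rw [numBlocks, blockBits, pow_add, two_mul, pow_add]
    ring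
  have hrf : 8 * ((d + 1) * (d + 1) * (d + 1)) = rowFactor d := by rw [rowFactor]; ring
  have hst : (d + 1) * (d + 1) = (d + 1) ^ 2 := by ring
  have hrfle : rowFactor d ≤ numRows d := Nat.le_mul_of_pos_left _ (by positivity)
  refine Ref.bound (Det.seq (Det.assign_eq hw0 (x := 1) (by norm_num [numRegs])
    (by simp; omega) (by simp)) (T' := d * 50 + 280) (Q' := 0) ?_) (by simp; omega) (by simp)
  rintro σ₁ rfl
  refine Ref.bound (Det.seq (Det.forLoop (i := 12) (b := 1) (N := d) (T := 20) (Q := 0)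
    (R := fun k σ' => σ'.v 0 = σ.v 0 ∧ σ'.v 1 = d ∧ σ'.v 2 = E ∧ σ'.v 3 = 2 ^ k) hw0
    (by norm_num [numRegs])
    (by norm_num [numRegs]) (by norm_num) (by omega) (by simp [AbsState.set_v, h1])
    (by simp [AbsState.set_v, h1, h2]) ?_) (T' := 240) (Q' := 0) ?_) (by omega) (by simp)
  · rintro k hk σ₂ hi hb ⟨e0, e1, e2, e3⟩
    have : 2 ^ k ≤ 2 ^ d := Nat.pow_le_pow_right (by norm_num) hk.le
    refine (Det.assign hw0 (by norm_num [numRegs]) (by simp [numRegs, e3]; omega)).weaken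
      (by simp) le_rfl ?_
    rintro _ σ' rfl
    simp [AbsState.set_v, hi, e0, e1, e2, e3, pow_succ]
  rintro σ₂ ⟨e0, e1, e2, e3⟩
  refine Ref.bound (Det.seq (Det.assign_eq hw0 (x := rowFactor d) (by norm_num [numRegs])
    ?_ (by simp [e1, hrf])) (T' := 190) (Q' := 0) ?_) (by simp) (by simp)
  · have h3 : (d + 1) * (d + 1) ≤ rowFactor d := by rw [← hrf]; nlinarith
    have h4 : (d + 1) * (d + 1) * (d + 1) ≤ rowFactor d := by rw [← hrf]; omega
    simp [numRegs, e1, hrf]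
    omega
  rintro σ₃ rfl
  refine Ref.bound (Det.seq (Det.assign_eq hw0 (x := numBlocks d) (by norm_num [numRegs])
    (by simp [numRegs, AbsState.set_v, e3, hb16]; omega) (by simp [AbsState.set_v, e3, hb16]))
    (T' := 150) (Q' := 0) ?_) (by simp) (by simp)
  rintro σ₃ rfl
  refine Ref.bound (Det.seq (Det.assign_eq hw0 (x := blockBits d) (by norm_num [numRegs])
    (by simp [numRegs, AbsState.set_v, e1]; omega) (by simp [AbsState.set_v, e1, blockBits]))
    (T' := 120) (Q' := 0) ?_) (by simp) (by simp)
  rintro σ₃ rfl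
  have hnr : 2 ^ d * rowFactor d = numRows d := rfl
  refine Ref.bound (Det.seq (Det.assign_eq hw0 (x := numRows d) (by norm_num [numRegs])
    (by simp [numRegs, AbsState.set_v, e3, hnr]; omega) (by simp [AbsState.set_v, e3, numRows]))
    (T' := 90) (Q' := 0) ?_) (by simp) (by simp)
  rintro σ₃ rfl
  refine Ref.bound (Det.seq (Det.assign_eq hw0 (x := (d + 1) ^ 2) (by norm_num [numRegs])
    (by simp [numRegs, AbsState.set_v, e1, hst]; omega) (by simp [AbsState.set_v, e1, hst]))
    (T' := 50) (Q' := 0) ?_) (by simp) (by simp)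
  rintro σ₃ rfl
  refine (Det.assign hw0 (by norm_num [numRegs])
    (by simp [numRegs, AbsState.set_v, e2]; omega)).weaken (by simp) le_rfl ?_
  rintro _ σ' rfl
  simp [AbsState.set_v, e0, e1, e2, e3]
  omega

theorem hashCode_spec {d E : ℕ} (hB : Big w n d E) (h0 : σ.v 0 = n) (h6 : σ.v 6 = blockBits d) :
    Ref w f D hashCode σ (fillP (fillP coinP (blockBits d)) n)
      (fun g σ' => HoldsHash σ' (blockOf g) ∧ Keep 20 {22} σ σ')
      (n * (blockBits d * 60 + 130) + 30) 0 := by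
  have hF := hB.fits
  have hw0 := hF.pos
  have h64 := hF.le_two_pow
  have h24 := hF.le_rows
  have hblk : numBlocks d < 2 ^ w := by
    have h1 := hB.blocks_lt
    nlinarith
  have hbits : blockBits d < 2 ^ w := by
    have h1 := hB.blocks_lt
    have h2 : 1 ≤ numBlocks d := Nat.one_le_two_pow
    nlinarith
  refine (Ref.fillLoop (i := 20) (b := 0) (N := n) (T := blockBits d * 60 + 100) (Q := 0)
    (R := fun k g σ' => (∀ i : Fin n, (i : ℕ) < k → σ'.a 22 i = blockOf g i) ∧ Keep 20 {22} σ σ')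
    hw0 (by norm_num [numRegs]) (by norm_num [numRegs]) (by norm_num) hF.lt h0
    ⟨by simp, Keep.refl.set le_rfl⟩ ?_).weaken le_rfl (by simp) ?_
  · rintro k hk g σ₁ hi hb ⟨hR, hkeep⟩
    have e6 : σ₁.v 6 = blockBits d := by rw [hkeep.1 6 (by norm_num), h6]
    refine Ref.bound (Det.seq (Det.assign_eq hw0 (x := 0) (by norm_num [numRegs])
      (by simp) (by simp)) (T' := blockBits d * 60 + 90) (Q' := 0) ?_) (by simp; omega) (by simp)
    rintro σ₂ rfl
    rw [← PMF.bind_pure (fillP coinP (blockBits d))]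
    refine Ref.bound (Ref.seq (Ref.fillLoop (i := 25) (b := 6) (N := blockBits d) (T := 30) (Q := 0)
      (R := fun k g σ' => σ'.v 23 = digitsVal g k ∧ Keep 21 ∅ σ₁ σ') hw0 (by norm_num [numRegs])
      (by norm_num [numRegs]) (by norm_num) hbits (by simp [AbsState.set_v, e6])
      ⟨by simp [AbsState.set_v, digitsVal], (Keep.refl.set (by norm_num)).set (by norm_num)⟩ ?_)
      (T' := 40) (Q' := 0) ?_) (by omega) (by simp)
    · rintro l hl g' σ₂ hi' hb' ⟨e23, hkeep'⟩
      rw [← PMF.bind_pure coinP]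
      refine Ref.bound (Ref.seq (Ref.coin hw0 (by norm_num [numRegs])) (T' := 25) (Q' := 0)
        fun y σ₃ hσ₃ => Det.ret _ ?_) (by norm_num) (by simp)
      subst hσ₃
      have hlt := digitsVal_lt g' l
      have hle : 2 * 2 ^ l ≤ numBlocks d := by
        rw [← pow_succ']
        exact Nat.pow_le_pow_right (by norm_num) hl
      have hy : y.val < 2 := ZMod.val_lt _
      refine (Det.assign_eq hw0 (x := 2 * digitsVal g' l + y.val) (by norm_num [numRegs])
        ?_ ?_).weaken (by simp) le_rfl ?_
      · simp [numRegs, AbsState.set_v, e23]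
        omega
      · simp [AbsState.set_v, e23]
      rintro _ σ' rfl
      refine ⟨by simp [AbsState.set_v, hi'], by simp [AbsState.set_v, hb'], ?_, ?_⟩
      · simp only [AbsState.set_v, digitsVal]
        simp only [hl, if_true, dif_pos]
        rw [if_neg (by norm_num), digitsVal_congr (g := g')]
        exact fun i hi => (if_neg (by omega)).symm
      · exact ((hkeep'.set (by norm_num)).set (by norm_num)).set (by norm_num)
    · rintro g' σ₂ ⟨e23, hkeep'⟩
      have hlt := digitsVal_lt g' (blockBits d)
      refine Det.ret _ ((Det.put_eq hw0 (kk := 22) (ii := k) (x := digitsVal g' (blockBits d))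
        (by simp [numRegs]) (by simp; omega) (by simp [numRegs]) (by simp)
        (by simp [hkeep'.1 20 (by norm_num), hi])
        (by simp [e23]) hk (hF.row (by omega)) (by rw [hkeep'.1 0 (by norm_num), hb])).weaken
        (by simp) le_rfl ?_)
      rintro _ σ' rfl
      refine ⟨by simp [hkeep'.1 20 (by norm_num), hi], by simp [hkeep'.1 0 (by norm_num), hb], ?_,
        ?_⟩
      · intro i hik
        rw [AbsState.set_a, AbsState.put_a]
        by_cases h : (i : ℕ) = k
        · simp [h, blockOf]
        · rw [if_neg (by tauto), hkeep'.2 22 (by simp), hR i (by omega)]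
          simp [blockOf, h]
      · exact ((hkeep.trans hkeep' (by norm_num) (by simp)).put (by simp)).set le_rfl
  · rintro g σ' ⟨h1, h2⟩
    exact ⟨fun i => h1 i i.2, h2⟩

theorem tableCode_spec {d E : ℕ} (hB : Big w n d E) (h0 : σ.v 0 = n) (h7 : σ.v 7 = numRows d) :
    Ref w f D tableCode σ (fillP (fillP coinP n) (numRows d))
      (fun g σ' => HoldsTab σ' (numRows d) (tableOf g) ∧ Keep 20 (Set.Ici 23) σ σ')
      (numRows d * (n * 60 + 60) + 30) 0 := by
  have hF := hB.fits
  have hw0 := hF.pos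
  have h64 := hF.le_two_pow
  have hrows := hB.rows_lt
  refine (Ref.fillLoop (i := 20) (b := 7) (N := numRows d) (T := n * 60 + 30) (Q := 0)
    (R := fun k g σ' => (∀ j < k, HoldsVec σ' (23 + j) (tableOf g j)) ∧ Keep 20 (Set.Ici 23) σ σ')
    hw0 (by norm_num [numRegs]) (by norm_num [numRegs]) (by norm_num) (by omega) h7
    ⟨by simp, Keep.refl.set le_rfl⟩ ?_).weaken le_rfl (by simp) ?_
  · rintro k hk g σ₁ hi hb ⟨hR, hkeep⟩
    refine (Ref.fillLoop (i := 21) (b := 0) (N := n) (T := 30) (Q := 0)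
      (R := fun l g' σ' => (∀ i : Fin n, (i : ℕ) < l → σ'.a (23 + k) i = (g' i).val) ∧
        Keep 21 {23 + k} σ₁ σ')
      hw0 (by norm_num [numRegs]) (by norm_num [numRegs]) (by norm_num) hF.lt
      (by rw [hkeep.1 0 (by norm_num), h0]) ⟨by simp, Keep.refl.set le_rfl⟩ ?_).weaken
      le_rfl (by simp) ?_
    · rintro l hl g' σ₂ hi' hb' ⟨hR', hkeep'⟩
      rw [← PMF.bind_pure coinP]
      refine Ref.bound (Ref.seq (Ref.coin hw0 (by norm_num [numRegs])) (T' := 28) (Q' := 0)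
        fun y σ₃ hσ₃ => Det.ret _ ?_) (by norm_num) (by simp)
      subst hσ₃
      have e20 : σ₂.v 20 = k := by rw [hkeep'.1 20 (by norm_num), hi]
      refine (Det.put_eq hw0 (kk := 23 + k) (ii := l) (x := y.val) (by simp [numRegs])
        (by simp [numRegs, AbsState.set_v, e20]; omega) (by simp [numRegs])
        (by simp [AbsState.set_v, e20]) (by simp [AbsState.set_v, hi']) (by simp [AbsState.set_v])
        hl (hF.row (by omega)) (by simp [AbsState.set_v, hb'])).weaken (by simp) le_rfl ?_
      rintro _ σ' rfl
      refine ⟨by simp [AbsState.set_v, hi'], by simp [AbsState.set_v, hb'], ?_, ?_⟩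
      · intro i hil
        rw [AbsState.set_a, AbsState.put_a]
        by_cases h : (i : ℕ) = l
        · simp [h]
        · rw [if_neg (by tauto), AbsState.set_a, hR' i (by omega)]
          simp [h]
      · exact ((hkeep'.set (by norm_num)).put (by simp)).set (by norm_num)
    · rintro g' σ' ⟨h1, h2⟩
      refine ⟨by rw [h2.1 20 (by norm_num), hi], by rw [h2.1 7 (by norm_num), hb], ?_, ?_⟩
      · intro j hj i
        rw [AbsState.set_a]
        by_cases h : j = k
        · subst h
          rw [h1 i i.2]
          simp [tableOf, hk]
        · rw [h2.2 (23 + j) (by simp; omega), hR j (by omega) i]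
          have hj' : j < numRows d := by omega
          simp [tableOf, hj', h]
      · exact (hkeep.trans h2 (by norm_num) (by simp)).set le_rfl
  · rintro g σ' ⟨h1, h2⟩
    exact ⟨h1, h2⟩

end Tester

section Tester

variable {w n : ℕ} {f : BoolFun n} {D : PMF (Cube n)} {σ : AbsState}

/-- A bound for the time to process an example. -/
def sampleTime (n d : ℕ) : ℕ := 13000 * (2 ^ d * (d + 1) ^ 5 * (n + 1))
/-- A bound for the number of queries to process an example. -/
def sampleQueries (d : ℕ) : ℕ := 21 * (2 ^ d * (d + 1) ^ 5)

theorem pow_mul_le (n d : ℕ) :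
    n + 1 ≤ 2 ^ d * (d + 1) ^ 5 * (n + 1) ∧ (d + 1) ^ 2 ≤ 2 ^ d * (d + 1) ^ 5 * (n + 1) ∧
    (d + 1) * (n + 1) ≤ 2 ^ d * (d + 1) ^ 5 * (n + 1) ∧
    2 ^ d * (d + 1) ^ 3 * (n + 1) ≤ 2 ^ d * (d + 1) ^ 5 * (n + 1) := by
  have h1 : 1 ≤ 2 ^ d := Nat.one_le_two_pow
  have hd : 1 ≤ d + 1 := by omega
  have h2 : 1 ≤ (d + 1) ^ 5 := Nat.one_le_pow _ _ (by omega)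
  have h3 : d + 1 ≤ (d + 1) ^ 5 := Nat.le_self_pow (by norm_num) _
  have h4 : (d + 1) ^ 2 ≤ (d + 1) ^ 5 := Nat.pow_le_pow_right hd (by norm_num)
  have h5 : (d + 1) ^ 3 ≤ (d + 1) ^ 5 := Nat.pow_le_pow_right hd (by norm_num)
  refine ⟨?_, ?_, ?_, ?_⟩
  · calc (n + 1) = 1 * 1 * (n + 1) := by ring
      _ ≤ _ := by gcongr
  · calc (d + 1) ^ 2 = 1 * (d + 1) ^ 2 * 1 := by ring
      _ ≤ _ := by gcongr; omega
  · calc (d + 1) * (n + 1) = 1 * (d + 1) * (n + 1) := by ring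
      _ ≤ _ := by gcongr
  · gcongr

theorem fZ_toVec (f : BoolFun n) (x : Cube n) : fZ f (toVec x) = if f x then 1 else 0 := by
  unfold fZ toVec
  congr 3
  funext i
  by_cases hi : x i <;> simp [hi]

theorem sampleCode_spec {d E : ℕ} {h : Fin n → ℕ} {tab : ℕ → Vec n} {acc : Bool}
    (hB : Big w n d E) (hn : 0 < n) (hC : Consts d h tab σ) (h8 : σ.v 8 = (d + 1) ^ 2)
    (h13 : σ.v 13 = acc.toNat) :
    Ref w f D sampleCode σ (sampleStep f D d h tab acc)
      (fun b σ' => σ'.v 13 = b.toNat ∧ (∀ r < 12, r ≠ 10 → σ'.v r = σ.v r) ∧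
        ∀ k ≥ 22, σ'.a k = σ.a k) (sampleTime n d) (sampleQueries d) := by
  have hF := hB.fits
  have hw0 := hF.pos
  have h64 := hF.le_two_pow
  have h24 := hF.le_rows
  have hrows := hB.rows_lt
  obtain ⟨hm1, hm2, -, -⟩ := pow_mul_le n d
  -- The (d+1)^2 steps, each of cost proportional to 2^d (d+1)^3, produce the exponent 5.
  have hT1 : (d + 1) ^ 2 * (stepTime n d + 30) = 12000 * (2 ^ d * (d + 1) ^ 5 * (n + 1)) +
    30 * (d + 1) ^ 2 := by rw [stepTime]; ring
  have hQ1 : (d + 1) ^ 2 * stepQueries d = 20 * (2 ^ d * (d + 1) ^ 5) := by rw [stepQueries]; ring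
  have hQ2 : 1 ≤ 2 ^ d * (d + 1) ^ 5 := Nat.one_le_iff_ne_zero.2 (by positivity)
  refine Ref.bound (Ref.seq (Ref.sampleRow hw0 (by norm_num [numRegs]) (by simp; omega)
    (by simpa using hF.row (k := 21) (by omega)) hC.v0)
    (T' := n * 80 + 200 + ((d + 1) ^ 2 * (stepTime n d + 30)))
    (Q' := (d + 1) ^ 2 * stepQueries d) ?_) ?_ (by rw [hQ1, sampleQueries]; omega)
  swap
  · simp only [Expr.cost_c]
    rw [sampleTime, hT1]
    generalize 2 ^ d * (d + 1) ^ 5 * (n + 1) = X at *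
    generalize (d + 1) ^ 2 = Y at *
    omega
  rintro x σ₁ hσ₁
  have e10 : σ₁.v 10 = (fZ f (toVec x)).val := by
    rw [hσ₁, AbsState.setRow_v, AbsState.set_v, if_pos rfl, fZ_toVec]
    cases f x <;> rfl
  have er : ∀ r, r ≠ 10 → σ₁.v r = σ.v r := fun r hr => by
    rw [hσ₁, AbsState.setRow_v, AbsState.set_v, if_neg hr]
  have ex : HoldsVec σ₁ 21 (toVec x) := by
    intro i
    rw [hσ₁, AbsState.setRow_a]
    simp [toVec]
    cases x i <;> rfl
  have ea : ∀ k, k ≠ 21 → σ₁.a k = σ.a k := fun k hk => by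
    rw [hσ₁, AbsState.setRow_a]
    simp [hk]
  clear hσ₁
  have r20 := hF.row (k := 20) (by omega)
  refine Ref.bound (Det.seq (Det.fillRow (i := 26) (T := 50) (K := 20) (g := fun _ => 2) hF
    (by norm_num [numRegs]) (by norm_num) (by rw [er 0 (by norm_num), hC.v0]) ?_)
    (T' := 150 + ((d + 1) ^ 2 * (stepTime n d + 30)))
    (Q' := (d + 1) ^ 2 * stepQueries d) ?_) (by omega) (by omega)
  · intro k hk σ₂ hi hkeep _
    refine (Det.put_eq hw0 (kk := 20) (ii := k) (x := 2) (by simp; omega) (by simp; omega)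
      (by simp [numRegs]) (by simp) (by simp [hi]) (by simp) hk r20
      (by rw [hkeep.1 0 (by norm_num), er 0 (by norm_num), hC.v0])).weaken (by simp) le_rfl ?_
    rintro _ σ' rfl
    refine ⟨by simp [AbsState.put_a], ?_, Keep.refl.put (by simp)⟩
    intro j hj
    rw [AbsState.put_a, if_neg (by tauto)]
  rintro σ₂ ⟨hl, k2⟩
  refine Ref.bound (Ref.assign_seq hw0 (by norm_num [numRegs]) (by simp)
    (Ref.assign_seq hw0 (by norm_num [numRegs]) (by simp)
    (Ref.assign_seq hw0 (by norm_num [numRegs]) (by simp; omega)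
    (Ref.assign_seq hw0 (by norm_num [numRegs]) (by simp [numRegs])
    (T := 100 + ((d + 1) ^ 2 * (stepTime n d + 30))) (Q := (d + 1) ^ 2 * stepQueries d) ?_))))
    (by simp; omega) (by simp)
  generalize hσ₃ : AbsState.set _ 17 _ = σ₃
  have s14 : σ₃.v 14 = 0 := by rw [← hσ₃]; simp [AbsState.set_v]
  have s15 : σ₃.v 15 = 0 := by rw [← hσ₃]; simp [AbsState.set_v]
  have s16 : σ₃.v 16 = 1 := by rw [← hσ₃]; simp [AbsState.set_v]
  have s17 : σ₃.v 17 = numRows d := by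
    rw [← hσ₃]; simp [AbsState.set_v, k2.1 7 (by norm_num), er 7 (by norm_num), hC.v7]
  have s13 : σ₃.v 13 = acc.toNat := by
    rw [← hσ₃]; simp [AbsState.set_v, k2.1 13 (by norm_num), er 13 (by norm_num), h13]
  have s10 : σ₃.v 10 = (fZ f (toVec x)).val := by
    rw [← hσ₃]; simp [AbsState.set_v, k2.1 10 (by norm_num), e10]
  have sr : ∀ r < 13, r ≠ 10 → σ₃.v r = σ.v r := fun r hr hr' => by
    rw [← hσ₃, ← er r hr', ← k2.1 r (by omega)]
    simp only [AbsState.set_v]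
    repeat rw [if_neg (by omega)]
  have sa : σ₃.a = σ₂.a := by rw [← hσ₃]; rfl
  have sk : ∀ k ≥ 22, σ₃.a k = σ.a k := fun k hk => by
    rw [sa, k2.2 k (by simp; omega), ea k (by omega)]
  have sx : HoldsVec σ₃ 21 (toVec x) := fun i => by
    rw [sa, k2.2 21 (by simp), ex i]
  have sl : HoldsLab σ₃ (fun _ : Fin n => 2) := fun i => by rw [sa, hl i i.2]
  clear hσ₃
  have hC3 : Consts d h tab σ₃ :=
    { v0 := by rw [sr 0 (by norm_num) (by norm_num), hC.v0]
      v1 := by rw [sr 1 (by norm_num) (by norm_num), hC.v1]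
      v3 := by rw [sr 3 (by norm_num) (by norm_num), hC.v3]
      v4 := by rw [sr 4 (by norm_num) (by norm_num), hC.v4]
      v5 := by rw [sr 5 (by norm_num) (by norm_num), hC.v5]
      v6 := by rw [sr 6 (by norm_num) (by norm_num), hC.v6]
      v7 := by rw [sr 7 (by norm_num) (by norm_num), hC.v7]
      hash := fun i => by rw [sk 22 le_rfl, hC.hash i]
      table := fun j hj i => by rw [sk (23 + j) (by omega), hC.table j hj i] }
  rw [← PMF.bind_pure_comp]
  refine Ref.bound (Ref.seq (Ref.forLoop (i := 12) (b := 8) (N := (d + 1) ^ 2)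
    (ν := fun _ => walkStep f d h tab (toVec x)) (x₀ := (acc, some (fun _ => 2, 0)))
    (T := stepTime n d) (Q := stepQueries d)
    (R := fun _ q σ' => WalkRel d q σ' ∧ (∀ r < 12, σ'.v r = σ₃.v r) ∧ ∀ k ≥ 21, σ'.a k = σ₃.a k)
    hw0 (by norm_num [numRegs]) (by norm_num [numRegs]) (by norm_num) hB.steps_lt
    (by rw [sr 8 (by norm_num) (by norm_num), h8]) ?_ ?_) (T' := 30) (Q' := 0) ?_) (by omega)
    (by omega)
  · refine ⟨⟨by simp [AbsState.set_v, s13], ?_⟩, ?_, fun k _ => rfl⟩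
    · exact ⟨by simp [AbsState.set_v, s14], by simp [AbsState.set_v, s15], Nat.zero_le _,
        by simp [AbsState.set_v, s16], by simp [AbsState.set_v, s17, numRows], sl⟩
    · intro r hr
      rw [AbsState.set_v, if_neg (by omega)]
  · rintro k hk q σ₄ hi hb ⟨hq, hr, ha⟩
    have hC4 : Consts d h tab σ₄ :=
      { v0 := by rw [hr 0 (by norm_num), hC3.v0]
        v1 := by rw [hr 1 (by norm_num), hC3.v1]
        v3 := by rw [hr 3 (by norm_num), hC3.v3]
        v4 := by rw [hr 4 (by norm_num), hC3.v4]
        v5 := by rw [hr 5 (by norm_num), hC3.v5]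
        v6 := by rw [hr 6 (by norm_num), hC3.v6]
        v7 := by rw [hr 7 (by norm_num), hC3.v7]
        hash := fun i => by rw [ha 22 (by norm_num), hC3.hash i]
        table := fun j hj i => by rw [ha (23 + j) (by omega), hC3.table j hj i] }
    refine (walkCode_spec hB hn hC4 (fun i => by rw [ha 21 le_rfl, sx i])
      (by rw [hr 10 (by norm_num), s10]) hq).weaken le_rfl le_rfl ?_
    rintro q' σ' ⟨hq', hs'⟩
    refine ⟨by rw [hs'.1 12 (by norm_num), hi], by rw [hs'.1 8 (by norm_num), hb], ?_, ?_, ?_⟩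
    · obtain ⟨acc', _ | ⟨lab, s⟩⟩ := q'
      · exact ⟨by simpa [AbsState.set_v] using hq'.1, by simpa [AbsState.set_v] using hq'.2⟩
      · exact ⟨by simpa [AbsState.set_v] using hq'.1, by simpa [AbsState.set_v, HoldsLab] using hq'.2⟩
    · intro r hr'
      rw [AbsState.set_v, if_neg (by omega), hs'.1 r (by omega), hr r hr']
    · intro k hk
      rw [AbsState.set_a, hs'.2 k (by simpa using hk), ha k hk]
  · rintro ⟨acc', st⟩ σ₄ ⟨hq, hr, ha⟩
    refine Det.ret _ ?_
    refine Ref.bound (Ref.cond hw0 (T := 5) (Q := 0) (T' := 5) (Q' := 0) (by simp [numRegs])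
      (fun hc => ?_) (fun hc => ?_)) (by simp) (by simp)
    · refine (Det.assign hw0 (by norm_num [numRegs]) (by simp)).weaken (by simp) le_rfl ?_
      rintro _ σ' rfl
      rcases st with _ | ⟨lab, s⟩
      · refine ⟨by simpa [AbsState.set_v] using hq.1, ?_, ?_⟩
        · intro r hr1 hr2
          rw [AbsState.set_v, if_neg (by omega), hr r hr1, sr r (by omega) hr2]
        · intro k hk
          rw [AbsState.set_a, ha k (by omega), sk k hk]
      · exact absurd hq.2.1 hc
    · refine (Det.assign hw0 (by norm_num [numRegs]) (by simp)).weaken (by simp) le_rfl ?_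
      rintro _ σ' rfl
      rcases st with _ | ⟨lab, s⟩
      · have := hq.2
        simp only at this
        simp [this] at hc
      · refine ⟨by simp [AbsState.set_v], ?_, ?_⟩
        · intro r hr1 hr2
          rw [AbsState.set_v, if_neg (by omega), hr r hr1, sr r (by omega) hr2]
        · intro k hk
          rw [AbsState.set_a, ha k (by omega), sk k hk]

theorem testerCode_spec {d E : ℕ} (hB : Big w n d E) (hE : 0 < E) (hn : 0 < n) (h0 : σ.v 0 = n)
    (h1 : σ.v 1 = d) (h2 : σ.v 2 = E) :
    Ref w f D testerCode σ (verdictP f D d E) (fun b σ' => σ'.v 0 = b.toNat)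
      (1100000 * (E * (2 ^ d * (d + 1) ^ 5 * (n + 1)))) (1680 * (E * (2 ^ d * (d + 1) ^ 5))) := by
  have hF := hB.fits
  have hw0 := hF.pos
  have h64 := hF.le_two_pow
  have hQ : 80 * E * sampleQueries d = 1680 * (E * (2 ^ d * (d + 1) ^ 5)) := by
    rw [sampleQueries]; ring
  have hT : (d * 50 + 300) + (n * (blockBits d * 60 + 130) + 30) +
      (numRows d * (n * 60 + 60) + 30) + (80 * E * (sampleTime n d + 30) + 30) + 200 ≤
      1100000 * (E * (2 ^ d * (d + 1) ^ 5 * (n + 1))) := by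
    obtain ⟨hm1, hm2, hm3, hm4⟩ := pow_mul_le n d
    have e1 : n * (blockBits d * 60 + 130) ≤ 370 * ((d + 1) * (n + 1)) := by
      rw [blockBits]; nlinarith
    have e2 : numRows d * (n * 60 + 60) = 480 * (2 ^ d * (d + 1) ^ 3 * (n + 1)) := by
      rw [numRows, rowFactor]; ring
    have e3 : 80 * E * (sampleTime n d + 30) =
        1040000 * (E * (2 ^ d * (d + 1) ^ 5 * (n + 1))) + 2400 * E := by
      rw [sampleTime]; ring
    have e4 : d ≤ (d + 1) * (n + 1) := by nlinarith
    rw [e2, e3]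
    clear e2 e3
    generalize 2 ^ d * (d + 1) ^ 5 * (n + 1) = X at *
    generalize 2 ^ d * (d + 1) ^ 3 * (n + 1) = Y at *
    generalize (d + 1) * (n + 1) = Z at *
    generalize n * (blockBits d * 60 + 130) = V at *
    have e5 : X ≤ E * X := Nat.le_mul_of_pos_left _ hE
    have e6 : E ≤ E * X := Nat.le_mul_of_pos_right _ (by omega)
    generalize E * X = U at *
    clear hm2
    omega
  refine Ref.bound (Ref.cond hw0 (T' := 0) (Q' := 0)
    (T := (d * 50 + 300) + ((n * (blockBits d * 60 + 130) + 30) +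
      ((numRows d * (n * 60 + 60) + 30) + ((80 * E * (sampleTime n d + 30) + 30) + 60))))
    (Q := 0 + (0 + (0 + 80 * E * sampleQueries d))) (by simp [numRegs]) (fun _ => ?_)
    (fun hc => absurd hc (by simp [h0, hn.ne']))) (by simp; omega) (by simp [hQ])
  refine Ref.bound (Det.seq (constCode_spec hB h1 h2)
    (T' := (n * (blockBits d * 60 + 130) + 30) +
      ((numRows d * (n * 60 + 60) + 30) + ((80 * E * (sampleTime n d + 30) + 30) + 50)))
    (Q' := 0 + (0 + 80 * E * sampleQueries d)) ?_) (by omega) le_rfl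
  rintro σ₁ ⟨e0, e1, e3, e4, e5, e6, e7, e8, e9⟩
  rw [h0] at e0
  refine Ref.bound (Ref.seq (hashCode_spec hB e0 e6)
    (T' := (numRows d * (n * 60 + 60) + 30) + ((80 * E * (sampleTime n d + 30) + 30) + 40))
    (Q' := 0 + 80 * E * sampleQueries d) ?_) (by omega) le_rfl
  rintro hb σ₂ ⟨hh, k2⟩
  refine Ref.bound (Ref.seq (tableCode_spec hB (by rw [k2.1 0 (by norm_num), e0])
    (by rw [k2.1 7 (by norm_num), e7]))
    (T' := (80 * E * (sampleTime n d + 30) + 30) + 30)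
    (Q' := 80 * E * sampleQueries d) ?_) (by omega) le_rfl
  rintro tb σ₃ ⟨ht, k3⟩
  have kr : ∀ r < 20, σ₃.v r = σ₁.v r := fun r hr => by rw [k3.1 r hr, k2.1 r hr]
  have hC : Consts d (blockOf hb) (tableOf tb) σ₃ :=
    { v0 := by rw [kr 0 (by norm_num), e0]
      v1 := by rw [kr 1 (by norm_num), e1]
      v3 := by rw [kr 3 (by norm_num), e3]
      v4 := by rw [kr 4 (by norm_num), e4]
      v5 := by rw [kr 5 (by norm_num), e5]
      v6 := by rw [kr 6 (by norm_num), e6]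
      v7 := by rw [kr 7 (by norm_num), e7]
      hash := hh.of_keep k3 (by simp)
      table := ht }
  refine Ref.bound (Det.seq (Det.assign_eq hw0 (x := 1) (by norm_num [numRegs])
      (by simp; omega) (by simp)) (T' := (80 * E * (sampleTime n d + 30) + 30) + 20)
      (Q' := 80 * E * sampleQueries d) ?_) (by simp; omega) (by omega)
  rintro σ₄ rfl
  rw [← PMF.bind_pure (loopP _ _ _ _)]
  refine Ref.bound (Ref.seq (Ref.forLoop (i := 11) (b := 9) (N := 80 * E) (T := sampleTime n d)
    (Q := sampleQueries d)
    (R := fun _ acc σ' => σ'.v 13 = acc.toNat ∧ (∀ r < 11, r ≠ 10 → σ'.v r = σ₃.v r) ∧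
        ∀ k ≥ 22, σ'.a k = σ₃.a k) hw0 (by norm_num [numRegs]) (by norm_num [numRegs]) (by norm_num)
    hB.samples_lt (by simp [AbsState.set_v, kr 9 (by norm_num), e9]) ?_ ?_)
    (T' := 10) (Q' := 0) ?_) (by omega) (by omega)
  · refine ⟨by simp [AbsState.set_v], ?_, fun _ _ => rfl⟩
    intro r hr _
    rw [AbsState.set_v, if_neg (by omega), AbsState.set_v, if_neg (by omega)]
  · rintro k hk acc σ₄ hi hb ⟨h13, hr, ha⟩
    have hC4 : Consts d (blockOf _) (tableOf tb) σ₄ :=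
      { v0 := by rw [hr 0 (by norm_num) (by norm_num), hC.v0]
        v1 := by rw [hr 1 (by norm_num) (by norm_num), hC.v1]
        v3 := by rw [hr 3 (by norm_num) (by norm_num), hC.v3]
        v4 := by rw [hr 4 (by norm_num) (by norm_num), hC.v4]
        v5 := by rw [hr 5 (by norm_num) (by norm_num), hC.v5]
        v6 := by rw [hr 6 (by norm_num) (by norm_num), hC.v6]
        v7 := by rw [hr 7 (by norm_num) (by norm_num), hC.v7]
        hash := fun i => by rw [ha 22 (by norm_num), hC.hash i]
        table := fun j hj i => by rw [ha (23 + j) (by omega), hC.table j hj i] }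
    refine (sampleCode_spec hB hn hC4 (by
      rw [hr 8 (by norm_num) (by norm_num), kr 8 (by norm_num), e8]) h13).weaken le_rfl le_rfl ?_
    rintro b σ' ⟨g13, gr, ga⟩
    refine ⟨by rw [gr 11 (by norm_num) (by norm_num), hi],
      by rw [gr 9 (by norm_num) (by norm_num), hb], by simpa [AbsState.set_v] using g13, ?_, ?_⟩
    · intro r hr1 hr2
      rw [AbsState.set_v, if_neg (by omega), gr r (by omega) hr2, hr r hr1 hr2]
    · intro k hk
      rw [AbsState.set_a, ga k hk, ha k hk]
  · rintro b σ₄ ⟨h13, -, -⟩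
    refine Det.ret _ ((Det.assign hw0 (by norm_num [numRegs]) (by simp [numRegs])).weaken
      (by simp) le_rfl ?_)
    rintro _ σ' rfl
    simpa [AbsState.set_v] using h13

end Tester

/-! ### Expectations -/

/-- The expectation of a nonnegative function. -/
def expect {α : Type} (μ : PMF α) (F : α → ENNReal) : ENNReal := ∑' a, μ a * F a

section Expect
variable {α β : Type} {μ : PMF α} {F G : α → ENNReal}

@[simp] theorem expect_pure (a : α) : expect (PMF.pure a) F = F a := by
  classical
  unfold expect
  rw [tsum_eq_single a]
  · simp
  · intro b hb
    simp [PMF.pure_apply, hb]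

@[simp] theorem expect_bind (ν : α → PMF β) (F : β → ENNReal) :
    expect (μ.bind ν) F = expect μ fun a => expect (ν a) F := by
  unfold expect
  simp_rw [PMF.bind_apply, ← ENNReal.tsum_mul_right, ← ENNReal.tsum_mul_left]
  rw [ENNReal.tsum_comm]
  simp_rw [mul_assoc]

@[simp] theorem expect_map (g : α → β) (F : β → ENNReal) :
    expect (μ.map g) F = expect μ fun a => F (g a) := by
  rw [← PMF.bind_pure_comp, expect_bind]
  simp

theorem expect_mono (h : ∀ a, F a ≤ G a) : expect μ F ≤ expect μ G :=
  ENNReal.tsum_le_tsum fun a => by gcongr; exact h a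

theorem expect_const (c : ENNReal) : expect μ (fun _ => c) = c := by
  rw [expect, ENNReal.tsum_mul_right, μ.tsum_coe, one_mul]

theorem expect_le_const {c : ENNReal} (h : ∀ a, F a ≤ c) : expect μ F ≤ c :=
  (expect_mono h).trans_eq (expect_const c)

theorem toOuterMeasure_eq_expect (S : Set α) :
    μ.toOuterMeasure S = expect μ (S.indicator 1) := by
  rw [PMF.toOuterMeasure_apply]
  refine tsum_congr fun a => ?_
  by_cases h : a ∈ S <;> simp [h]

theorem expect_le_of_support {c : ENNReal} (h : ∀ a ∈ μ.support, F a ≤ c) : expect μ F ≤ c := by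
  rw [← expect_const (μ := μ) c]
  refine ENNReal.tsum_le_tsum fun a => ?_
  by_cases ha : a ∈ μ.support
  · gcongr; exact h a ha
  · rw [PMF.mem_support_iff, not_not] at ha
    simp [ha]

theorem expect_uniform [Fintype α] [Nonempty α] (F : α → ENNReal) :
    expect (PMF.uniformOfFintype α) F = (∑ a, F a) / Fintype.card α := by
  unfold expect
  rw [tsum_fintype, div_eq_mul_inv, Finset.sum_mul]
  refine Finset.sum_congr rfl fun a _ => ?_
  rw [PMF.uniformOfFintype_apply, mul_comm]

end Expect

/-! ### Uniform filling -/

theorem coinP_eq : coinP = PMF.uniformOfFintype (ZMod 2) := by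
  ext a
  rw [coinP, PMF.map_apply, tsum_fintype, PMF.uniformOfFintype_apply]
  simp only [PMF.uniformOfFintype_apply, Fintype.sum_bool, Fintype.card_bool, ZMod.card]
  have ha : a = 0 ∨ a = 1 := by revert a; decide
  rcases ha with rfl | rfl <;> simp

theorem coin3P_eq : coin3P = PMF.uniformOfFintype (ZMod 2 × ZMod 2 × ZMod 2) := by
  ext ⟨a, b, c⟩
  rw [PMF.uniformOfFintype_apply, coin3P, coinP_eq]
  simp only [PMF.bind_apply, PMF.map_apply, PMF.uniformOfFintype_apply, tsum_fintype,
    Fintype.card_prod, ZMod.card]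
  have h8 : ((2 * (2 * 2) : ℕ) : ENNReal)⁻¹ = ((2 : ℕ) : ENNReal)⁻¹ * (((2 : ℕ) : ENNReal)⁻¹ *
      ((2 : ℕ) : ENNReal)⁻¹) := by
    rw [Nat.cast_mul, Nat.cast_mul, ENNReal.mul_inv (by simp) (by simp),
      ENNReal.mul_inv (by simp) (by simp)]
  rw [h8, Finset.sum_eq_single a, Finset.sum_eq_single b, Finset.sum_eq_single c]
  · simp
  · intro c' _ hc
    simp [Ne.symm hc]
  · simp
  · intro b' _ hb
    simp [Ne.symm hb]
  · simp
  · intro a' _ ha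
    simp [Ne.symm ha]
  · simp

/-- The statement is general enough for induction on m: rounds k to k + m - 1 overwrite exactly
these coordinates, so y must agree with g on all others and the overwritten ones are independent. -/
theorem loopP_fill_apply {β : Type} (ν : PMF β) {N : ℕ} (m k : ℕ) (hk : k + m ≤ N) (g y : Fin N → β) :
    loopP (fun k g => ν.map fun b (i : Fin N) => if (i : ℕ) = k then b else g i) k m g y =
      open Classical in
      if ∀ i : Fin N, (i : ℕ) < k ∨ k + m ≤ i → y i = g i then
        ∏ i ∈ Finset.univ.filter fun i : Fin N => k ≤ (i : ℕ) ∧ (i : ℕ) < k + m, ν (y i) else 0 := by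
  classical
  induction m generalizing k g with
  | zero =>
    rw [loopP, PMF.pure_apply]
    by_cases h : y = g
    · subst h
      simp only [if_true, implies_true]
      rw [Finset.prod_eq_one]
      intro i hi
      simp at hi
      omega
    · rw [if_neg h, if_neg]
      intro h'
      exact h (funext fun i => h' i (by omega))
  | succ m ih =>
    have hkN : k < N := by omega
    rw [loopP, PMF.bind_apply]
    have h1 : ∑' a, (ν.map fun b (i : Fin N) => if (i : ℕ) = k then b else g i) a *
        loopP (fun k g => ν.map fun b (i : Fin N) => if (i : ℕ) = k then b else g i) (k + 1) m a y =
        expect ν fun b => loopP (fun k g => ν.map fun b (i : Fin N) => if (i : ℕ) = k then b else g i)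
          (k + 1) m (fun i : Fin N => if (i : ℕ) = k then b else g i) y :=
      expect_map (μ := ν) _
        (fun a => loopP (fun k g => ν.map fun b (i : Fin N) => if (i : ℕ) = k then b else g i)
          (k + 1) m a y)
    -- Later rounds do not touch the coordinate k again, so only the sample equal to y k can lead to
    -- y.
    rw [h1, expect, tsum_eq_single (y ⟨k, hkN⟩)]
    · rw [ih (k + 1) (by omega)]
      have hcond : (∀ i : Fin N, (i : ℕ) < k + 1 ∨ k + 1 + m ≤ i →
          y i = if (i : ℕ) = k then y ⟨k, hkN⟩ else g i) ↔
          ∀ i : Fin N, (i : ℕ) < k ∨ k + (m + 1) ≤ i → y i = g i := by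
        constructor
        · intro h i hi
          rw [h i (by omega), if_neg (by omega)]
        · intro h i hi
          by_cases hik : (i : ℕ) = k
          · rw [if_pos hik]
            congr 1
            exact Fin.ext hik
          · rw [if_neg hik, h i (by omega)]
      simp only [hcond]
      split_ifs
      · have : (Finset.univ.filter fun i : Fin N => k ≤ (i : ℕ) ∧ (i : ℕ) < k + (m + 1)) =
            insert ⟨k, hkN⟩ (Finset.univ.filter fun i : Fin N =>
              k + 1 ≤ (i : ℕ) ∧ (i : ℕ) < k + 1 + m) := by
          ext i
          simp [Fin.ext_iff]
          omega
        rw [this, Finset.prod_insert (by simp)]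
      · simp
    · intro b hb
      rw [ih (k + 1) (by omega), if_neg, mul_zero]
      intro h
      apply hb
      rw [h ⟨k, hkN⟩ (by simp), if_pos rfl]

theorem fillP_apply {β : Type} [Inhabited β] (ν : PMF β) (N : ℕ) (y : Fin N → β) :
    fillP ν N y = ∏ i, ν (y i) := by
  classical
  rw [fillP, loopP_fill_apply ν N 0 (by omega), if_pos]
  · refine Finset.prod_congr (Finset.filter_true_of_mem fun i _ => ?_) fun _ _ => rfl
    have := i.2
    omega
  · intro i hi
    omega

theorem fillP_uniform {β : Type} [Inhabited β] [Fintype β] (N : ℕ) :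
    fillP (PMF.uniformOfFintype β) N = PMF.uniformOfFintype (Fin N → β) := by
  ext y
  rw [fillP_apply, PMF.uniformOfFintype_apply]
  simp [PMF.uniformOfFintype_apply, ENNReal.inv_pow]

/-! ### The literal test -/

section Literal

theorem zval_add_le (a b : ZMod 2) : (a + b).val ≤ a.val + b.val := by revert a b; decide
theorem zval_add3_le (a b c : ZMod 2) : (a + b + c).val ≤ a.val + b.val + c.val := by
  revert a b c; decide
theorem zadd_self (a : ZMod 2) : a + a = 0 := by revert a; decide
theorem vadd_self {n : ℕ} (u : Vec n) : u + u = 0 := funext fun i => zadd_self (u i)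

variable {n : ℕ} (φ : Vec n → ZMod 2)

/-- The derivative of `φ` in the direction `x`. -/
def slope (x z : Vec n) : ZMod 2 := φ z + φ (z + x)

/-- The most frequent value of the derivative in the direction `x`. -/
def majority (x : Vec n) : ZMod 2 :=
  if ∑ z, (slope φ x z).val ≤ ∑ z, (slope φ x z + 1).val then 0 else 1

theorem sum_majority_le (x : Vec n) (b : ZMod 2) :
    ∑ z, (slope φ x z + majority φ x).val ≤ ∑ z, (slope φ x z + b).val := by
  unfold majority
  have hb : b = 0 ∨ b = 1 := by revert b; decide
  rcases hb with rfl | rfl <;> split_ifs with h <;> simp at h ⊢ <;> omega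

theorem sum_shift {M : Type} [AddCommMonoid M] (F : Vec n → M) (x : Vec n) :
    ∑ z, F (z + x) = ∑ z, F z :=
  Equiv.sum_comp (Equiv.addRight x) F

/-- The number of pairs at which additivity fails. -/
def additivityFails : ℕ := ∑ u, ∑ v, (φ u + φ v + φ (u + v) + φ 0).val
/-- The number of triples at which multiplicativity fails. -/
def multiplicativityFails : ℕ :=
  ∑ u, ∑ v, ∑ z, (slope φ (u * v) z + (φ u + φ 0) * (φ v + φ 0)).val

local notation "N" => Fintype.card (Vec n)

/-- Two votes, at z and at z', for the derivative in the direction x differ only if additivity fails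
at (z', z) or at (z' + x, z + x), since both pairs have the same sum. The majority value disagrees
with the votes at most as often as any single vote z' does; summing this over z' gives the bound. -/
theorem majority_error (x : Vec n) :
    N * ∑ z, (slope φ x z + majority φ x).val ≤ 2 * additivityFails φ := by
  have h1 : N * ∑ z, (slope φ x z + majority φ x).val ≤
      ∑ z', ∑ z, (slope φ x z + slope φ x z').val := by
    rw [← smul_eq_mul, ← Finset.card_univ, ← Finset.sum_const]
    exact Finset.sum_le_sum fun z' _ => sum_majority_le φ x _
  refine h1.trans ?_
  have h2 : ∑ z', ∑ z, (slope φ x z + slope φ x z').val ≤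
      ∑ z', ∑ z, ((φ z' + φ z + φ (z' + z) + φ 0).val +
        (φ (z' + x) + φ (z + x) + φ (z' + x + (z + x)) + φ 0).val) := by
    refine Finset.sum_le_sum fun z' _ => Finset.sum_le_sum fun z _ => ?_
    refine le_trans (le_of_eq ?_) (zval_add_le _ _)
    congr 1
    have : z' + x + (z + x) = z' + z := by
      rw [add_add_add_comm, vadd_self, add_zero]
    rw [this]
    unfold slope
    generalize φ z = a
    generalize φ (z + x) = b
    generalize φ z' = c
    generalize φ (z' + x) = d
    generalize φ (z' + z) = e
    generalize φ 0 = k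
    revert a b c d e k
    decide
  refine h2.trans (le_of_eq ?_)
  simp only [Finset.sum_add_distrib]
  rw [two_mul, additivityFails]
  congr 1
  rw [sum_shift (fun z' => ∑ z, (φ z' + φ (z + x) + φ (z' + (z + x)) + φ 0).val) x]
  refine Finset.sum_congr rfl fun z' _ => ?_
  exact sum_shift (fun z => (φ z' + φ z + φ (z' + z) + φ 0).val) x

theorem card_mul_val (a : ZMod 2) : N * a.val = ∑ _z : Vec n, a.val := by simp

/-- The counting form of the probabilistic method: a fixed element that could be 1 only at fewer
than all points is 0. -/
theorem zero_of_card_mul_lt {a : ZMod 2} (h : N * a.val < N) : a = 0 := by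
  have h1 : ∀ a : ZMod 2, a = 0 ∨ a = 1 := by decide
  rcases h1 a with rfl | rfl
  · rfl
  · simp [ZMod.val_one] at h

variable {φ}

/-- Each of the three majority values is wrong for fewer than a twentieth of the points, so some z
has all three votes correct, and the votes telescope along z, z + x, z + x + y. -/
theorem majority_add (hA : 40 * additivityFails φ < N ^ 2) (x y : Vec n) :
    majority φ (x + y) = majority φ x + majority φ y := by
  have hN : 0 < N := Fintype.card_pos
  have hm : ∀ x, 20 * ∑ z, (slope φ x z + majority φ x).val < N := by
    intro x
    have := majority_error φ x
    by_contra! h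
    nlinarith
  suffices h : majority φ x + majority φ y + majority φ (x + y) = 0 by
    have : ∀ a b c : ZMod 2, a + b + c = 0 → c = a + b := by decide
    exact this _ _ _ h
  apply zero_of_card_mul_lt (n := n)
  rw [card_mul_val]
  have h1 : ∑ _z : Vec n, (majority φ x + majority φ y + majority φ (x + y)).val ≤
      ∑ z, ((slope φ x z + majority φ x).val + (slope φ y (z + x) + majority φ y).val +
        (slope φ (x + y) z + majority φ (x + y)).val) := by
    refine Finset.sum_le_sum fun z _ => ?_
    refine le_trans (le_of_eq ?_) (zval_add3_le _ _ _)
    congr 1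
    unfold slope
    rw [add_assoc z x y]
    generalize φ z = a
    generalize φ (z + x) = b
    generalize φ (z + (x + y)) = c
    generalize majority φ x = d
    generalize majority φ y = e
    generalize majority φ (x + y) = k
    revert a b c d e k
    decide
  refine lt_of_le_of_lt h1 ?_
  simp only [Finset.sum_add_distrib]
  rw [sum_shift (fun z => (slope φ y z + majority φ y).val) x]
  have := hm x
  have := hm y
  have := hm (x + y)
  omega

/-- The third condition of the test says that most votes in the direction 1 are 1, and most votes
agree with the majority; some vote does both. -/
theorem majority_one (hA : 40 * additivityFails φ < N ^ 2)
    (hC : 40 * ∑ z, (slope φ 1 z + 1).val < N) : majority φ 1 = 1 := by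
  have hm := majority_error φ 1
  suffices h : majority φ 1 + 1 = 0 by
    have : ∀ a : ZMod 2, a + 1 = 0 → a = 1 := by decide
    exact this _ h
  apply zero_of_card_mul_lt (n := n)
  rw [card_mul_val]
  have h1 : ∑ _z : Vec n, (majority φ 1 + 1).val ≤
      ∑ z, ((slope φ 1 z + majority φ 1).val + (slope φ 1 z + 1).val) := by
    refine Finset.sum_le_sum fun z _ => ?_
    refine le_trans (le_of_eq ?_) (zval_add_le _ _)
    congr 1
    generalize slope φ 1 z = a
    generalize majority φ 1 = b
    revert a b
    decide
  refine lt_of_le_of_lt h1 ?_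
  rw [Finset.sum_add_distrib]
  have : 20 * ∑ z, (slope φ 1 z + majority φ 1).val < N := by
    by_contra! h
    nlinarith
  omega

/-- If the vote of z in the direction u is correct and additivity holds at (z, u), then φ u + φ 0 is
the majority value. The two failure counts sum to 2A + A, where A is the number of failing pairs. -/
theorem majority_close (hA : 40 * additivityFails φ < N ^ 2) :
    40 * ∑ u, (φ u + φ 0 + majority φ u).val ≤ 3 * N := by
  have hN : 0 < N := Fintype.card_pos
  have h1 : N * ∑ u, (φ u + φ 0 + majority φ u).val ≤
      ∑ u, ∑ z, ((slope φ u z + majority φ u).val + (φ z + φ u + φ (z + u) + φ 0).val) := by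
    rw [Finset.mul_sum]
    refine Finset.sum_le_sum fun u _ => ?_
    rw [card_mul_val]
    refine Finset.sum_le_sum fun z _ => ?_
    refine le_trans (le_of_eq ?_) (zval_add_le _ _)
    congr 1
    unfold slope
    generalize φ z = a
    generalize φ u = b
    generalize φ (z + u) = c
    generalize φ 0 = d
    generalize majority φ u = e
    revert a b c d e
    decide
  simp only [Finset.sum_add_distrib] at h1
  rw [Finset.sum_comm (f := fun u z => (φ z + φ u + φ (z + u) + φ 0).val)] at h1
  have h2 : N * ∑ u, ∑ z, (slope φ u z + majority φ u).val ≤ N * (2 * additivityFails φ) := by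
    rw [Finset.mul_sum]
    refine (Finset.sum_le_sum fun u _ => majority_error φ u).trans ?_
    simp
  have h3 := Nat.le_of_mul_le_mul_left h2 hN
  have h4 : N * ∑ u, (φ u + φ 0 + majority φ u).val ≤ 3 * additivityFails φ := by
    have : ∑ u, ∑ z, (φ u + φ z + φ (u + z) + φ 0).val = additivityFails φ := rfl
    omega
  by_contra! h
  nlinarith

/-- The defect G u v = L (u * v) + L u * L v is bilinear because L is additive. If it is nonzero
somewhere, it is nonzero on at least a quarter of all pairs: adding u to the first argument flips
the value, and likewise for the second. But where the vote in the direction u * v, the product test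
and the closeness of φ to L at u and at v are all in order, the defect vanishes, and this leaves too
few pairs. -/
theorem majority_mul (hA : 40 * additivityFails φ < N ^ 2)
    (hB : 40 * multiplicativityFails φ < N ^ 3) (u v : Vec n) :
    majority φ (u * v) = majority φ u * majority φ v := by
  have hN : 0 < N := Fintype.card_pos
  set L := majority φ with hL
  have hadd : ∀ x y, L (x + y) = L x + L y := majority_add hA
  set G : Vec n → Vec n → ZMod 2 := fun u v => L (u * v) + L u * L v with hG
  have hG1 : ∀ u u' v, G (u + u') v = G u v + G u' v := fun u u' v => by
    simp only [hG, add_mul, hadd]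
    abel
  have hG2 : ∀ u v v', G u (v + v') = G u v + G u v' := fun u v v' => by
    simp only [hG, mul_add, hadd]
    abel
  suffices h : G u v = 0 by
    have : ∀ a b : ZMod 2, a + b = 0 → a = b := by decide
    exact this _ _ h
  by_contra hne
  have hval : (G u v).val = 1 := by
    have : ∀ a : ZMod 2, a ≠ 0 → a.val = 1 := by decide
    exact this _ hne
  have h1 : N ≤ 2 * ∑ u', (G u' v).val := by
    have : ∑ u', (G u' v).val + ∑ u', (G (u' + u) v).val = 2 * ∑ u', (G u' v).val := by
      rw [sum_shift (fun u' => (G u' v).val), two_mul]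
    rw [← this, ← Finset.sum_add_distrib]
    calc N = ∑ _u' : Vec n, 1 := by simp
      _ ≤ _ := Finset.sum_le_sum fun u' _ => by
        rw [hG1, ← hval]
        generalize G u' v = a
        generalize G u v = b
        revert a b
        decide
  have h2 : ∀ u', N * (G u' v).val ≤ 2 * ∑ v', (G u' v').val := by
    intro u'
    have : ∑ v', (G u' v').val + ∑ v', (G u' (v' + v)).val = 2 * ∑ v', (G u' v').val := by
      rw [sum_shift (fun v' => (G u' v').val), two_mul]
    rw [← this, ← Finset.sum_add_distrib, card_mul_val]
    refine Finset.sum_le_sum fun v' _ => ?_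
    rw [hG2]
    generalize G u' v' = a
    generalize G u' v = b
    revert a b
    decide
  have h3 : N ^ 2 ≤ 4 * ∑ u', ∑ v', (G u' v').val := by
    have := Finset.sum_le_sum fun u' (_ : u' ∈ Finset.univ) => h2 u'
    rw [← Finset.mul_sum, ← Finset.mul_sum] at this
    nlinarith
  have h4 : ∑ u', ∑ v', N * (G u' v').val ≤
      ∑ u', ∑ v', ∑ z, ((slope φ (u' * v') z + L (u' * v')).val +
        (slope φ (u' * v') z + (φ u' + φ 0) * (φ v' + φ 0)).val +
        ((φ u' + φ 0 + L u').val + (φ v' + φ 0 + L v').val)) := by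
    refine Finset.sum_le_sum fun u' _ => Finset.sum_le_sum fun v' _ => ?_
    rw [card_mul_val]
    refine Finset.sum_le_sum fun z _ => ?_
    simp only [hG]
    generalize slope φ (u' * v') z = a
    generalize L (u' * v') = b
    generalize L u' = c
    generalize L v' = d
    generalize φ u' + φ 0 = e
    generalize φ v' + φ 0 = k
    revert a b c d e k
    decide
  simp only [Finset.sum_add_distrib, Finset.sum_const, Finset.card_univ, smul_eq_mul,
    ← Finset.mul_sum] at h4
  have h5 : ∑ u', ∑ v', N * ∑ z, (slope φ (u' * v') z + L (u' * v')).val ≤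
      N * (N * (2 * additivityFails φ)) := by
    calc _ ≤ ∑ _u' : Vec n, ∑ _v' : Vec n, 2 * additivityFails φ :=
          Finset.sum_le_sum fun u' _ => Finset.sum_le_sum fun v' _ => majority_error φ _
      _ = _ := by simp
  simp only [← Finset.mul_sum] at h5
  have h6 := Nat.le_of_mul_le_mul_left h5 hN
  have h7 := majority_close hA
  rw [← hL] at h7
  have h8 : ∑ u', ∑ v', ∑ z, (slope φ (u' * v') z + (φ u' + φ 0) * (φ v' + φ 0)).val =
    multiplicativityFails φ := rfl
  rw [h8] at h4
  generalize ∑ u', (φ u' + φ 0 + L u').val = S at *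
  generalize ∑ u', ∑ v', (G u' v').val = X at *
  generalize ∑ u', ∑ v', ∑ z, (slope φ (u' * v') z + L (u' * v')).val = Y at *
  generalize N = M at *
  generalize additivityFails φ = A at *
  generalize multiplicativityFails φ = B at *
  -- In units of M^3/40 the votes account for at most 2, the product test for less than 1 and the
  -- closeness for at most 6, in total less than the 10 that a nonzero defect forces.
  have e1 : 40 * (M * X) ≤ 40 * Y + 40 * B + 80 * (M * (M * S)) := by
    nlinarith
  have e2 : 40 * Y ≤ 2 * M ^ 3 := by nlinarith
  have e3 : 80 * (M * (M * S)) ≤ 6 * M ^ 3 := by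
    have : M * M * (40 * S) ≤ M * M * (3 * M) := Nat.mul_le_mul_left _ h7
    nlinarith
  have e4 : 10 * M ^ 3 ≤ 40 * (M * X) := by
    have : M * M ^ 2 ≤ M * (4 * X) := Nat.mul_le_mul_left _ h3
    nlinarith
  omega

/-- An additive and multiplicative unital function is a coordinate. -/
theorem exists_coordinate {L : Vec n → ZMod 2} (hadd : ∀ x y, L (x + y) = L x + L y)
    (hmul : ∀ x y, L (x * y) = L x * L y) (hone : L 1 = 1) : ∃ τ, ∀ x, L x = x τ := by
  have h0 : L 0 = 0 := by simpa using hadd 0 0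
  let L' : Vec n →+ ZMod 2 := { toFun := L, map_zero' := h0, map_add' := hadd }
  -- The all-one vector is the sum of the unit vectors, so L is 1 at some unit vector τ; multiplying
  -- by that vector then projects x to its coordinate τ.
  have hsum : ∑ i, L (Pi.single i 1) = 1 := by
    have h1 : ∑ i, Pi.single i 1 = (1 : Vec n) := Finset.univ_sum_single (1 : Vec n)
    calc ∑ i, L (Pi.single i 1) = L (∑ i, Pi.single i 1) := (map_sum L' _ _).symm
      _ = 1 := by rw [h1, hone]
  obtain ⟨τ, -, hτ⟩ := Finset.exists_ne_zero_of_sum_ne_zero (hsum.trans_ne one_ne_zero)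
  have hτ1 : L (Pi.single τ 1) = 1 := by
    have : ∀ a : ZMod 2, a ≠ 0 → a = 1 := by decide
    exact this _ hτ
  refine ⟨τ, fun x => ?_⟩
  have h2 : x * Pi.single τ 1 = Pi.single τ (x τ) := by
    funext i
    by_cases h : i = τ
    · subst h; simp
    · simp [h]
  have h3 := hmul x (Pi.single τ 1)
  rw [hτ1, mul_one, h2] at h3
  rw [← h3]
  have : x τ = 0 ∨ x τ = 1 := by generalize x τ = a; revert a; decide
  rcases this with h | h
  · rw [h, Pi.single_zero, h0]
  · rw [h, hτ1]

/-- The number of triples at which `LiteralTest` fails. -/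
def literalFails (φ : Vec n → ZMod 2) (x : Vec n) : ℕ :=
  ∑ u, ∑ v, ∑ z, if LiteralTest φ x u v z then 0 else 1

/-- Whatever the function, there is a variable such that the test fails with constant probability at
every point at which the function does not agree with the variable. -/
theorem exists_literal (hn : 0 < n) (φ : Vec n → ZMod 2) :
    ∃ τ, ∀ x, φ x + φ 0 ≠ x τ → N ^ 3 ≤ 40 * literalFails φ x := by
  have hN : 0 < N := Fintype.card_pos
  have heq : ∀ a b : ZMod 2, a + b ≠ 0 → a ≠ b := by decide
  have hval : ∀ (a : ZMod 2) (P : Prop) [Decidable P], (a ≠ 0 → ¬ P) →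
      a.val ≤ if P then 0 else 1 := by
    intro a P _ h
    by_cases ha : a = 0
    · simp [ha]
    · rw [if_neg (h ha)]
      have : a.val < 2 := ZMod.val_lt a
      omega
  by_cases hA : 40 * additivityFails φ < N ^ 2
  swap
  -- If one of the first three conditions, which do not involve x, fails often enough by itself,
  -- then the test fails often at every x and any variable will do.
  · refine ⟨⟨0, hn⟩, fun x _ => ?_⟩
    have : N * additivityFails φ ≤ literalFails φ x := by
      rw [additivityFails, literalFails, Finset.mul_sum]
      refine Finset.sum_le_sum fun u _ => ?_
      rw [Finset.mul_sum]
      refine Finset.sum_le_sum fun v _ => ?_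
      rw [card_mul_val]
      exact Finset.sum_le_sum fun z _ => hval _ _ fun h hP => h hP.1
    nlinarith
  by_cases hB : 40 * multiplicativityFails φ < N ^ 3
  swap
  · refine ⟨⟨0, hn⟩, fun x _ => ?_⟩
    have : multiplicativityFails φ ≤ literalFails φ x :=
      Finset.sum_le_sum fun u _ => Finset.sum_le_sum fun v _ => Finset.sum_le_sum fun z _ =>
        hval _ _ fun h hP => heq _ _ h hP.2.1
    omega
  by_cases hC : 40 * ∑ z, (slope φ 1 z + 1).val < N
  swap
  · refine ⟨⟨0, hn⟩, fun x _ => ?_⟩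
    have : N * (N * ∑ z, (slope φ 1 z + 1).val) ≤ literalFails φ x := by
      calc _ = ∑ _u : Vec n, ∑ _v : Vec n, ∑ z, (slope φ 1 z + 1).val := by simp
        _ ≤ _ := Finset.sum_le_sum fun u _ => Finset.sum_le_sum fun v _ =>
          Finset.sum_le_sum fun z _ => hval _ _ fun h hP => heq _ _ h hP.2.2.1
    have h2 : N * N * N ≤ N * N * (40 * ∑ z, (slope φ 1 z + 1).val) :=
      Nat.mul_le_mul_left _ (not_lt.1 hC)
    nlinarith
  obtain ⟨τ, hτ⟩ := exists_coordinate (majority_add hA) (majority_mul hA hB) (majority_one hA hC)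
  refine ⟨τ, fun x hx => ?_⟩
  rw [← hτ x] at hx
  have h1 : N * (N * ∑ z, (slope φ x z + (φ x + φ 0)).val) ≤ literalFails φ x := by
    calc _ = ∑ _u : Vec n, ∑ _v : Vec n, ∑ z, (slope φ x z + (φ x + φ 0)).val := by simp
      _ ≤ _ := Finset.sum_le_sum fun u _ => Finset.sum_le_sum fun v _ =>
        Finset.sum_le_sum fun z _ => hval _ _ fun h hP => heq _ _ h hP.2.2.2
  -- The bit read differs from the majority value, so each vote disagrees with one of them. Fewer
  -- than a twentieth disagree with the majority, so the fourth condition fails for most z.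
  have h2 : N ≤ ∑ z, (slope φ x z + (φ x + φ 0)).val + ∑ z, (slope φ x z + majority φ x).val := by
    rw [← Finset.sum_add_distrib]
    calc N = ∑ _z : Vec n, 1 := by simp
      _ ≤ _ := Finset.sum_le_sum fun z _ => by
        generalize φ x + φ 0 = a at hx ⊢
        generalize majority φ x = b at hx ⊢
        generalize slope φ x z = c
        revert a b c
        decide
  have h3 : 20 * ∑ z, (slope φ x z + majority φ x).val < N := by
    have := majority_error φ x
    by_contra! h
    nlinarith
  have h4 : N ≤ 40 * ∑ z, (slope φ x z + (φ x + φ 0)).val := by omega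
  have h5 : N * N * N ≤ N * N * (40 * ∑ z, (slope φ x z + (φ x + φ 0)).val) :=
    Nat.mul_le_mul_left _ h4
  nlinarith

/-- The equivalence between vectors of triples and triples of vectors. -/
def tripleEquiv (n : ℕ) : (Fin n → ZMod 2 × ZMod 2 × ZMod 2) ≃ Vec n × Vec n × Vec n where
  toFun g := (fun i => (g i).1, fun i => (g i).2.1, fun i => (g i).2.2)
  invFun p := fun i => (p.1 i, p.2.1 i, p.2.2 i)
  left_inv _ := rfl
  right_inv _ := rfl

theorem sum_ite_add_sum_ite {α β γ : Type} [Fintype α] [Fintype β] [Fintype γ]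
    (P : α → β → γ → Prop) [∀ a b c, Decidable (P a b c)] :
    (∑ p : α × β × γ, if P p.1 p.2.1 p.2.2 then 1 else 0) +
      ∑ a, ∑ b, ∑ c, (if P a b c then 0 else 1) =
      Fintype.card α * (Fintype.card β * Fintype.card γ) := by
  have : ∑ a, ∑ b, ∑ c, (if P a b c then 0 else 1) =
      ∑ p : α × β × γ, if P p.1 p.2.1 p.2.2 then 0 else 1 := by
    simp only [Fintype.sum_prod_type]
  rw [this, ← Finset.sum_add_distrib, ← Fintype.card_prod, ← Fintype.card_prod,
    Fintype.card_eq_sum_ones]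
  refine Finset.sum_congr rfl fun p _ => ?_
  split_ifs <;> rfl

theorem literalTest_prob (hn : 0 < n) (φ : Vec n → ZMod 2) :
    ∃ τ, ∀ x, φ x + φ 0 ≠ x τ →
      expect (fillP coin3P n) (fun g => if LiteralTest φ x (fun i => (g i).1) (fun i => (g i).2.1)
        (fun i => (g i).2.2) then 1 else 0) ≤ 39 / 40 := by
  obtain ⟨τ, hτ⟩ := exists_literal hn φ
  refine ⟨τ, fun x hx => ?_⟩
  have h1 := hτ x hx
  rw [coin3P_eq, fillP_uniform, expect_uniform]
  have h2 : (∑ g : Fin n → ZMod 2 × ZMod 2 × ZMod 2, if LiteralTest φ x (fun i => (g i).1)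
      (fun i => (g i).2.1) (fun i => (g i).2.2) then (1 : ENNReal) else 0) =
      ((∑ p : Vec n × Vec n × Vec n, if LiteralTest φ x p.1 p.2.1 p.2.2 then 1 else 0 : ℕ) :
        ENNReal) := by
    push_cast
    exact Equiv.sum_comp (tripleEquiv n)
      (fun p => if LiteralTest φ x p.1 p.2.1 p.2.2 then (1 : ENNReal) else 0)
  have h3 : Fintype.card (Fin n → ZMod 2 × ZMod 2 × ZMod 2) = N ^ 3 := by
    rw [Fintype.card_congr (tripleEquiv n), Fintype.card_prod, Fintype.card_prod]
    ring
  have h4 : (∑ p : Vec n × Vec n × Vec n, if LiteralTest φ x p.1 p.2.1 p.2.2 then 1 else 0) +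
      literalFails φ x = N ^ 3 := by
    rw [literalFails, sum_ite_add_sum_ite]
    ring
  rw [h2, h3]
  have hN : 0 < N ^ 3 := pow_pos Fintype.card_pos 3
  generalize (∑ p : Vec n × Vec n × Vec n, if LiteralTest φ x p.1 p.2.1 p.2.2 then 1 else 0) = s at *
  have h5 : 40 * s ≤ 39 * N ^ 3 := by omega
  rw [ENNReal.div_le_iff (by exact_mod_cast hN.ne') (by simp), ← ENNReal.mul_div_right_comm,
    ENNReal.le_div_iff_mul_le (by simp) (by simp)]
  rw [mul_comm]
  exact_mod_cast h5

end Literal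

/-! ### Soundness -/

theorem loopP_support {β : Type} {ν : ℕ → β → PMF β} {I : β → Prop}
    (h : ∀ k x, I x → ∀ y ∈ (ν k x).support, I y) (m k : ℕ) (x : β) (hx : I x) :
    ∀ y ∈ (loopP ν k m x).support, I y := by
  induction m generalizing k x with
  | zero =>
    intro y hy
    rw [loopP, PMF.mem_support_pure_iff] at hy
    rwa [hy]
  | succ m ih =>
    intro y hy
    rw [loopP, PMF.mem_support_bind_iff] at hy
    obtain ⟨z, hz, hy⟩ := hy
    exact ih (k + 1) z (h k x hx z hz) y hy

section Soundness

variable {n : ℕ} (f : BoolFun n) (hn : 0 < n)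

/-- The variable that a function is compared with. -/
def literal (φ : Vec n → ZMod 2) : Fin n := (literalTest_prob hn φ).choose

/-- Query the variables `τ j, …, τ (j + m - 1)` and continue. -/
def readTree (τ : ℕ → Fin n) (cont : ℕ → DecisionTree n) : ℕ → ℕ → ℕ → DecisionTree n
  | 0, _, A => cont A
  | m + 1, j, A => .node (τ j) (readTree τ cont m (j + 1) A)
      (readTree τ cont m (j + 1) (A + 4 * 2 ^ j))

/-- The decision tree that the tester follows. -/
def walkTree (d : ℕ) (h : Fin n → ℕ) (tab : ℕ → Vec n) : ℕ → Lab n → ℕ → DecisionTree n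
  | 0, _, _ => .leaf false
  | k + 1, lab, s =>
    if scanIdx f lab s tab (2 ^ d / 2 ^ s * rowFactor d) = 0 then
      if s = 0 then .leaf (decide (classSum f lab s 2 (tab 0) = 1))
      else if classSum f lab s 2 (tab 0) = 0 then .leaf false
      else readTree (fun j => literal hn (classFun f lab s (4 * 2 ^ j)))
        (fun A => walkTree d h tab k (collapse lab A) 0) s 0 1
    else if s < d then
      walkTree d h tab k (addClass lab h (searchBlock f lab s h
        (tab (scanIdx f lab s tab (2 ^ d / 2 ^ s * rowFactor d))) (tab 0) (numBlocks d)
        (blockBits d)) s) (s + 1)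
    else .leaf false

theorem readTree_depth {τ : ℕ → Fin n} {cont : ℕ → DecisionTree n} {D : ℕ}
    (hD : ∀ A, (cont A).depth ≤ D) (m j A : ℕ) : (readTree τ cont m j A).depth ≤ D + m := by
  induction m generalizing j A with
  | zero => exact hD A
  | succ m ih =>
    rw [readTree, DecisionTree.depth]
    have h1 := ih (j + 1) A
    have h2 := ih (j + 1) (A + 4 * 2 ^ j)
    omega

/-- The potential k + s pays for the queries: adding a class uses up one step and prepays one query,
and reading spends s and resets s to 0. -/
theorem walkTree_depth (d : ℕ) (h : Fin n → ℕ) (tab : ℕ → Vec n) (k : ℕ) (lab : Lab n) (s : ℕ) :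
    (walkTree f hn d h tab k lab s).depth ≤ k + s := by
  induction k generalizing lab s with
  | zero => simp [walkTree, DecisionTree.depth]
  | succ k ih =>
    rw [walkTree]
    split_ifs
    · simp [DecisionTree.depth]
    · simp [DecisionTree.depth]
    · exact (readTree_depth (fun A => ih _ 0) s 0 1).trans (by omega)
    · exact (ih _ _).trans (by omega)
    · simp [DecisionTree.depth]

/-- For d = 0 the permitted depth is 0, so the bound (d+1)^2 = 1 is not good enough; but no class
can be added and the tree is a single leaf. -/
theorem walkTree_depth_zero (h : Fin n → ℕ) (tab : ℕ → Vec n) (k : ℕ) (lab : Lab n) :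
    (walkTree f hn 0 h tab k lab 0).depth = 0 := by
  cases k with
  | zero => simp [walkTree, DecisionTree.depth]
  | succ k =>
    rw [walkTree]
    split_ifs <;> simp [DecisionTree.depth] at *

variable {f hn}

theorem readStep_fst {lab : Lab n} {s : ℕ} {x : Vec n} (j : ℕ) (q : Bool × ℕ) (hq : q.1 = false) :
    ∀ q' ∈ (readStep f lab s x j q).support, q'.1 = false := by
  intro q' hq'
  rw [readStep, PMF.mem_support_map_iff] at hq'
  obtain ⟨g, -, rfl⟩ := hq'
  simp [hq]

/-- F stands for the acceptance probability of the rest of the walk. As long as the bits read agree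
with the associated variables, the run follows `readTree`. At the first disagreement the literal
test fails with probability at least 1/40, whatever happens later, and a failed test is never
forgotten. -/
theorem read_sound {lab : Lab n} {s : ℕ} {x : Cube n} {cont : ℕ → DecisionTree n} {b : Bool}
    {F : Bool × ℕ → ENNReal} (hF1 : ∀ q, F q ≤ 1) (hF0 : ∀ A, F (false, A) = 0)
    (hF : ∀ A, (cont A).eval x ≠ b → ∀ acc, F (acc, A) ≤ 39 / 40) (m j A : ℕ) (acc : Bool)
    (hT : (readTree (fun j => literal hn (classFun f lab s (4 * 2 ^ j))) cont m j A).eval x ≠ b) :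
    expect (loopP (readStep f lab s (toVec x)) j m (acc, A)) F ≤ 39 / 40 := by
  induction m generalizing j A acc with
  | zero =>
    rw [loopP, expect_pure]
    exact hF A hT acc
  | succ m ih =>
    rw [loopP, expect_bind]
    set φ := classFun f lab s (4 * 2 ^ j) with hφ
    set τ := literal hn φ with hτ
    by_cases hb : φ (toVec x) + φ 0 = toVec x τ
    -- The bit read does not depend on the random test vectors, so every outcome continues in the
    -- same subtree; only the verdict may vary.
    · refine expect_le_of_support fun q hq => ?_
      rw [readStep, PMF.mem_support_map_iff] at hq
      obtain ⟨g, -, rfl⟩ := hq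
      apply ih
      rw [readTree, DecisionTree.eval] at hT
      rw [← hφ, hb]
      by_cases hx : x τ
      · rw [← hφ, ← hτ, if_pos hx] at hT
        simpa [toVec, hx, ZMod.val_one] using hT
      · rw [← hφ, ← hτ, if_neg hx] at hT
        simpa [toVec, hx] using hT
    · have hP := (literalTest_prob hn φ).choose_spec (toVec x) hb
      refine le_trans ?_ hP
      rw [readStep, expect_map]
      refine expect_mono fun g => ?_
      rw [← hφ]
      split_ifs with ht
      · exact expect_le_const hF1
      · refine expect_le_of_support fun q hq => ?_
        have := loopP_support (ν := readStep f lab s (toVec x)) (I := fun q => q.1 = false)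
          readStep_fst m (j + 1) _ (by simp [ht]) q hq
        obtain ⟨q1, q2⟩ := q
        simp only at this
        rw [this, hF0]

/-- The state in which the tester accepts the example. -/
def acceptInd (q : WalkState n) : ENNReal := if q.1 && q.2.isNone then 1 else 0

theorem acceptInd_le_one (q : WalkState n) : acceptInd q ≤ 1 := by
  unfold acceptInd
  split_ifs <;> simp

theorem walkStep_fst {d : ℕ} {h : Fin n → ℕ} {tab : ℕ → Vec n} {x : Vec n} (q : WalkState n)
    (hq : q.1 = false) : ∀ q' ∈ (walkStep f d h tab x q).support, q'.1 = false := by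
  intro q' hq'
  obtain ⟨acc, _ | ⟨lab, s⟩⟩ := q
  · rw [walkStep, PMF.mem_support_pure_iff] at hq'
    rwa [hq']
  · simp only at hq
    subst hq
    rw [walkStep] at hq'
    split_ifs at hq'
    · rw [PMF.mem_support_pure_iff] at hq'
      simp [hq']
    · rw [PMF.mem_support_pure_iff] at hq'
      simp [hq']
    · rw [PMF.mem_support_map_iff] at hq'
      obtain ⟨r, hr, rfl⟩ := hq'
      exact loopP_support (I := fun q => q.1 = false) readStep_fst _ _ _ rfl r hr
    · rw [PMF.mem_support_pure_iff] at hq'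
      simp [hq']
    · rw [PMF.mem_support_pure_iff] at hq'
      simp [hq']

theorem walk_false {d : ℕ} {h : Fin n → ℕ} {tab : ℕ → Vec n} {x : Vec n} (m k : ℕ)
    (st : Option (Lab n × ℕ)) :
    expect (loopP (fun _ => walkStep f d h tab x) k m (false, st)) acceptInd = 0 := by
  refine le_antisymm (expect_le_of_support fun q hq => ?_) zero_le
  have := loopP_support (ν := fun _ => walkStep f d h tab x) (I := fun q => q.1 = false)
    (fun _ => walkStep_fst) m k _ rfl q hq
  simp [acceptInd, this]

theorem walk_none {d : ℕ} {h : Fin n → ℕ} {tab : ℕ → Vec n} {x : Vec n} (m k : ℕ) (acc : Bool) :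
    loopP (fun _ => walkStep f d h tab x) k m (acc, none) = PMF.pure (acc, none) := by
  induction m generalizing k with
  | zero => rfl
  | succ m ih => rw [loopP, walkStep, PMF.pure_bind, ih]

/-- Adding a class is deterministic and `read_sound` covers the readings. If the path of x ends at a
leaf carrying the wrong value, the final comparison with f(x) rejects; in the remaining cases the
tester rejects or runs out of steps. -/
theorem walk_sound {d : ℕ} {h : Fin n → ℕ} {tab : ℕ → Vec n} {x : Cube n} (m k : ℕ) (acc : Bool)
    (lab : Lab n) (s : ℕ) (hT : (walkTree f hn d h tab m lab s).eval x ≠ f x) :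
    expect (loopP (fun _ => walkStep f d h tab (toVec x)) k m (acc, some (lab, s))) acceptInd ≤
      39 / 40 := by
  induction m generalizing k acc lab s with
  | zero => simp [loopP, acceptInd]
  | succ m ih =>
    rw [loopP, walkStep]
    rw [walkTree] at hT
    split_ifs at hT ⊢ with h1 h2 h3 h4
    · have hf : (decide (classSum f lab s 2 (tab 0) = fZ f (toVec x))) = false := by
        rw [fZ_toVec]
        rw [DecisionTree.eval] at hT
        have : ∀ c : ZMod 2, c = 0 ∨ c = 1 := by decide
        rcases this (classSum f lab s 2 (tab 0)) with hc | hc <;> rw [hc] at hT ⊢ <;>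
          cases hfx : f x <;> simp [hfx] at hT ⊢
      rw [hf, Bool.and_false, PMF.pure_bind, walk_false]
      simp
    · rw [PMF.pure_bind, walk_false]
      simp
    · rw [PMF.bind_map, expect_bind]
      refine read_sound (b := f x) (hn := hn)
        (cont := fun A => walkTree f hn d h tab m (collapse lab A) 0) ?_ ?_ ?_ s 0 1 acc hT
      · exact fun q => expect_le_const acceptInd_le_one
      · exact fun A => walk_false _ _ _
      · exact fun A hA acc' => ih _ _ _ _ hA
    · rw [PMF.pure_bind]
      exact ih _ _ _ _ hT
    · rw [PMF.pure_bind, walk_false]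
      simp

/-- The indicator of acceptance. -/
def boolInd (b : Bool) : ENNReal := if b then 1 else 0

theorem sampleStep_expect (D : PMF (Cube n)) {d : ℕ} {h : Fin n → ℕ} {tab : ℕ → Vec n} (acc : Bool) :
    expect (sampleStep f D d h tab acc) boolInd =
      expect D fun x => expect (loopP (fun _ => walkStep f d h tab (toVec x)) 0 ((d + 1) ^ 2)
        (acc, some (fun _ => 2, 0))) acceptInd := by
  rw [sampleStep, expect_bind]
  simp only [expect_map]
  rfl

theorem loop_sound {ν : Bool → PMF Bool} {r : ENNReal} (hF : expect (ν false) boolInd = 0)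
    (hT : expect (ν true) boolInd ≤ r) (m k : ℕ) :
    expect (loopP (fun _ => ν) k m true) boolInd ≤ r ^ m ∧
    expect (loopP (fun _ => ν) k m false) boolInd = 0 := by
  induction m generalizing k with
  | zero => simp [loopP, boolInd]
  | succ m ih =>
    obtain ⟨h1, h2⟩ := ih (k + 1)
    have h3 : ∀ b, expect (loopP (fun _ => ν) (k + 1) m b) boolInd ≤ boolInd b * r ^ m := by
      intro b
      cases b
      · rw [h2]; simp
      · simpa [boolInd] using h1
    have h4 : ∀ b, expect ((ν b).bind (loopP (fun _ => ν) (k + 1) m)) boolInd ≤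
        expect (ν b) boolInd * r ^ m := by
      intro b
      rw [expect_bind]
      refine (expect_mono h3).trans_eq ?_
      rw [expect, expect, ← ENNReal.tsum_mul_right]
      simp_rw [mul_assoc]
    constructor
    · rw [loopP, pow_succ, mul_comm]
      refine (h4 true).trans ?_
      gcongr
    · rw [loopP]
      have := h4 false
      rw [hF, zero_mul] at this
      exact le_antisymm this zero_le

/-- From 1 - t ≤ exp(-t) and 80 E ε / 40 ≥ 2; moreover exp 2 ≥ 1 + 2. -/
theorem pow_le_third {ε : ℝ} (hε : 0 < ε) (h1 : ε ≤ 1) {E : ℕ} (hE : 1 / ε ≤ E) :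
    (1 - ε / 40) ^ (80 * E) ≤ 1 / 3 := by
  have h2 : (1 - ε / 40) ^ (80 * E) ≤ Real.exp (-(ε / 40)) ^ (80 * E) := by
    gcongr
    · linarith
    · have := Real.add_one_le_exp (-(ε / 40))
      linarith
  refine h2.trans ?_
  rw [← Real.exp_nat_mul]
  have h3 : ((80 * E : ℕ) : ℝ) * -(ε / 40) ≤ -2 := by
    push_cast
    rw [div_le_iff₀ hε] at hE
    linarith
  refine (Real.exp_le_exp.2 h3).trans ?_
  rw [Real.exp_neg, one_div]
  apply inv_anti₀ (by norm_num)
  have := Real.add_one_le_exp (2 : ℝ)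
  linarith

theorem sampleStep_sound (D : PMF (Cube n)) {d : ℕ} {h : Fin n → ℕ} {tab : ℕ → Vec n} {ε : ℝ}
    (hε : 0 < ε) (h1 : ε ≤ 1)
    (hfar : ENNReal.ofReal ε <
      disagreement D f (walkTree f hn d h tab ((d + 1) ^ 2) (fun _ => 2) 0).eval) :
    expect (sampleStep f D d h tab true) boolInd ≤ ENNReal.ofReal (1 - ε / 40) := by
  set T := walkTree f hn d h tab ((d + 1) ^ 2) (fun _ => 2) 0 with hT
  rw [sampleStep_expect]
  set S := {x | f x ≠ T.eval x} with hS
  classical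
  have h2 : expect D (fun x => expect (loopP (fun _ => walkStep f d h tab (toVec x)) 0 ((d + 1) ^ 2)
        (true, some (fun _ => 2, 0))) acceptInd) ≤
      expect D (fun x => if x ∈ S then 39 / 40 else 1) := by
    refine expect_mono fun x => ?_
    split_ifs with hx
    · exact walk_sound (hn := hn) _ _ _ _ _ (Ne.symm hx)
    · exact expect_le_const acceptInd_le_one
  refine h2.trans ?_
  have h40 : (39 / 40 : ENNReal) + 1 / 40 = 1 := by
    rw [← ENNReal.add_div]
    norm_num
    exact ENNReal.div_self (by simp) (by simp)
  have h3 : expect D (fun x => if x ∈ S then 39 / 40 else 1) + disagreement D f T.eval / 40 = 1 := by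
    rw [disagreement, toOuterMeasure_eq_expect, ← hS, div_eq_mul_inv (expect _ _), expect, expect,
      ← ENNReal.tsum_mul_right, ← ENNReal.tsum_add]
    refine (tsum_congr fun x => ?_).trans D.tsum_coe
    by_cases hx : x ∈ S
    · rw [if_pos hx, Set.indicator_of_mem hx, Pi.one_apply, mul_one, ← mul_add]
      rw [show (40 : ENNReal)⁻¹ = 1 / 40 by simp, h40, mul_one]
    · simp [hx]
  have h4 : ENNReal.ofReal (1 - ε / 40) + ENNReal.ofReal ε / 40 = 1 := by
    rw [show (40 : ENNReal) = ENNReal.ofReal 40 by simp, ← ENNReal.ofReal_div_of_pos (by norm_num),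
      ← ENNReal.ofReal_add (by linarith) (by positivity)]
    simp
  have h5 : ENNReal.ofReal ε / 40 ≤ disagreement D f T.eval / 40 := by gcongr
  by_contra! hcon
  have h6 : ENNReal.ofReal ε / 40 ≠ ⊤ := ENNReal.div_ne_top (by simp) (by simp)
  have := ENNReal.add_lt_add_of_lt_of_le h6 hcon h5
  rw [h3, h4] at this
  exact lt_irrefl _ this

/-- The bound is proved for every fixed hash and table. These are drawn before the examples, so
`walkTree` is one tree for all examples and farness applies to it. -/
theorem verdictP_sound (hn : 0 < n) (D : PMF (Cube n)) {d E depth : ℕ} {ε : ℝ} (hε : 0 < ε)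
    (h1 : ε ≤ 1) (hE : 1 / ε ≤ E) (hfar : IsFarFrom D ε f (DT n depth))
    (hdepth : d = 0 ∨ (d + 1) ^ 2 ≤ depth) :
    expect (verdictP f D d E) boolInd ≤ 1 / 3 := by
  rw [verdictP, expect_bind]
  refine expect_le_const fun hb => ?_
  rw [expect_bind]
  refine expect_le_const fun tb => ?_
  have hwalk : ENNReal.ofReal ε < disagreement D f (walkTree f hn d (blockOf hb) (tableOf tb)
      ((d + 1) ^ 2) (fun _ => 2) 0).eval := by
    refine hfar _ ⟨_, ?_, rfl⟩
    rcases hdepth with rfl | hd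
    · rw [walkTree_depth_zero]
      exact Nat.zero_le _
    · exact (walkTree_depth f hn d _ _ _ _ _).trans (by omega)
  have h2 := (loop_sound (ν := sampleStep f D d (blockOf hb) (tableOf tb)) ?_
    (sampleStep_sound D hε h1 hwalk) (80 * E) 0).1
  · refine h2.trans ?_
    rw [← ENNReal.ofReal_pow (by linarith)]
    refine (ENNReal.ofReal_le_ofReal (pow_le_third hε h1 hE)).trans ?_
    rw [ENNReal.ofReal_div_of_pos (by norm_num)]
    simp
  · rw [sampleStep_expect]
    refine le_antisymm (expect_le_const fun x => ?_) zero_le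
    rw [walk_false]

end Soundness

/-! ### Polynomial degree over the field with two elements -/

section Degree

variable {n : ℕ}

/-- `g` has degree at most `r`: all its derivatives of order `r + 1` vanish. -/
def PolyDeg : ℕ → (Vec n → ZMod 2) → Prop
  | 0, g => ∀ x z, g z + g (z + x) = 0
  | r + 1, g => ∀ x, PolyDeg r fun z => g z + g (z + x)

variable {g g' : Vec n → ZMod 2} {r r' : ℕ}

theorem PolyDeg.const (c : ZMod 2) (r : ℕ) : PolyDeg r fun _ : Vec n => c := by
  induction r generalizing c with
  | zero => exact fun _ _ => zadd_self c
  | succ r ih => exact fun _ => ih _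

theorem PolyDeg.add (h : PolyDeg r g) (h' : PolyDeg r g') : PolyDeg r fun z => g z + g' z := by
  induction r generalizing g g' with
  | zero =>
    intro x z
    rw [add_add_add_comm, h, h', add_zero]
  | succ r ih =>
    intro x
    have := ih (h x) (h' x)
    simpa only [add_add_add_comm] using this

theorem PolyDeg.shift (h : PolyDeg r g) (y : Vec n) : PolyDeg r fun z => g (z + y) := by
  induction r generalizing g with
  | zero =>
    intro x z
    show g (z + y) + g (z + x + y) = 0
    rw [add_right_comm z x y]
    exact h x _
  | succ r ih =>
    intro x
    have := ih (h x)
    simpa only [add_right_comm] using this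

theorem PolyDeg.const_mul (h : PolyDeg r g) (c : ZMod 2) : PolyDeg r fun z => c * g z := by
  have : ∀ c : ZMod 2, c = 0 ∨ c = 1 := by decide
  rcases this c with rfl | rfl
  · simpa using PolyDeg.const 0 r
  · simpa using h

theorem PolyDeg.succ (h : PolyDeg r g) : PolyDeg (r + 1) g := by
  induction r generalizing g with
  | zero =>
    intro x
    have : (fun z => g z + g (z + x)) = fun _ => 0 := funext fun z => h x z
    rw [this]
    exact PolyDeg.const 0 0
  | succ r ih => exact fun x => ih (h x)

theorem PolyDeg.mono (h : PolyDeg r g) (hr : r ≤ r') : PolyDeg r' g := by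
  induction r', hr using Nat.le_induction with
  | base => exact h
  | succ k _ ih => exact ih.succ

/-- The product rule for derivatives: the derivative of z i * g is z i times the derivative of g,
plus a constant multiple of a shift of g, and the first term has smaller degree by induction. -/
theorem PolyDeg.coord_mul (h : PolyDeg r g) (i : Fin n) : PolyDeg (r + 1) fun z => z i * g z := by
  have key : ∀ (g : Vec n → ZMod 2) (x z : Vec n), z i * g z + (z + x) i * g (z + x) =
      z i * (g z + g (z + x)) + x i * g (z + x) := by
    intro g x z
    rw [Pi.add_apply]
    ring
  induction r generalizing g with
  | zero =>
    intro x
    simp only [key, h x, mul_zero, zero_add]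
    exact (PolyDeg.shift h x).const_mul (x i)
  | succ r ih =>
    intro x
    simp only [key]
    exact (ih (h x)).add ((PolyDeg.shift h x).const_mul (x i))

/-- The hypothesis on p says that it is affine with linear part ℓ; the lemma is needed for the map
that overwrites the labelled variables. -/
theorem PolyDeg.comp (h : PolyDeg r g) {p ℓ : Vec n → Vec n} (hp : ∀ z x, p (z + x) = p z + ℓ x) :
    PolyDeg r fun z => g (p z) := by
  induction r generalizing g with
  | zero =>
    intro x z
    show g (p z) + g (p (z + x)) = 0
    rw [hp]
    exact h _ _
  | succ r ih =>
    intro x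
    have := ih (h (ℓ x))
    simpa only [hp] using this

/-- The minimum distance of Reed-Muller codes. If all derivatives vanish, g is a nonzero constant.
Otherwise some derivative is nonzero and has degree r - 1, and its support has at most twice the
size of that of g. -/
theorem PolyDeg.card_le (h : PolyDeg r g) {z₀ : Vec n} (hz : g z₀ ≠ 0) :
    Fintype.card (Vec n) ≤ 2 ^ r * ∑ z, (g z).val := by
  have h1 : ∀ a : ZMod 2, a ≠ 0 → a.val = 1 := by decide
  have hconst : (∀ x z, g z + g (z + x) = 0) → Fintype.card (Vec n) ≤ ∑ z, (g z).val := by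
    intro hc
    rw [Fintype.card_eq_sum_ones]
    refine Finset.sum_le_sum fun z _ => ?_
    have h2 := hc (z₀ + z) z₀
    rw [← add_assoc, vadd_self, zero_add] at h2
    rw [h1 (g z) (fun h0 => hz (by rwa [h0, add_zero] at h2))]
  induction r generalizing g z₀ with
  | zero => simpa using hconst h
  | succ r ih =>
    by_cases hc : ∀ x z, g z + g (z + x) = 0
    · refine (hconst hc).trans (Nat.le_mul_of_pos_left _ (by positivity))
    · push Not at hc
      obtain ⟨x, z, hxz⟩ := hc
      have h2 : Fintype.card (Vec n) ≤ 2 ^ r * ∑ z, (g z + g (z + x)).val := by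
        refine ih (h x) hxz fun hc' => ?_
        rw [Fintype.card_eq_sum_ones]
        refine Finset.sum_le_sum fun y _ => ?_
        have h3 := hc' (z + y) z
        rw [← add_assoc z z y, vadd_self, zero_add] at h3
        rw [h1 _ (fun h0 => hxz (by rwa [h0, add_zero] at h3))]
      have h3 : ∑ z, (g z + g (z + x)).val ≤ 2 * ∑ z, (g z).val := by
        refine (Finset.sum_le_sum fun z _ => zval_add_le _ _).trans ?_
        rw [Finset.sum_add_distrib, sum_shift (fun z => (g z).val), two_mul]
      calc _ ≤ _ := h2
        _ ≤ 2 ^ r * (2 * ∑ z, (g z).val) := by gcongr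
        _ = _ := by rw [pow_succ]; ring

theorem fZ_node (i : Fin n) (l r : DecisionTree n) (y : Vec n) :
    fZ (DecisionTree.node i l r).eval y = fZ l.eval y + y i * (fZ l.eval y + fZ r.eval y) := by
  unfold fZ
  rw [DecisionTree.eval]
  have : ∀ a : ZMod 2, a = 0 ∨ a = 1 := by decide
  rcases this (y i) with h | h
  · simp [h]
  · simp only [h, one_mul, ← add_assoc, zadd_self, zero_add]
    simp

/-- A node computes l + x_i (l + r), which raises the degree by at most one. -/
theorem polyDeg_tree (T : DecisionTree n) : PolyDeg T.depth (fZ T.eval) := by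
  induction T with
  | leaf b => exact PolyDeg.const (if b then 1 else 0) 0
  | node i l r hl hr =>
    have h1 : PolyDeg (max l.depth r.depth) (fZ l.eval) := hl.mono (le_max_left _ _)
    have h2 : PolyDeg (max l.depth r.depth) (fZ r.eval) := hr.mono (le_max_right _ _)
    have : fZ (DecisionTree.node i l r).eval =
        fun y => fZ l.eval y + y i * (fZ l.eval y + fZ r.eval y) := funext (fZ_node i l r)
    rw [this]
    exact h1.succ.add ((h1.add h2).coord_mul i)

end Degree

/-! ### Sums over classes -/

section ClassSum

variable {n : ℕ}

/-- The labels are those of at most `s` classes. -/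
def ValidLab (s : ℕ) (lab : Lab n) : Prop :=
  ∀ i, lab i = 0 ∨ lab i = 1 ∨ lab i = 2 ∨ ∃ j < s, lab i = 4 * 2 ^ j

theorem div_class (a j : ℕ) : (4 * a + 1) / (4 * 2 ^ j) = a / 2 ^ j := by
  rw [← Nat.div_div_eq_div_mul]
  congr 1
  omega

/-- Half of 4a + 1, rounded down, is even, so the condition in `classSum` excludes nothing. -/
theorem classSum_two (f : BoolFun n) (lab : Lab n) (s : ℕ) (y : Vec n) :
    classSum f lab s 2 y = ∑ a ∈ Finset.range (2 ^ s), fZ f (pointOf lab 2 (4 * a + 1) y) := by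
  refine Finset.sum_congr rfl fun a _ => if_pos ?_
  omega

theorem cast_two_pow_add_div {s j a : ℕ} (hj : j < s) :
    (((2 ^ s + a) / 2 ^ j : ℕ) : ZMod 2) = ((a / 2 ^ j : ℕ) : ZMod 2) := by
  have h1 : 2 ^ s = 2 ^ j * (2 * 2 ^ (s - j - 1)) := by
    rw [← pow_succ', ← pow_add]
    congr 1
    omega
  have h2 : (2 : ZMod 2) = 0 := rfl
  rw [h1, Nat.mul_add_div (by positivity)]
  push_cast
  rw [h2]
  ring

/-- The indicator of a class. -/
def classInd (lab : Lab n) (s : ℕ) : Vec n := fun i => if lab i = 4 * 2 ^ s then 1 else 0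

/-- Setting the bit s flips exactly the variables of the class s. Thus summing over that bit takes a
derivative in the direction of the class. -/
theorem pointOf_top {S s a : ℕ} {lab : Lab n} (hlab : ValidLab S lab) (ha : a < 2 ^ s) (y : Vec n) :
    pointOf lab 2 (4 * (2 ^ s + a) + 1) y = pointOf lab 2 (4 * a + 1) y + classInd lab s := by
  have hs1 : 1 ≤ 2 ^ s := Nat.one_le_two_pow
  have h2 : (2 : ZMod 2) = 0 := rfl
  have h4 : (4 : ZMod 2) = 0 := rfl
  funext i
  rw [Pi.add_apply, pointOf, pointOf, classInd]
  rcases hlab i with h | h | h | ⟨j, -, h⟩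
  · simp [h]
  · rw [h, if_neg (by norm_num), if_neg (by norm_num), if_neg (by omega), Nat.div_one, Nat.div_one]
    push_cast
    rw [h4]
    ring
  · rw [h, if_pos (by simp), if_pos (by simp), if_neg (by omega), add_zero]
  · have hj1 : 1 ≤ 2 ^ j := Nat.one_le_two_pow
    rw [h, if_neg (by omega), if_neg (by omega), div_class, div_class]
    rcases lt_trichotomy j s with hjs | rfl | hjs
    · rw [cast_two_pow_add_div hjs, if_neg, add_zero]
      have := Nat.pow_lt_pow_right (a := 2) (by norm_num) hjs
      omega
    · rw [if_pos rfl, Nat.add_div_left _ (by positivity)]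
      push_cast
      ring
    · have h1 : 2 ^ s * 2 ≤ 2 ^ j := by
        rw [← pow_succ]
        exact Nat.pow_le_pow_right (by norm_num) hjs
      rw [Nat.div_eq_of_lt (by omega), Nat.div_eq_of_lt (by omega), if_neg (by omega)]
      simp

/-- By `pointOf_top` the sum over the last class is a sum of the same form for a derivative of g,
which has smaller degree. What remains for s = 0 is g at a point depending affinely on y. -/
theorem polyDeg_sum {S s d : ℕ} {lab : Lab n} (hlab : ValidLab S lab) {g : Vec n → ZMod 2}
    (hg : PolyDeg d g) (hs : s ≤ d) :
    PolyDeg (d - s) fun y => ∑ a ∈ Finset.range (2 ^ s), g (pointOf lab 2 (4 * a + 1) y) := by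
  induction s generalizing d g with
  | zero =>
    simp only [pow_zero, Finset.range_one, Finset.sum_singleton]
    refine hg.comp (ℓ := fun x i => if lab i = 2 then x i else 0) fun z x => ?_
    funext i
    simp only [pointOf, Pi.add_apply, or_self]
    split_ifs <;> simp
  | succ s ih =>
    obtain ⟨d, rfl⟩ := Nat.exists_eq_add_of_le' (show 1 ≤ d by omega)
    have h1 := ih (hg (classInd lab s)) (by omega)
    have h2 : (fun y => ∑ a ∈ Finset.range (2 ^ (s + 1)), g (pointOf lab 2 (4 * a + 1) y)) =
        fun y => ∑ a ∈ Finset.range (2 ^ s), (g (pointOf lab 2 (4 * a + 1) y) +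
          g (pointOf lab 2 (4 * a + 1) y + classInd lab s)) := by
      funext y
      rw [pow_succ, mul_two, Finset.sum_range_add, Finset.sum_add_distrib]
      congr 1
      refine Finset.sum_congr rfl fun a ha => ?_
      rw [pointOf_top hlab (Finset.mem_range.1 ha)]
    rw [h2]
    convert h1 using 1
    omega

end ClassSum

/-! ### Completeness of the processing of one example -/

section Tree

variable {n : ℕ}

/-- The variables of a decision tree. -/
def DecisionTree.vars : DecisionTree n → Finset (Fin n)
  | .leaf _ => ∅
  | .node i l r => insert i (l.vars ∪ r.vars)

/-- The variables queried on an input. -/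
def DecisionTree.path : DecisionTree n → Cube n → Finset (Fin n)
  | .leaf _, _ => ∅
  | .node i l r, x => insert i (if x i then r.path x else l.path x)

theorem card_vars_lt (T : DecisionTree n) : T.vars.card + 1 ≤ 2 ^ T.depth := by
  induction T with
  | leaf b => simp [DecisionTree.vars, DecisionTree.depth]
  | node i l r hl hr =>
    rw [DecisionTree.vars, DecisionTree.depth, pow_succ]
    have h1 := Finset.card_insert_le i (l.vars ∪ r.vars)
    have h2 := Finset.card_union_le l.vars r.vars
    have h3 : 2 ^ l.depth ≤ 2 ^ max l.depth r.depth :=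
      Nat.pow_le_pow_right (by norm_num) (le_max_left _ _)
    have h4 : 2 ^ r.depth ≤ 2 ^ max l.depth r.depth :=
      Nat.pow_le_pow_right (by norm_num) (le_max_right _ _)
    omega

theorem path_subset (T : DecisionTree n) (x : Cube n) : T.path x ⊆ T.vars := by
  induction T with
  | leaf b => simp [DecisionTree.path]
  | node i l r hl hr =>
    rw [DecisionTree.path, DecisionTree.vars]
    refine Finset.insert_subset_insert i ?_
    split_ifs
    · exact hr.trans Finset.subset_union_right
    · exact hl.trans Finset.subset_union_left

theorem card_path_le (T : DecisionTree n) (x : Cube n) : (T.path x).card ≤ T.depth := by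
  induction T with
  | leaf b => simp [DecisionTree.path]
  | node i l r hl hr =>
    rw [DecisionTree.path, DecisionTree.depth]
    refine (Finset.card_insert_le _ _).trans ?_
    split_ifs <;> omega

theorem eval_of_path (T : DecisionTree n) {x y : Cube n} (h : ∀ i ∈ T.path x, y i = x i) :
    T.eval y = T.eval x := by
  induction T with
  | leaf b => rfl
  | node i l r hl hr =>
    rw [DecisionTree.path] at h
    rw [DecisionTree.eval, DecisionTree.eval, h i (Finset.mem_insert_self _ _)]
    split_ifs at h ⊢
    · exact hr fun j hj => h j (Finset.mem_insert_of_mem hj)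
    · exact hl fun j hj => h j (Finset.mem_insert_of_mem hj)

theorem fZ_of_path (T : DecisionTree n) {x : Cube n} {y : Vec n}
    (h : ∀ i ∈ T.path x, y i = toVec x i) : fZ T.eval y = fZ T.eval (toVec x) := by
  rw [fZ_toVec, fZ, eval_of_path T (x := x)]
  intro i hi
  rw [h i hi, toVec]
  cases x i <;> simp

theorem fZ_of_vars (T : DecisionTree n) {y y' : Vec n} (h : ∀ i ∈ T.vars, y i = y' i) :
    fZ T.eval y = fZ T.eval y' := by
  rw [fZ, fZ, eval_of_path T (x := fun i => decide (y' i ≠ 0))]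
  intro i hi
  rw [h i (path_subset T _ hi)]

/-- Only labels and values on the variables of the tree matter. Hence wrong labels elsewhere in a
block do no harm, and the union bound for the table need not range over all n variables. -/
theorem classSum_congr (T : DecisionTree n) {lab lab' : Lab n} {s skip : ℕ} {y y' : Vec n}
    (hl : ∀ i ∈ T.vars, lab i = lab' i)
    (hy : ∀ i ∈ T.vars, lab i = 2 ∨ lab i = skip → y i = y' i) :
    classSum T.eval lab s skip y = classSum T.eval lab' s skip y' := by
  refine Finset.sum_congr rfl fun a _ => ?_
  split_ifs
  · refine fZ_of_vars T fun i hi => ?_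
    rw [pointOf, pointOf, ← hl i hi]
    split_ifs with h
    · exact hy i hi h
    · rfl
  · rfl

/-- The table distinguishes every sum over classes that may occur from a constant. -/
def GoodTab (T : DecisionTree n) (d : ℕ) (tab : ℕ → Vec n) : Prop :=
  ∀ lab s, s ≤ d → ValidLab s lab → (T.vars.filter fun i => lab i ≠ 2).card ≤ (d + 1) ^ 2 →
    (∀ j < 2 ^ d / 2 ^ s * rowFactor d,
      classSum T.eval lab s 2 (tab j) = classSum T.eval lab s 2 (tab 0)) →
    ∀ y, classSum T.eval lab s 2 y = classSum T.eval lab s 2 (tab 0)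

/-- The invariant while an example is processed with `k` steps left. -/
structure WalkInv (T : DecisionTree n) (d : ℕ) (x : Cube n) (k : ℕ) (lab : Lab n) (s : ℕ) : Prop where
  valid : ValidLab s lab
  classes : ∀ j < s, ∃ τ ∈ T.vars, ∀ i ∈ T.vars, lab i = 4 * 2 ^ j ↔ i = τ
  fixed : ∀ i ∈ T.vars, lab i < 2 → (lab i : ZMod 2) = toVec x i
  nonzero : s = 0 ∨ ∃ y, classSum T.eval lab s 2 y = 1
  le : s ≤ d
  -- Each variable of the path that is not yet fixed pays for a round of at most d additions and one
  -- reading. The current round has d - s additions left, and one step is kept for the final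
  -- comparison.
  budget : ((T.path x).filter fun i => 2 ≤ lab i).card * (d + 1) + (d - s) + 1 ≤ k
  -- Every step labels at most one further variable of the tree, so the labellings stay among those
  -- that `GoodTab` covers.
  sparse : (T.vars.filter fun i => lab i ≠ 2).card + k ≤ (d + 1) ^ 2

end Tree

/-! ### Correctness of the scan and of the binary search. -/

section Search

variable {n : ℕ} {f : BoolFun n} {lab : Lab n} {s : ℕ}

theorem scanIdx_eq_zero {tab : ℕ → Vec n} {m : ℕ} (h : scanIdx f lab s tab m = 0) :
    ∀ j < m, classSum f lab s 2 (tab j) = classSum f lab s 2 (tab 0) := by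
  induction m with
  | zero => simp
  | succ m ih =>
    rw [scanIdx] at h
    intro j hj
    split_ifs at h with h1
    · rcases Nat.lt_succ_iff_lt_or_eq.1 hj with hj | rfl
      · exact ih h j hj
      · exact h1
    · subst h
      obtain rfl : j = 0 := by omega
      rfl

theorem scanIdx_ne_zero {tab : ℕ → Vec n} {m : ℕ} (h : scanIdx f lab s tab m ≠ 0) :
    classSum f lab s 2 (tab (scanIdx f lab s tab m)) ≠ classSum f lab s 2 (tab 0) := by
  induction m with
  | zero => simp [scanIdx] at h
  | succ m ih =>
    rw [scanIdx] at h ⊢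
    split_ifs at h ⊢ with h1
    · exact ih h
    · exact h1

/-- The invariant of binary search: the hybrid at the lower end still has the value at Q, the hybrid
at the upper end has not. The number of blocks is a power of two, so the width halves exactly and
reaches 1 after `ell` rounds. -/
theorem searchBlock_spec {h : Fin n → ℕ} {P Q : Vec n} {ell : ℕ} (hh : ∀ i, h i < 2 ^ ell)
    (hPQ : classSum f lab s 2 P ≠ classSum f lab s 2 Q) {k : ℕ} (hk : k ≤ ell) :
    classSum f lab s 2 (hybrid h (searchBlock f lab s h P Q (2 ^ ell) k) P Q) =
      classSum f lab s 2 Q ∧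
    classSum f lab s 2 (hybrid h (searchBlock f lab s h P Q (2 ^ ell) k + 2 ^ ell / 2 ^ k) P Q) ≠
      classSum f lab s 2 Q := by
  induction k with
  | zero =>
    have h1 : hybrid h 0 P Q = Q := funext fun i => by simp [hybrid]
    have h2 : hybrid h (2 ^ ell) P Q = P := funext fun i => by simp [hybrid, hh i]
    simp [searchBlock, h1, h2, hPQ]
  | succ k ih =>
    obtain ⟨h1, h2⟩ := ih (by omega)
    have h3 : 2 ^ ell / 2 ^ k = 2 ^ ell / 2 ^ (k + 1) + 2 ^ ell / 2 ^ (k + 1) := by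
      rw [Nat.pow_div (by omega) (by norm_num), Nat.pow_div hk (by norm_num), ← two_mul,
        ← pow_succ']
      congr 1
      omega
    rw [searchBlock]
    split_ifs with hc
    · refine ⟨hc, ?_⟩
      rwa [add_assoc, ← h3]
    · exact ⟨h1, hc⟩

end Search

/-! ### Completeness: adding a class. -/

section Complete

variable {n : ℕ} {T : DecisionTree n} {d k s : ℕ} {x : Cube n} {lab : Lab n} {h : Fin n → ℕ}
  {tab : ℕ → Vec n}

theorem loopP_support_lt {β : Type} {ν : ℕ → β → PMF β} {I : ℕ → β → Prop} {N : ℕ}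
    (h : ∀ k < N, ∀ x, I k x → ∀ y ∈ (ν k x).support, I (k + 1) y) {m k : ℕ} (hk : k + m = N)
    {x : β} (hx : I k x) : ∀ y ∈ (loopP ν k m x).support, I N y := by
  induction m generalizing k x with
  | zero =>
    intro y hy
    rw [loopP, PMF.mem_support_pure_iff] at hy
    obtain rfl : k = N := by omega
    rwa [hy]
  | succ m ih =>
    intro y hy
    rw [loopP, PMF.mem_support_bind_iff] at hy
    obtain ⟨z, hz, hy⟩ := hy
    exact ih (by omega) (h k (by omega) x hx z hz) y hy

theorem pow_ne_of_lt {i j : ℕ} (h : i < j) : 4 * 2 ^ i ≠ 4 * 2 ^ j := by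
  have := Nat.pow_lt_pow_right (a := 2) (by norm_num) h
  omega

theorem pow_ne_two (j : ℕ) : 4 * 2 ^ j ≠ 2 := by
  have : 1 ≤ 2 ^ j := Nat.one_le_two_pow
  omega

theorem ne_add_eq_one {a b : ZMod 2} (h : a ≠ b) : a + b = 1 := by revert a b; decide

/-- The new class contains v as its only variable of the tree, so summing over its bit is a
derivative in the direction of v. -/
theorem classSum_addClass (T : DecisionTree n) {lab' : Lab n} {v : Fin n} (hv : lab v = 2)
    (hvalid : ValidLab s lab) (hvalid' : ValidLab (s + 1) lab')
    (hlab : ∀ i ∈ T.vars, lab' i = if i = v then 4 * 2 ^ s else lab i) (y : Vec n) :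
    classSum T.eval lab' (s + 1) 2 y = classSum T.eval lab s 2 (Function.update y v 0) +
      classSum T.eval lab s 2 (Function.update y v 1) := by
  rw [classSum_two, classSum_two, classSum_two, pow_succ, mul_two, Finset.sum_range_add]
  have key : ∀ a < 2 ^ s, ∀ i ∈ T.vars,
      pointOf lab' 2 (4 * a + 1) y i = pointOf lab 2 (4 * a + 1) (Function.update y v 0) i := by
    intro a ha i hi
    rw [pointOf, pointOf, hlab i hi]
    by_cases hiv : i = v
    · subst hiv
      rw [if_pos rfl, if_neg (by simp [pow_ne_two]), div_class, Nat.div_eq_of_lt ha]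
      simp [hv]
    · simp [hiv]
  congr 1
  · refine Finset.sum_congr rfl fun a ha => fZ_of_vars T (key a (Finset.mem_range.1 ha))
  · refine Finset.sum_congr rfl fun a ha => fZ_of_vars T fun i hi => ?_
    have ha := Finset.mem_range.1 ha
    rw [pointOf_top hvalid' ha, Pi.add_apply, key a ha i hi, classInd, hlab i hi]
    by_cases hiv : i = v
    · subst hiv
      simp [pointOf, hv]
    · rw [if_neg hiv, if_neg]
      · simp [pointOf, hiv]
      · intro h1
        rcases hvalid i with h2 | h2 | h2 | ⟨j, hj, h2⟩
        · have := pow_pos (show 0 < 2 by norm_num) s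
          omega
        · omega
        · exact pow_ne_two s (h1.symm.trans h2)
        · exact pow_ne_of_lt hj (h2.symm.trans h1)

/-- The hybrids for t and t + 1 differ only in the block t, and by injectivity of the hash this
block contains only one variable of the tree. The class sum changes when this variable is flipped,
so the new class sum, being the derivative in its direction, takes the value 1 at the hybrid. This
establishes `nonzero`. -/
theorem WalkInv.addClass (hI : WalkInv T d x (k + 1) lab s) (hh : ∀ i, h i < 2 ^ blockBits d)
    (hinj : Set.InjOn h T.vars) {P Q : Vec n} (hs : s < d)
    (hPQ : classSum T.eval lab s 2 P ≠ classSum T.eval lab s 2 Q) :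
    WalkInv T d x k (DTTest.addClass lab h (searchBlock T.eval lab s h P Q (numBlocks d)
      (blockBits d)) s) (s + 1) := by
  obtain ⟨h1, h2⟩ := searchBlock_spec hh hPQ (le_refl (blockBits d))
  rw [Nat.div_self (by positivity)] at h2
  change classSum T.eval lab s 2 (hybrid h (searchBlock T.eval lab s h P Q (numBlocks d)
      (blockBits d)) P Q) = _ at h1
  change classSum T.eval lab s 2 (hybrid h (searchBlock T.eval lab s h P Q (numBlocks d)
      (blockBits d) + 1) P Q) ≠ _ at h2
  generalize searchBlock T.eval lab s h P Q (numBlocks d) (blockBits d) = t at *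
  rw [← h1] at h2
  have hother : ∀ i, h i ≠ t → hybrid h (t + 1) P Q i = hybrid h t P Q i := by
    intro i hi
    simp only [hybrid]
    by_cases hlt : h i < t
    · rw [if_pos hlt, if_pos (by omega)]
    · rw [if_neg hlt, if_neg (by omega)]
  -- A change of the class sum needs a free variable of the tree at which the two hybrids differ,
  -- and such a variable lies in the block t.
  obtain ⟨v, hvT, hv2, hvt, hvne⟩ : ∃ v ∈ T.vars, lab v = 2 ∧ h v = t ∧
      hybrid h (t + 1) P Q v ≠ hybrid h t P Q v := by
    by_contra! hcon
    refine h2 (classSum_congr T (fun _ _ => rfl) fun i hi hl => ?_)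
    by_cases hit : h i = t
    · exact hcon i hi (by simpa using hl) hit
    · exact hother i hit
  have hlab : ∀ i ∈ T.vars, DTTest.addClass lab h t s i = if i = v then 4 * 2 ^ s else lab i := by
    intro i hi
    rw [DTTest.addClass]
    by_cases hiv : i = v
    · simp [hiv, hvt]
    · rw [if_neg hiv, if_neg]
      exact fun hit => hiv (hinj hi hvT (hit.trans hvt.symm))
  have hvalid : ValidLab (s + 1) (DTTest.addClass lab h t s) := by
    intro i
    rw [DTTest.addClass]
    split_ifs
    · exact Or.inr (Or.inr (Or.inr ⟨s, by omega, rfl⟩))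
    · rcases hI.valid i with h3 | h3 | h3 | ⟨j, hj, h3⟩
      · exact Or.inl h3
      · exact Or.inr (Or.inl h3)
      · exact Or.inr (Or.inr (Or.inl h3))
      · exact Or.inr (Or.inr (Or.inr ⟨j, by omega, h3⟩))
  have hpos : 1 ≤ 2 ^ s := Nat.one_le_two_pow
  refine ⟨hvalid, ?_, ?_, Or.inr ⟨hybrid h t P Q, ?_⟩, hs, ?_, ?_⟩
  · intro j hj
    by_cases hjs : j = s
    · subst hjs
      refine ⟨v, hvT, fun i hi => ?_⟩
      rw [hlab i hi]
      by_cases hiv : i = v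
      · simp [hiv]
      · rw [if_neg hiv]
        refine ⟨fun h3 => ?_, fun h3 => absurd h3 hiv⟩
        rcases hI.valid i with h4 | h4 | h4 | ⟨l, hl, h4⟩
        · omega
        · omega
        · exact absurd (h3.symm.trans h4) (pow_ne_two _)
        · exact absurd (h4.symm.trans h3) (pow_ne_of_lt hl)
    · obtain ⟨τ, hτ, hτi⟩ := hI.classes j (by omega)
      refine ⟨τ, hτ, fun i hi => ?_⟩
      rw [hlab i hi]
      by_cases hiv : i = v
      · rw [if_pos hiv]
        have hτv : τ ≠ v := by
          rintro rfl
          have := (hτi τ hτ).2 rfl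
          exact pow_ne_two j (this.symm.trans hv2)
        refine ⟨fun h3 => absurd h3.symm (pow_ne_of_lt (by omega)), fun h3 => ?_⟩
        exact absurd (h3.symm.trans hiv) hτv
      · rw [if_neg hiv]
        exact hτi i hi
  · intro i hi
    rw [hlab i hi]
    split_ifs with hiv
    · intro h3
      omega
    · exact hI.fixed i hi
  · rw [classSum_addClass T hv2 hI.valid hvalid hlab]
    have e1 : classSum T.eval lab s 2 (hybrid h t P Q) =
        classSum T.eval lab s 2 (Function.update (hybrid h t P Q) v (hybrid h t P Q v)) := by
      rw [Function.update_eq_self]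
    have e2 : classSum T.eval lab s 2 (hybrid h (t + 1) P Q) =
        classSum T.eval lab s 2 (Function.update (hybrid h t P Q) v (hybrid h (t + 1) P Q v)) := by
      refine classSum_congr T (fun _ _ => rfl) fun i hi _ => ?_
      by_cases hiv : i = v
      · simp [hiv]
      · rw [Function.update_of_ne hiv]
        exact hother i fun hit => hiv (hinj hi hvT (hit.trans hvt.symm))
    rw [e1, e2] at h2
    generalize hybrid h (t + 1) P Q v = a at hvne h2
    generalize hybrid h t P Q v = b at hvne h2
    have hab : ∀ a b : ZMod 2, a ≠ b → (a = 0 ∧ b = 1) ∨ (a = 1 ∧ b = 0) := by decide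
    rcases hab a b hvne with ⟨rfl, rfl⟩ | ⟨rfl, rfl⟩
    · exact ne_add_eq_one h2
    · rw [add_comm]
      exact ne_add_eq_one h2
  · have h3 : ((T.path x).filter fun i => 2 ≤ DTTest.addClass lab h t s i) =
        (T.path x).filter fun i => 2 ≤ lab i := by
      refine Finset.filter_congr fun i hi => ?_
      rw [hlab i (path_subset T x hi)]
      split_ifs with hiv
      · rw [hiv, hv2]
        omega
      · rfl
    rw [h3]
    have := hI.budget
    omega
  · have h3 : (T.vars.filter fun i => DTTest.addClass lab h t s i ≠ 2) ⊆
        insert v (T.vars.filter fun i => lab i ≠ 2) := by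
      intro i hi
      obtain ⟨hi1, hi2⟩ := Finset.mem_filter.1 hi
      rw [hlab i hi1] at hi2
      by_cases hiv : i = v
      · exact Finset.mem_insert.2 (Or.inl hiv)
      · rw [if_neg hiv] at hi2
        exact Finset.mem_insert_of_mem (Finset.mem_filter.2 ⟨hi1, hi2⟩)
    have h4 := (Finset.card_le_card h3).trans (Finset.card_insert_le _ _)
    have := hI.sparse
    omega

end Complete

/-! ### Completeness: reading the classes and the whole walk. -/

section Reading

variable {n : ℕ} {T : DecisionTree n} {d k s : ℕ} {x : Cube n} {lab : Lab n} {h : Fin n → ℕ}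
  {tab : ℕ → Vec n}

theorem cast_div_pow (a i : ℕ) : ((a / 2 ^ i : ℕ) : ZMod 2) = if a.testBit i then 1 else 0 := by
  rw [Nat.testBit_eq_decide_div_mod_eq]
  rcases Nat.mod_two_eq_zero_or_one (a / 2 ^ i) with h | h
  · simp only [h]
    rw [if_neg (by simp), ZMod.natCast_eq_zero_iff]
    omega
  · simp only [h]
    rw [if_pos (by simp), ← Nat.cast_one, ZMod.natCast_eq_natCast_iff]
    exact h

/-- The values of the classes are paired by flipping the bit j with an exclusive or: the half with
bit 0 is the class function at 0, the other half the class function at 1. So if the whole sum is 1,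
the class function distinguishes 0 and 1. -/
theorem classSum_split (f : BoolFun n) (hvalid : ValidLab s lab) {j : ℕ} (hj : j < s) :
    classFun f lab s (4 * 2 ^ j) 0 + classFun f lab s (4 * 2 ^ j) 1 = classSum f lab s 2 0 := by
  set l := 4 * 2 ^ j with hl
  have hl2 : l ≠ 2 := pow_ne_two j
  have hcond : ∀ a, (4 * a + 1) / l % 2 = 0 ↔ a.testBit j = false := by
    intro a
    rw [hl, div_class, Nat.testBit_eq_decide_div_mod_eq]
    simp
  have h0 : ∀ a, a.testBit j = false →
      pointOf lab l (4 * a + 1) (mask lab l 0) = pointOf lab 2 (4 * a + 1) 0 := by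
    intro a ha
    funext i
    rw [pointOf, pointOf]
    by_cases hi : lab i = l
    · rw [if_pos (Or.inr hi), if_neg (by simp [hi, hl2]), hi, hl, div_class, cast_div_pow, ha]
      simp [mask]
    · simp [hi, mask]
  have h1 : ∀ a, a.testBit j = false →
      pointOf lab l (4 * a + 1) (mask lab l 1) = pointOf lab 2 (4 * (a ^^^ 2 ^ j) + 1) 0 := by
    intro a ha
    funext i
    rw [pointOf, pointOf]
    rcases hvalid i with h | h | h | ⟨m, -, h⟩
    · have hl0 : 0 ≠ l := by
        have := pow_pos (show 0 < 2 by norm_num) j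
        omega
      rw [h, if_neg (by simp [hl0]), if_neg (by norm_num), Nat.div_zero, Nat.div_zero]
    · have h4 : (4 : ZMod 2) = 0 := rfl
      have hl1 : 1 ≠ l := by omega
      rw [h, if_neg (by simp [hl1]), if_neg (by norm_num)]
      simp [h4]
    · simp [h, mask, Ne.symm hl2]
    · rw [h, if_neg (c := 4 * 2 ^ m = 2 ∨ 4 * 2 ^ m = 2) (by simp [pow_ne_two]), div_class, div_class,
        cast_div_pow, cast_div_pow, Nat.testBit_xor, Nat.testBit_two_pow]
      by_cases hm : m = j
      · subst hm
        rw [if_pos (Or.inr rfl), mask, h, if_pos rfl, ha]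
        simp
      · have : 4 * 2 ^ m ≠ l := by
          rcases Nat.lt_or_gt_of_ne hm with h' | h'
          · exact pow_ne_of_lt h'
          · exact (pow_ne_of_lt h').symm
        rw [if_neg (by simp [this, pow_ne_two])]
        simp [Ne.symm hm]
  rw [classFun, classFun, classSum_two, classSum, classSum]
  simp only [hcond]
  have e0 : ∀ a ∈ Finset.range (2 ^ s), (if a.testBit j = false then
      fZ f (pointOf lab l (4 * a + 1) (mask lab l 0)) else 0) =
      if a.testBit j = false then fZ f (pointOf lab 2 (4 * a + 1) 0) else 0 := by
    intro a _
    split_ifs with ha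
    · rw [h0 a ha]
    · rfl
  have e1 : ∀ a ∈ Finset.range (2 ^ s), (if a.testBit j = false then
      fZ f (pointOf lab l (4 * a + 1) (mask lab l 1)) else 0) =
      if a.testBit j = false then fZ f (pointOf lab 2 (4 * (a ^^^ 2 ^ j) + 1) 0) else 0 := by
    intro a _
    split_ifs with ha
    · rw [h1 a ha]
    · rfl
  rw [Finset.sum_congr rfl e0, Finset.sum_congr rfl e1]
  have e2 : (∑ a ∈ Finset.range (2 ^ s), if a.testBit j = false then
      fZ f (pointOf lab 2 (4 * (a ^^^ 2 ^ j) + 1) 0) else 0) =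
      ∑ a ∈ Finset.range (2 ^ s), if a.testBit j = false then 0 else
        fZ f (pointOf lab 2 (4 * a + 1) 0) := by
    have hp : 2 ^ j < 2 ^ s := Nat.pow_lt_pow_right (by norm_num) hj
    have hx : ∀ a, a ^^^ 2 ^ j ^^^ 2 ^ j = a := fun a => by
      rw [Nat.xor_assoc, Nat.xor_self, Nat.xor_zero]
    refine Finset.sum_nbij' (fun a => a ^^^ 2 ^ j) (fun a => a ^^^ 2 ^ j) ?_ ?_ ?_ ?_ ?_
    · intro a ha
      exact Finset.mem_range.2 (Nat.xor_lt_two_pow (Finset.mem_range.1 ha) hp)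
    · intro a ha
      exact Finset.mem_range.2 (Nat.xor_lt_two_pow (Finset.mem_range.1 ha) hp)
    · exact fun a _ => hx a
    · exact fun a _ => hx a
    · intro a _
      have : (a ^^^ 2 ^ j).testBit j = !a.testBit j := by
        rw [Nat.testBit_xor, Nat.testBit_two_pow]
        simp
      simp only [this]
      cases a.testBit j <;> simp
  rw [e2, ← Finset.sum_add_distrib]
  refine Finset.sum_congr rfl fun a _ => ?_
  split_ifs <;> simp

theorem literalTest_of_literal {φ : Vec n → ZMod 2} {τ : Fin n} (hφ : ∀ u, φ u = u τ + φ 0)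
    (x u v z : Vec n) : LiteralTest φ x u v z ∧ φ x + φ 0 = x τ := by
  have hc : ∀ a b : ZMod 2, a + b + b = a := by decide
  refine ⟨⟨?_, ?_, ?_, ?_⟩, ?_⟩
  · rw [hφ u, hφ v, hφ (u + v), Pi.add_apply]
    generalize u τ = a
    generalize v τ = b
    generalize φ 0 = c
    revert a b c
    decide
  · rw [hφ u, hφ v, hφ z, hφ (z + u * v), Pi.add_apply, Pi.mul_apply]
    generalize u τ = a
    generalize v τ = b
    generalize z τ = c
    generalize φ 0 = e
    revert a b c e
    decide
  · rw [hφ z, hφ (z + 1), Pi.add_apply, Pi.one_apply]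
    generalize z τ = c
    generalize φ 0 = e
    revert c e
    decide
  · rw [hφ z, hφ (z + x), hφ x, Pi.add_apply]
    generalize z τ = c
    generalize x τ = a
    generalize φ 0 = e
    revert a c e
    decide
  · rw [hφ x, hc]

/-- Among the variables of the class only τ occurs in the tree, so the class function depends on the
coordinate τ alone, and by `classSum_split` it is not constant. -/
theorem WalkInv.classFun_eq (hI : WalkInv T d x k lab s)
    (hone : ∀ y, classSum T.eval lab s 2 y = 1) {j : ℕ} (hj : j < s) {τ : Fin n}
    (hτ : ∀ i ∈ T.vars, lab i = 4 * 2 ^ j ↔ i = τ) (u : Vec n) :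
    classFun T.eval lab s (4 * 2 ^ j) u = u τ + classFun T.eval lab s (4 * 2 ^ j) 0 := by
  have hcongr : ∀ u u' : Vec n, u τ = u' τ →
      classFun T.eval lab s (4 * 2 ^ j) u = classFun T.eval lab s (4 * 2 ^ j) u' := by
    intro u u' huu
    refine classSum_congr T (fun _ _ => rfl) fun i hi _ => ?_
    rw [mask, mask]
    split_ifs with hl
    · rw [(hτ i hi).1 hl, huu]
    · rfl
  have hs := classSum_split T.eval hI.valid hj
  rw [hone] at hs
  have hc : ∀ a : ZMod 2, a = 0 ∨ a = 1 := by decide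
  rcases hc (u τ) with h0 | h1
  · rw [hcongr u 0 (by simpa using h0), h0, zero_add]
  · rw [hcongr u 1 (by simpa using h1), h1, ← hs]
    generalize classFun T.eval lab s (4 * 2 ^ j) 0 = a
    generalize classFun T.eval lab s (4 * 2 ^ j) 1 = b
    revert a b
    decide

theorem read_complete (hI : WalkInv T d x k lab s) (hone : ∀ y, classSum T.eval lab s 2 y = 1) :
    ∀ q ∈ (loopP (readStep T.eval lab s (toVec x)) 0 s (true, 1)).support,
      q.1 = true ∧ ∃ B, q.2 = 4 * B + 1 ∧ ∀ i < s, ∀ v ∈ T.vars, lab v = 4 * 2 ^ i →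
        ((B / 2 ^ i : ℕ) : ZMod 2) = toVec x v := by
  intro q hq
  have := loopP_support_lt (ν := readStep T.eval lab s (toVec x)) (N := s)
    (I := fun j q => q.1 = true ∧ ∃ B < 2 ^ j, q.2 = 4 * B + 1 ∧ ∀ i < j, ∀ v ∈ T.vars,
      lab v = 4 * 2 ^ i → ((B / 2 ^ i : ℕ) : ZMod 2) = toVec x v) ?_ (zero_add s)
      (x := (true, 1)) ⟨rfl, 0, by simp⟩ q hq
  · obtain ⟨h1, B, -, h2, h3⟩ := this
    exact ⟨h1, B, h2, h3⟩
  · rintro j hj ⟨acc, A⟩ ⟨rfl, B, hB, rfl, hb⟩ q hq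
    rw [readStep, PMF.mem_support_map_iff] at hq
    obtain ⟨g, -, rfl⟩ := hq
    obtain ⟨τ, hτT, hτ⟩ := hI.classes j hj
    obtain ⟨h1, h2⟩ := literalTest_of_literal (hI.classFun_eq hone hj hτ) (toVec x)
      (fun i => (g i).1) (fun i => (g i).2.1) fun i => (g i).2.2
    refine ⟨by simpa using h1, B + 2 ^ j * (toVec x τ).val, ?_, ?_, ?_⟩
    · have : (toVec x τ).val < 2 := ZMod.val_lt _
      rw [pow_succ]
      nlinarith [pow_pos (show 0 < 2 by norm_num) j]
    · simp only [h2]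
      ring
    · intro i hi v hv hlv
      by_cases hij : i = j
      · subst hij
        rw [(hτ v hv).1 hlv, Nat.add_mul_div_left _ _ (by positivity), Nat.div_eq_of_lt hB]
        simp
      · have hlt : i < j := by omega
        rw [← hb i hlt v hv hlv]
        have hc : ∀ a : ZMod 2, a.val = 0 ∨ a.val = 1 := by decide
        rcases hc (toVec x τ) with h0 | h0
        · rw [h0, mul_zero, add_zero]
        · rw [h0, mul_one, add_comm, cast_two_pow_add_div hlt]

/-- If no class met the path of x, every one of the 2^s points derived from x would agree with x on
the path and have the same value of f. For s > 0 these values add up to 0, not to 1. -/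
theorem WalkInv.exists_path (hI : WalkInv T d x k lab s)
    (hone : ∀ y, classSum T.eval lab s 2 y = 1) (hs : s ≠ 0) : ∃ i ∈ T.path x, 2 < lab i := by
  by_contra! hcon
  have h1 := hone (toVec x)
  rw [classSum_two] at h1
  have h2 : ∀ a ∈ Finset.range (2 ^ s), fZ T.eval (pointOf lab 2 (4 * a + 1) (toVec x)) =
      fZ T.eval (toVec x) := by
    intro a _
    refine fZ_of_path T fun i hi => ?_
    have hfix := hI.fixed i (path_subset T x hi)
    have hle := hcon i hi
    rw [pointOf]
    rcases hI.valid i with h | h | h | ⟨j, -, h⟩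
    · rw [if_neg (by simp [h]), ← hfix (by omega), h]
      simp
    · have h4 : (4 : ZMod 2) = 0 := rfl
      rw [if_neg (by simp [h]), ← hfix (by omega), h]
      simp [h4]
    · rw [if_pos (Or.inl h)]
    · have := pow_pos (show 0 < 2 by norm_num) j
      omega
  rw [Finset.sum_congr rfl h2, Finset.sum_const, Finset.card_range, nsmul_eq_mul] at h1
  have h3 : ((2 ^ s : ℕ) : ZMod 2) = 0 := by
    push_cast
    rw [show (2 : ZMod 2) = 0 from rfl, zero_pow hs]
  rw [h3, zero_mul] at h1
  exact zero_ne_one h1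

/-- The bits read are the values of x at the class variables of the tree, and old bits are
reproduced by the division. By `exists_path` at least one variable of the path is newly fixed, which
pays for the next round. -/
theorem WalkInv.collapse (hI : WalkInv T d x (k + 1) lab s)
    (hone : ∀ y, classSum T.eval lab s 2 y = 1) (hs : s ≠ 0) {B : ℕ}
    (hB : ∀ i < s, ∀ v ∈ T.vars, lab v = 4 * 2 ^ i → ((B / 2 ^ i : ℕ) : ZMod 2) = toVec x v) :
    WalkInv T d x k (DTTest.collapse lab (4 * B + 1)) 0 := by
  have hlt : ∀ i, lab i ≠ 2 → DTTest.collapse lab (4 * B + 1) i < 2 := by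
    intro i hi
    rw [DTTest.collapse, if_neg hi]
    exact Nat.mod_lt _ (by norm_num)
  have h2 : ∀ i, lab i = 2 → DTTest.collapse lab (4 * B + 1) i = 2 := by
    intro i hi
    rw [DTTest.collapse, if_pos hi]
  refine ⟨?_, by simp, ?_, Or.inl rfl, Nat.zero_le _, ?_, ?_⟩
  · intro i
    by_cases hi : lab i = 2
    · exact Or.inr (Or.inr (Or.inl (h2 i hi)))
    · have := hlt i hi
      omega
  · intro i hi hl
    have hi2 : lab i ≠ 2 := fun h => by rw [h2 i h] at hl; omega
    rw [DTTest.collapse, if_neg hi2, ZMod.natCast_mod]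
    rcases hI.valid i with h | h | h | ⟨j, hj, h⟩
    · rw [← hI.fixed i hi (by omega), h]
      simp
    · have h4 : (4 : ZMod 2) = 0 := rfl
      rw [← hI.fixed i hi (by omega), h]
      simp [h4]
    · exact absurd h hi2
    · rw [h, div_class]
      exact hB j hj i hi h
  · obtain ⟨i₀, hi₀, hi₀l⟩ := hI.exists_path hone hs
    have h3 : ((T.path x).filter fun i => 2 ≤ DTTest.collapse lab (4 * B + 1) i) ⊂
        (T.path x).filter fun i => 2 ≤ lab i := by
      refine Finset.ssubset_iff_subset_ne.2 ⟨fun i hi => ?_, fun heq => ?_⟩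
      · obtain ⟨hi1, hi2⟩ := Finset.mem_filter.1 hi
        refine Finset.mem_filter.2 ⟨hi1, ?_⟩
        by_contra hcon
        have := hlt i (by omega)
        omega
      · have h4 : i₀ ∈ (T.path x).filter fun i => 2 ≤ lab i :=
          Finset.mem_filter.2 ⟨hi₀, hi₀l.le⟩
        rw [← heq] at h4
        have h5 := (Finset.mem_filter.1 h4).2
        have := hlt i₀ (by omega)
        omega
    have h4 := Finset.card_lt_card h3
    have := hI.budget
    rw [Nat.sub_zero]
    nlinarith
  · have h3 : (T.vars.filter fun i => DTTest.collapse lab (4 * B + 1) i ≠ 2) =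
        T.vars.filter fun i => lab i ≠ 2 := by
      refine Finset.filter_congr fun i _ => ?_
      by_cases hi : lab i = 2
      · simp [h2 i hi, hi]
      · have := hlt i hi
        simp only [hi, not_false_iff, ne_eq, iff_true]
        omega
    rw [h3]
    have := hI.sparse
    omega

theorem walk_complete (hT : T.depth ≤ d) (hh : ∀ i, h i < 2 ^ blockBits d)
    (hinj : Set.InjOn h T.vars) (htab : GoodTab T d tab) (k k₀ : ℕ) (lab : Lab n) (s : ℕ)
    (hI : WalkInv T d x k lab s) :
    ∀ q ∈ (loopP (fun _ => walkStep T.eval d h tab (toVec x)) k₀ k (true, some (lab, s))).support,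
      q = (true, none) := by
  induction k generalizing k₀ lab s with
  | zero => exact absurd hI.budget (by omega)
  | succ k ih =>
    intro q hq
    rw [loopP, walkStep] at hq
    have hsparse : (T.vars.filter fun i => lab i ≠ 2).card ≤ (d + 1) ^ 2 := by
      have := hI.sparse
      omega
    split_ifs at hq with h1 h2 h3 h4
    · subst h2
      -- Without classes the sum is f with some variables fixed. By the table it is constant in the
      -- free variables, and at x it equals f(x), because the variables of the tree are fixed to the
      -- bits of x.
      have hconst := htab lab 0 hI.le hI.valid hsparse (scanIdx_eq_zero h1) (toVec x)
      have hx : classSum T.eval lab 0 2 (toVec x) = fZ T.eval (toVec x) := by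
        rw [classSum_two]
        simp only [pow_zero, Finset.range_one, Finset.sum_singleton]
        refine fZ_of_vars T fun i hi => ?_
        have hfix := hI.fixed i hi
        rw [pointOf]
        rcases hI.valid i with h | h | h | ⟨j, hj, -⟩
        · rw [if_neg (by simp [h]), ← hfix (by omega), h]
        · rw [if_neg (by simp [h]), ← hfix (by omega), h]
        · rw [if_pos (Or.inl h)]
        · omega
      rw [← hconst, hx, PMF.pure_bind, walk_none, PMF.mem_support_pure_iff] at hq
      simpa using hq
    · have hconst := htab lab s hI.le hI.valid hsparse (scanIdx_eq_zero h1)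
      rcases hI.nonzero with h0 | ⟨y, hy⟩
      · exact absurd h0 h2
      · rw [hconst y, h3] at hy
        exact absurd hy zero_ne_one
    · have hconst := htab lab s hI.le hI.valid hsparse (scanIdx_eq_zero h1)
      have hone : ∀ y, classSum T.eval lab s 2 y = 1 := by
        intro y
        rw [hconst y]
        have : ∀ a : ZMod 2, a ≠ 0 → a = 1 := by decide
        exact this _ h3
      rw [PMF.bind_map, PMF.mem_support_bind_iff] at hq
      obtain ⟨⟨acc, A⟩, hr, hq⟩ := hq
      obtain ⟨rfl, B, rfl, hB⟩ := read_complete hI hone _ hr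
      exact ih _ _ _ (hI.collapse hone h2 hB) q hq
    · rw [PMF.pure_bind] at hq
      exact ih _ _ _ (hI.addClass hh hinj h4 (scanIdx_ne_zero h1)) q hq
    -- With d classes the sum has degree 0, so two rows cannot differ.
    · exfalso
      obtain rfl : s = d := by have := hI.le; omega
      have hdeg := polyDeg_sum hI.valid ((polyDeg_tree T).mono hT) le_rfl
      rw [Nat.sub_self] at hdeg
      refine scanIdx_ne_zero h1 ?_
      have h5 := hdeg (tab (scanIdx T.eval lab s tab (2 ^ s / 2 ^ s * rowFactor s)) + tab 0) (tab 0)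
      rw [add_comm (tab (scanIdx T.eval lab s tab (2 ^ s / 2 ^ s * rowFactor s))), ← add_assoc,
        vadd_self, zero_add] at h5
      rw [classSum_two, classSum_two]
      have : ∀ a b : ZMod 2, a + b = 0 → b = a := by decide
      exact this _ _ h5

/-- A path has at most d variables, and d(d+1) + d + 1 = (d+1)^2; this is where the number of steps
comes from. -/
theorem walkInv_start (hT : T.depth ≤ d) (x : Cube n) :
    WalkInv T d x ((d + 1) ^ 2) (fun _ => 2) 0 := by
  refine ⟨fun _ => by simp, by simp, fun i _ h => absurd h (by norm_num), Or.inl rfl,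
    Nat.zero_le _, ?_, by simp⟩
  have h1 : ((T.path x).filter fun _ => 2 ≤ 2).card ≤ d :=
    (Finset.card_filter_le _ _).trans ((card_path_le T x).trans hT)
  have h2 : ((T.path x).filter fun _ => 2 ≤ 2).card * (d + 1) ≤ d * (d + 1) :=
    Nat.mul_le_mul_right _ h1
  rw [Nat.sub_zero]
  nlinarith

theorem sampleStep_complete (hT : T.depth ≤ d) (hh : ∀ i, h i < 2 ^ blockBits d)
    (hinj : Set.InjOn h T.vars) (htab : GoodTab T d tab) (D : PMF (Cube n)) :
    ∀ b ∈ (sampleStep T.eval D d h tab true).support, b = true := by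
  intro b hb
  rw [sampleStep, PMF.mem_support_bind_iff] at hb
  obtain ⟨x, -, hb⟩ := hb
  rw [PMF.mem_support_map_iff] at hb
  obtain ⟨q, hq, rfl⟩ := hb
  rw [walk_complete hT hh hinj htab _ _ _ _ (walkInv_start hT x) q hq]
  rfl

end Reading

/-! ### The block numbers and the table are good with high probability -/

section Counting

theorem expect_add {α : Type} {μ : PMF α} (F G : α → ENNReal) :
    expect μ (fun a => F a + G a) = expect μ F + expect μ G := by
  unfold expect
  rw [← ENNReal.tsum_add]
  simp_rw [mul_add]

theorem expect_uniform_le {α : Type} [Fintype α] [Nonempty α] {P : α → Prop} [DecidablePred P]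
    {k : ℕ} (h : k * (Finset.univ.filter P).card ≤ Fintype.card α) :
    expect (PMF.uniformOfFintype α) (fun a => if P a then 1 else 0) ≤ 1 / k := by
  rw [expect_uniform, Finset.sum_boole]
  have hα : 0 < Fintype.card α := Fintype.card_pos
  refine ENNReal.div_le_of_le_mul ?_
  rw [one_div, mul_comm, ← div_eq_mul_inv, ENNReal.le_div_iff_mul_le (by simp) (by simp), mul_comm]
  exact_mod_cast h

theorem digitsVal_inj {N : ℕ} {g g' : Fin N → ZMod 2} {k : ℕ} (hk : k ≤ N)
    (h : digitsVal g k = digitsVal g' k) : ∀ i : Fin N, (i : ℕ) < k → g i = g' i := by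
  induction k with
  | zero => simp
  | succ k ih =>
    rw [digitsVal, digitsVal, dif_pos (by omega), dif_pos (by omega)] at h
    have h1 : (g ⟨k, by omega⟩).val < 2 := ZMod.val_lt _
    have h2 : (g' ⟨k, by omega⟩).val < 2 := ZMod.val_lt _
    intro i hi
    by_cases hik : (i : ℕ) = k
    · have : i = ⟨k, by omega⟩ := Fin.ext hik
      rw [this]
      apply ZMod.val_injective
      omega
    · exact ih (by omega) (by omega) i (by omega)

/-- Overwriting the coordinate i of such a y by an arbitrary element is injective, since the lost
entry can be recovered from the coordinate j. -/
theorem card_eq_mul_le {ι β : Type} [Fintype ι] [Fintype β] [DecidableEq ι] [DecidableEq β]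
    {i j : ι} (hij : i ≠ j) :
    Fintype.card β * (Finset.univ.filter fun y : ι → β => y i = y j).card ≤
      Fintype.card (ι → β) := by
  rw [← Finset.card_univ (α := β), mul_comm, ← Finset.card_product, ← Finset.card_univ]
  refine Finset.card_le_card_of_injOn (fun p => Function.update p.1 i p.2) (fun _ _ => by simp) ?_
  rintro ⟨y, b⟩ hy ⟨y', b'⟩ hy' heq
  simp only [Finset.coe_product, Set.mem_prod, Finset.mem_coe, Finset.mem_filter, Finset.mem_univ,
    true_and, and_true] at hy hy'
  have hb : b = b' := by simpa using congrFun heq i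
  have hne : ∀ k ≠ i, y k = y' k := fun k hk => by simpa [hk] using congrFun heq k
  rw [Prod.mk.injEq]
  refine ⟨funext fun k => ?_, hb⟩
  by_cases hk : k = i
  · rw [hk, hy, hy', hne j hij.symm]
  · exact hne k hk

open Classical in
-- A union bound over at most 4^d ordered pairs, each of which collides with probability
-- 2^(-(2d+4)); the summand 4 in `blockBits` yields the 1/16.
theorem blockOf_injOn {n d : ℕ} {V : Finset (Fin n)} (hV : V.card ≤ 2 ^ d) :
    expect (fillP (fillP coinP (blockBits d)) n)
      (fun hb => if ¬ Set.InjOn (blockOf hb) V then 1 else 0) ≤ 1 / (16 : ℕ) := by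
  rw [coinP_eq, fillP_uniform, fillP_uniform]
  refine expect_uniform_le (α := Fin n → Fin (blockBits d) → ZMod 2)
    (P := fun hb => ¬ Set.InjOn (blockOf hb) V) (k := 16) ?_
  have h1 : (Finset.univ.filter fun hb : Fin n → Fin (blockBits d) → ZMod 2 =>
      ¬ Set.InjOn (blockOf hb) V) ⊆ V.offDiag.biUnion fun p =>
        Finset.univ.filter fun hb : Fin n → Fin (blockBits d) → ZMod 2 => hb p.1 = hb p.2 := by
    intro hb hhb
    have h2 := (Finset.mem_filter.1 hhb).2
    unfold Set.InjOn at h2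
    push Not at h2
    obtain ⟨i, hi, j, hj, hij, hne⟩ := h2
    refine Finset.mem_biUnion.2 ⟨(i, j), Finset.mem_offDiag.2 ⟨hi, hj, hne⟩, ?_⟩
    refine Finset.mem_filter.2 ⟨Finset.mem_univ _, funext fun l => ?_⟩
    exact digitsVal_inj le_rfl hij l l.2
  have h2 := (Finset.card_le_card h1).trans Finset.card_biUnion_le
  have h3 : ∀ p ∈ V.offDiag, 2 ^ blockBits d * (Finset.univ.filter
      fun hb : Fin n → Fin (blockBits d) → ZMod 2 => hb p.1 = hb p.2).card ≤
      Fintype.card (Fin n → Fin (blockBits d) → ZMod 2) := by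
    intro p hp
    have := card_eq_mul_le (β := Fin (blockBits d) → ZMod 2) (Finset.mem_offDiag.1 hp).2.2
    rwa [Fintype.card_fun (α := Fin (blockBits d)), ZMod.card, Fintype.card_fin] at this
  have h4 := Finset.sum_le_sum h3
  rw [← Finset.mul_sum, Finset.sum_const, smul_eq_mul] at h4
  have h5 : V.offDiag.card ≤ 2 ^ d * 2 ^ d := by
    rw [Finset.offDiag_card]
    exact (Nat.sub_le _ _).trans (Nat.mul_le_mul hV hV)
  have h6 : 2 ^ blockBits d = 16 * (2 ^ d * 2 ^ d) := by
    rw [blockBits, pow_add, two_mul, pow_add]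
    ring
  rw [h6] at h4
  generalize Fintype.card (Fin n → Fin (blockBits d) → ZMod 2) = M at *
  have hpos : 0 < 2 ^ d * 2 ^ d := by positivity
  generalize 2 ^ d * 2 ^ d = q at *
  refine Nat.le_of_mul_le_mul_left ?_ hpos
  rw [← mul_assoc, mul_comm q 16]
  exact (Nat.mul_le_mul_left _ h2).trans (h4.trans (Nat.mul_le_mul_right _ h5))

theorem pow_mul_add_le (p k : ℕ) : p ^ k * (p + k) ≤ p * (p + 1) ^ k := by
  induction k with
  | zero => simp
  | succ k ih =>
    calc p ^ (k + 1) * (p + (k + 1)) = p ^ k * (p * (p + k + 1)) := by ring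
      _ ≤ p ^ k * ((p + k) * (p + 1)) := Nat.mul_le_mul_left _ (by nlinarith)
      _ = p ^ k * (p + k) * (p + 1) := by ring
      _ ≤ p * (p + 1) ^ k * (p + 1) := by gcongr
      _ = _ := by ring

/-- The inequality (1 - 1/q)^q ≤ 1/2 without division, from Bernoulli's inequality in the form of
`pow_mul_add_le` with k = p. -/
theorem two_mul_pow_le {q : ℕ} (hq : 0 < q) : 2 * (q - 1) ^ q ≤ q ^ q := by
  obtain ⟨p, rfl⟩ := Nat.exists_eq_add_of_le' hq
  rw [Nat.add_sub_cancel]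
  calc 2 * p ^ (p + 1) = p ^ p * (p + p) := by ring
    _ ≤ p * (p + 1) ^ p := pow_mul_add_le p p
    _ ≤ (p + 1) * (p + 1) ^ p := by gcongr; omega
    _ = _ := by ring

theorem two_pow_mul_le {q K M L : ℕ} (hq : 0 < q) (h : q * K ≤ (q - 1) * M) :
    2 ^ L * K ^ (q * L) ≤ M ^ (q * L) := by
  have h1 : (q * K) ^ (q * L) ≤ ((q - 1) * M) ^ (q * L) := Nat.pow_le_pow_left h _
  have hpos : 0 < q ^ (q * L) := by positivity
  refine Nat.le_of_mul_le_mul_left ?_ hpos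
  calc q ^ (q * L) * (2 ^ L * K ^ (q * L)) = 2 ^ L * (q * K) ^ (q * L) := by rw [mul_pow]; ring
    _ ≤ 2 ^ L * ((q - 1) * M) ^ (q * L) := by gcongr
    _ = (2 * (q - 1) ^ q) ^ L * M ^ (q * L) := by rw [mul_pow, mul_pow, ← pow_mul]; ring
    _ ≤ (q ^ q) ^ L * M ^ (q * L) := by gcongr; exact two_mul_pow_le hq
    _ = _ := by rw [← pow_mul]

/-- If A misses at least a 1/q fraction of the points, then q L independent points all lie in A with
probability at most 2^(-L). -/
theorem card_forall_lt {β : Type} [Fintype β] (A : Finset β) {m R : ℕ} (hm : m ≤ R)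
    {q L : ℕ} (hq : 0 < q) (hmq : m = q * L) (hA : q * A.card ≤ (q - 1) * Fintype.card β) :
    open Classical in
    2 ^ L * (Finset.univ.filter fun y : Fin R → β => ∀ j : Fin R, (j : ℕ) < m → y j ∈ A).card ≤
      Fintype.card (Fin R → β) := by
  classical
  have h1 : (Finset.univ.filter fun y : Fin R → β => ∀ j : Fin R, (j : ℕ) < m → y j ∈ A) =
      Fintype.piFinset fun j : Fin R => if (j : ℕ) < m then A else Finset.univ := by
    ext y
    simp only [Finset.mem_filter, Finset.mem_univ, true_and, Fintype.mem_piFinset]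
    refine forall_congr' fun j => ?_
    split_ifs with h <;> simp [h]
  have hcard : (Finset.univ.filter fun j : Fin R => (j : ℕ) < m).card = m := by
    rw [Fin.card_filter_val_lt]
    omega
  have h2 : ∏ j : Fin R, (if (j : ℕ) < m then A else Finset.univ).card =
      A.card ^ m * Fintype.card β ^ (R - m) := by
    have : ∀ j : Fin R, (if (j : ℕ) < m then A else Finset.univ).card =
        if (j : ℕ) < m then A.card else Fintype.card β := by
      intro j
      split_ifs <;> rfl
    simp only [this]
    rw [Finset.prod_ite, Finset.prod_const, Finset.prod_const, hcard]
    congr 2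
    have h3 := Finset.card_filter_add_card_filter_not (s := (Finset.univ : Finset (Fin R)))
      fun j : Fin R => (j : ℕ) < m
    rw [hcard, Finset.card_univ, Fintype.card_fin] at h3
    omega
  rw [h1, Fintype.card_piFinset, h2, Fintype.card_fun, Fintype.card_fin, ← mul_assoc]
  calc 2 ^ L * A.card ^ m * Fintype.card β ^ (R - m) ≤
      Fintype.card β ^ m * Fintype.card β ^ (R - m) := by
        gcongr
        rw [hmq]
        exact two_pow_mul_le hq hA
    _ = _ := by rw [← pow_add]; congr 1; omega

end Counting

/-! ### The random table and completeness of the tester. -/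

section Table

variable {n : ℕ}

/-- Descriptions of the labels of at most `M` variables of `V`. -/
abbrev LabCode (V : Finset (Fin n)) (M d : ℕ) : Type := Fin M → Option V × Fin (d + 3)

open Classical in
/-- The labels with the given description. -/
def LabCode.lab {V : Finset (Fin n)} {M d : ℕ} (c : LabCode V M d) : Lab n := fun i =>
  if h : ∃ k, ∃ v, (c k).1 = some v ∧ (v : Fin n) = i then 2 ^ ((c h.choose).2 : ℕ) / 2 else 2

/-- Half of 2^k, rounded down, runs through 0, 1, 2, 4, 8, ..., exactly the admissible labels, so
that an exponent encodes a label. -/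
theorem half_two_pow {d k : ℕ} (hk : k < d + 3) :
    2 ^ k / 2 = 0 ∨ 2 ^ k / 2 = 1 ∨ 2 ^ k / 2 = 2 ∨ ∃ j < d, 2 ^ k / 2 = 4 * 2 ^ j := by
  rcases k with _ | _ | _ | k
  · simp
  · simp
  · simp
  · refine Or.inr (Or.inr (Or.inr ⟨k, by omega, ?_⟩))
    rw [pow_succ, Nat.mul_div_cancel _ (by norm_num), pow_add]
    ring

theorem LabCode.valid {V : Finset (Fin n)} {M d : ℕ} (c : LabCode V M d) : ValidLab d c.lab := by
  intro i
  rw [LabCode.lab]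
  split_ifs with h
  · exact half_two_pow (Fin.is_lt _)
  · simp

theorem exists_half_two_pow {s d l : ℕ} (hs : s ≤ d)
    (h : l = 0 ∨ l = 1 ∨ l = 2 ∨ ∃ j < s, l = 4 * 2 ^ j) : ∃ k : Fin (d + 3), 2 ^ (k : ℕ) / 2 = l := by
  rcases h with rfl | rfl | rfl | ⟨j, hj, rfl⟩
  · exact ⟨⟨0, by omega⟩, by simp⟩
  · exact ⟨⟨1, by omega⟩, by simp⟩
  · exact ⟨⟨2, by omega⟩, by simp⟩
  · refine ⟨⟨j + 3, by omega⟩, ?_⟩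
    show 2 ^ (j + 3) / 2 = _
    rw [pow_succ, Nat.mul_div_cancel _ (by norm_num), pow_add]
    ring

/-- A labelling matters only on V and is 2 there except at few variables; the code lists these with
their labels. Unused entries of the list are `none`. -/
theorem exists_labCode {V : Finset (Fin n)} {M s d : ℕ} {lab : Lab n} (hs : s ≤ d)
    (hvalid : ValidLab s lab) (hM : (V.filter fun i => lab i ≠ 2).card ≤ M) :
    ∃ c : LabCode V M d, ∀ i ∈ V, lab i = c.lab i := by
  classical
  set A := V.filter fun i => lab i ≠ 2 with hA
  choose K hK using fun i => exists_half_two_pow hs (hvalid i)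
  have hAV : ∀ v : A, (v : Fin n) ∈ V := fun v => (Finset.mem_filter.1 v.2).1
  obtain ⟨c, hc1, hc2⟩ : ∃ c : LabCode V M d,
      (∀ k v, (c k).1 = some v → lab v ≠ 2 ∧ (c k).2 = K v) ∧
      ∀ i (hi : i ∈ V), lab i ≠ 2 → ∃ k, (c k).1 = some ⟨i, hi⟩ := by
    refine ⟨fun k => if h : (k : ℕ) < A.card then
      (some ⟨A.equivFin.symm ⟨k, h⟩, hAV _⟩, K (A.equivFin.symm ⟨k, h⟩)) else (none, 0), ?_, ?_⟩
    · intro k v hv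
      beta_reduce at hv ⊢
      by_cases hk : (k : ℕ) < A.card
      · rw [dif_pos hk] at hv ⊢
        obtain rfl := Option.some_injective _ hv
        exact ⟨(Finset.mem_filter.1 (A.equivFin.symm ⟨k, hk⟩).2).2, rfl⟩
      · rw [dif_neg hk] at hv
        simp at hv
    · intro i hi hne
      have hiA : i ∈ A := Finset.mem_filter.2 ⟨hi, hne⟩
      exact ⟨⟨A.equivFin ⟨i, hiA⟩, (Fin.is_lt _).trans_le hM⟩, by simp⟩
  refine ⟨c, fun i hi => ?_⟩
  rw [LabCode.lab]
  by_cases h : ∃ k, ∃ v, (c k).1 = some v ∧ (v : Fin n) = i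
  · rw [dif_pos h]
    obtain ⟨v, hv1, hv2⟩ := h.choose_spec
    rw [(hc1 _ _ hv1).2, hv2, hK]
  · rw [dif_neg h]
    by_contra hne
    obtain ⟨k, hk⟩ := hc2 i hi hne
    exact h ⟨k, _, hk, rfl⟩

/-- An entry has at most 2^d * 2^(d+2) values; (d+1)^2 entries give 2 (d+1)^3 bits, and the number
of classes together with the constant value gives at most d + 1 more. -/
theorem card_labCode_le {V : Finset (Fin n)} {d : ℕ} (hV : V.card + 1 ≤ 2 ^ d) :
    Fintype.card (LabCode V ((d + 1) ^ 2) d × Fin (d + 1) × ZMod 2) ≤ 2 ^ (3 * (d + 1) ^ 3) := by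
  have hd : d < 2 ^ d := Nat.lt_two_pow_self
  rw [Fintype.card_prod, Fintype.card_prod, Fintype.card_fun, Fintype.card_prod, Fintype.card_option,
    Fintype.card_coe, Fintype.card_fin, Fintype.card_fin, Fintype.card_fin, ZMod.card]
  calc ((V.card + 1) * (d + 3)) ^ (d + 1) ^ 2 * ((d + 1) * 2) ≤
      (2 ^ d * 2 ^ (d + 2)) ^ (d + 1) ^ 2 * (2 ^ d * 2) := by
        gcongr
        · rw [pow_add]
          omega
        · omega
    _ = 2 ^ (2 * (d + 1) * (d + 1) ^ 2 + (d + 1)) := by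
        rw [← pow_add, ← pow_succ, ← pow_mul, ← pow_add]
        congr 3
        ring
    _ ≤ _ := by
        apply Nat.pow_le_pow_right (by norm_num)
        have := le_cube d
        nlinarith

open Classical in
-- The class sum plus b is a nonzero polynomial of degree at most d - s, so the sum avoids b on at
-- least a 2^(-(d-s)) fraction of the points. All 2^(d-s) * `rowFactor d` rows miss that set with
-- probability at most 2^(-`rowFactor d`).
theorem card_fooled_le {T : DecisionTree n} {d s : ℕ} (hT : T.depth ≤ d) {lab : Lab n}
    (hvalid : ValidLab d lab) (hs : s ≤ d) {b : ZMod 2} (hb : ∃ y, classSum T.eval lab s 2 y ≠ b) :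
    2 ^ rowFactor d * (Finset.univ.filter fun tb : Fin (numRows d) → Vec n => ∀ j : Fin (numRows d),
      (j : ℕ) < 2 ^ d / 2 ^ s * rowFactor d →
        tb j ∈ Finset.univ.filter fun y => classSum T.eval lab s 2 y = b).card ≤
      Fintype.card (Fin (numRows d) → Vec n) := by
  obtain ⟨y₀, hy₀⟩ := hb
  have hdiv : 2 ^ d / 2 ^ s = 2 ^ (d - s) := Nat.pow_div hs (by norm_num)
  have hpos : 0 < 2 ^ (d - s) := by positivity
  have hdeg := (polyDeg_sum hvalid ((polyDeg_tree T).mono hT) hs).add (PolyDeg.const b _)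
  simp only [← classSum_two] at hdeg
  have hne : ∀ a b : ZMod 2, a ≠ b → a + b ≠ 0 := by decide
  have h4 := hdeg.card_le (hne _ _ hy₀)
  have hval : ∀ a b : ZMod 2, (if a = b then 1 else 0) + (a + b).val = 1 := by decide
  have h5 : (Finset.univ.filter fun y => classSum T.eval lab s 2 y = b).card +
      ∑ y, (classSum T.eval lab s 2 y + b).val = Fintype.card (Vec n) := by
    rw [Finset.card_filter, ← Finset.sum_add_distrib, Fintype.card_eq_sum_ones]
    exact Finset.sum_congr rfl fun y _ => by convert hval _ _
  have hm := div_mul_rowFactor_le (d := d) (s := s)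
  generalize hA : (Finset.univ.filter fun y => classSum T.eval lab s 2 y = b) = A at *
  generalize numRows d = R at *
  suffices hlt : 2 ^ (d - s) * A.card ≤ (2 ^ (d - s) - 1) * Fintype.card (Vec n) by
    convert card_forall_lt A hm hpos (by rw [hdiv]) hlt
  generalize (∑ y, (classSum T.eval lab s 2 y + b).val) = X at *
  rw [← h5] at h4 ⊢
  obtain ⟨p, hp⟩ := Nat.exists_eq_add_of_le' hpos
  rw [hp] at h4 ⊢
  rw [Nat.add_sub_cancel]
  nlinarith

open Classical in
-- A union bound over labelling, number of classes and common value b. Including b makes each bad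
-- event a fixed condition on the rows, although b is itself the value at the row 0. There are at
-- most 2^(3(d+1)^3) events of probability at most 2^(-8(d+1)^3).
theorem goodTab_prob {T : DecisionTree n} {d : ℕ} (hT : T.depth ≤ d) :
    expect (fillP (fillP coinP n) (numRows d))
      (fun tb => if ¬ GoodTab T d (tableOf tb) then 1 else 0) ≤ 1 / (16 : ℕ) := by
  rw [coinP_eq, fillP_uniform, fillP_uniform]
  refine expect_uniform_le (α := Fin (numRows d) → Vec n)
    (P := fun tb => ¬ GoodTab T d (tableOf tb)) (k := 16) ?_
  have hV : T.vars.card + 1 ≤ 2 ^ d :=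
    (card_vars_lt T).trans (Nat.pow_le_pow_right (by norm_num) hT)
  set Bad : LabCode T.vars ((d + 1) ^ 2) d × Fin (d + 1) × ZMod 2 → Finset (Fin (numRows d) → Vec n) :=
    fun p => if ∃ y, classSum T.eval p.1.lab p.2.1 2 y ≠ p.2.2 then
      Finset.univ.filter fun tb : Fin (numRows d) → Vec n => ∀ j : Fin (numRows d),
        (j : ℕ) < 2 ^ d / 2 ^ (p.2.1 : ℕ) * rowFactor d →
          tb j ∈ Finset.univ.filter fun y => classSum T.eval p.1.lab p.2.1 2 y = p.2.2
      else ∅ with hBad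
  have h1 : (Finset.univ.filter fun tb : Fin (numRows d) → Vec n => ¬ GoodTab T d (tableOf tb)) ⊆
      Finset.univ.biUnion Bad := by
    intro tb htb
    have h2 := (Finset.mem_filter.1 htb).2
    unfold GoodTab at h2
    push Not at h2
    obtain ⟨lab, s, hs, hvalid, hsparse, hall, y, hy⟩ := h2
    obtain ⟨c, hc⟩ := exists_labCode hs hvalid hsparse
    have hS : ∀ z, classSum T.eval lab s 2 z = classSum T.eval c.lab s 2 z := fun z =>
      classSum_congr T hc fun _ _ _ => rfl
    refine Finset.mem_biUnion.2 ⟨(c, ⟨s, by omega⟩, classSum T.eval lab s 2 (tableOf tb 0)),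
      Finset.mem_univ _, ?_⟩
    rw [hBad]
    simp only
    rw [if_pos ⟨y, by rwa [← hS]⟩]
    refine Finset.mem_filter.2 ⟨Finset.mem_univ _, fun j hj => ?_⟩
    refine Finset.mem_filter.2 ⟨Finset.mem_univ _, ?_⟩
    rw [← hS, ← hall j hj]
    simp [tableOf]
  have h2 := (Finset.card_le_card h1).trans Finset.card_biUnion_le
  have h3 : ∀ p ∈ (Finset.univ : Finset (LabCode T.vars ((d + 1) ^ 2) d × Fin (d + 1) × ZMod 2)),
      2 ^ rowFactor d * (Bad p).card ≤ Fintype.card (Fin (numRows d) → Vec n) := by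
    rintro ⟨c, s, b⟩ -
    rw [hBad]
    simp only
    split_ifs with hex
    · exact card_fooled_le hT c.valid (by omega) hex
    · simp
  have h4 := Finset.sum_le_sum h3
  rw [← Finset.mul_sum, Finset.sum_const, smul_eq_mul, Finset.card_univ] at h4
  have h5 := card_labCode_le (V := T.vars) hV
  have h6 : 16 * 2 ^ (3 * (d + 1) ^ 3) ≤ 2 ^ rowFactor d := by
    rw [show 16 = 2 ^ 4 by norm_num, ← pow_add]
    apply Nat.pow_le_pow_right (by norm_num)
    have := le_cube d
    rw [rowFactor]
    omega
  have hpos : 0 < 2 ^ (3 * (d + 1) ^ 3) := by positivity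
  refine Nat.le_of_mul_le_mul_left ?_ hpos
  calc 2 ^ (3 * (d + 1) ^ 3) * (16 * _) = 16 * 2 ^ (3 * (d + 1) ^ 3) * _ := by ring
    _ ≤ 2 ^ rowFactor d * _ := Nat.mul_le_mul h6 h2
    _ ≤ _ := h4
    _ ≤ _ := Nat.mul_le_mul_right _ h5

theorem verdictP_complete {T : DecisionTree n} {d : ℕ} (hT : T.depth ≤ d) (D : PMF (Cube n)) (E : ℕ) :
    2 / 3 ≤ expect (verdictP T.eval D d E) boolInd := by
  classical
  have hV : T.vars.card ≤ 2 ^ d :=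
    (Nat.le_succ _).trans ((card_vars_lt T).trans (Nat.pow_le_pow_right (by norm_num) hT))
  have h1 := blockOf_injOn hV
  have h2 := goodTab_prob hT
  -- For every hash and table, the acceptance probability plus the indicators of the two bad events
  -- is at least 1; this is then averaged.
  have h3 : 1 ≤ expect (verdictP T.eval D d E) boolInd + (1 / (16 : ℕ) + 1 / (16 : ℕ)) := by
    refine le_trans ?_ (add_le_add_right (add_le_add h1 h2) _)
    rw [verdictP, expect_bind]
    generalize hP : expect (fillP (fillP coinP n) (numRows d))
      (fun tb => if ¬ GoodTab T d (tableOf tb) then (1 : ENNReal) else 0) = P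
    refine le_trans ?_ ((expect_add _ _).trans (congrArg _ ((expect_add _ fun _ => P).trans
      (congrArg _ (expect_const P))))).le
    refine (expect_const 1).symm.le.trans (expect_mono fun hb => ?_)
    rw [expect_bind, ← hP]
    generalize hJ : (if ¬ Set.InjOn (blockOf hb) T.vars then (1 : ENNReal) else 0) = J
    refine le_trans ?_ ((expect_add _ _).trans (congrArg _ ((expect_add (fun _ => J) _).trans
      (congrArg (· + _) (expect_const J))))).le
    refine (expect_const 1).symm.le.trans (expect_mono fun tb => ?_)
    rw [← hJ]
    by_cases hinj : Set.InjOn (blockOf hb) T.vars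
    · by_cases htab : GoodTab T d (tableOf tb)
      · refine le_trans ?_ le_self_add
        refine (expect_const (μ := loopP (fun _ => sampleStep T.eval D d (blockOf hb) (tableOf tb)) 0
          (80 * E) true) 1).symm.le.trans ?_
        refine ENNReal.tsum_le_tsum fun b => ?_
        by_cases hb' : b ∈ (loopP (fun _ => sampleStep T.eval D d (blockOf hb) (tableOf tb)) 0
            (80 * E) true).support
        · have := loopP_support (I := fun b => b = true) (fun _ b hb => by
            subst hb
            exact sampleStep_complete hT (fun i => digitsVal_lt _ _) hinj htab D) _ _ _ rfl b hb'
          rw [this]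
          simp [boolInd]
        · rw [PMF.mem_support_iff, not_not] at hb'
          simp [hb']
      · refine le_trans (le_trans ?_ le_add_self) le_add_self
        simp [htab]
    · refine le_trans (le_trans ?_ le_self_add) le_add_self
      simp [hinj]
  have h4 : (1 / (16 : ℕ) + 1 / (16 : ℕ) : ENNReal) ≤ 1 / 3 := by
    rw [← ENNReal.add_div, ENNReal.div_le_iff (by simp) (by simp), ← ENNReal.mul_div_right_comm,
      ENNReal.le_div_iff_mul_le (by simp) (by simp)]
    norm_num
  have h5 : (2 / 3 : ENNReal) + 1 / 3 = 1 := by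
    rw [← ENNReal.add_div]
    norm_num
    exact ENNReal.div_self (by simp) (by simp)
  have h6 := h5.le.trans (h3.trans (add_le_add_right h4 _))
  exact (ENNReal.add_le_add_iff_right (ENNReal.div_ne_top (by simp) (by simp))).1 h6

end Table

/-! ### The tester on the machine -/

section Machine

variable {w n : ℕ} {f : BoolFun n} {D : PMF (Cube n)}

/-- A program whose verdict is distributed as `μ` accepts and rejects with the probabilities that
`μ` gives, within the stated time and number of queries. -/
theorem Ref.verdict {p : Prog} {input : List ℕ} {μ : PMF Bool} {T Q : ℕ}
    (h : Ref w f D p ((initial w p input).view n) μ (fun b σ' => σ'.v 0 = b.toNat) T Q) :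
    RunsWithin f D (initial w p input) Q T ∧
      expect μ boolInd ≤ acceptProb f D (initial w p input) ∧
      expect μ (fun b => boolInd !b) ≤ rejectProb f D (initial w p input) := by
  obtain ⟨N, hN⟩ := (h (initial w p input) [] rfl rfl).run fun _ _ hb => hb.1
  obtain ⟨hrun, hprob⟩ := hN N le_rfl
  have hreg : ∀ (b : Bool) (c' : Config w), (c'.view n).v 0 = b.toNat →
      (c'.reg 0).toNat = b.toNat := fun b c' hb => by
    rwa [c'.view_reg (by norm_num [numRegs])] at hb
  refine ⟨⟨N, fun c' hc' => ?_⟩, ?_, ?_⟩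
  · obtain ⟨b, htodo, -, htime, hqueries⟩ := hrun c' hc'
    simp only [initial, zero_add] at htime hqueries
    exact ⟨htodo, by exact_mod_cast hqueries, by exact_mod_cast htime⟩
  · have h1 : expect μ boolInd = μ.toOuterMeasure {true} := by
      rw [toOuterMeasure_eq_expect]
      congr 1
      funext b
      cases b <;> simp [boolInd]
    rw [h1]
    refine (hprob _).trans (le_iSup_of_le N (MeasureTheory.measure_mono ?_))
    rintro c' ⟨b, rfl, htodo, hv, -⟩
    refine ⟨htodo, fun h0 => ?_⟩
    have := hreg _ _ hv
    simp [h0] at this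
  · have h1 : expect μ (fun b => boolInd !b) = μ.toOuterMeasure {false} := by
      rw [toOuterMeasure_eq_expect]
      congr 1
      funext b
      cases b <;> simp [boolInd]
    rw [h1]
    refine (hprob _).trans (le_iSup_of_le N (MeasureTheory.measure_mono ?_))
    rintro c' ⟨b, rfl, htodo, hv, -⟩
    refine ⟨htodo, BitVec.eq_of_toNat_eq ?_⟩
    simpa using hreg _ _ hv

theorem two_thirds_le_of_le_third {μ : PMF Bool} (h : expect μ boolInd ≤ 1 / 3) :
    2 / 3 ≤ expect μ (fun b => boolInd !b) := by
  have h1 : expect μ boolInd + expect μ (fun b => boolInd !b) = 1 := by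
    rw [← expect_add, ← expect_const (μ := μ) 1]
    congr 1
    funext b
    cases b <;> simp [boolInd]
  have h2 : (2 / 3 : ENNReal) + 1 / 3 = 1 := by
    rw [← ENNReal.add_div]
    norm_num
    exact ENNReal.div_self (by simp) (by simp)
  have h3 := (h2.trans h1.symm).le.trans (add_le_add_left h _)
  rw [add_comm (1 / 3 : ENNReal)] at h3
  exact (ENNReal.add_le_add_iff_right (ENNReal.div_ne_top (by simp) (by simp))).1 h3

theorem not_isFarFrom_of_subsingleton (hn : n = 0) {ε : ℝ} {depth : ℕ} :
    ¬ IsFarFrom D ε f (DT n depth) := by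
  subst hn
  intro h
  refine absurd (h f ⟨.leaf (f default), Nat.zero_le _, ?_⟩) ?_
  · funext x
    rw [Subsingleton.elim x default]
    rfl
  · simp [disagreement]

/-- The case n = 0 is separate because the literal test needs a variable and the main time bound is
to be proportional to n. There the program accepts at once within the additive 100, and no function
is far since every function is a leaf. -/
theorem exists_verdict {d E depth : ℕ} {ε : ℝ} {σ : AbsState} (hε : 0 < ε) (h1 : ε ≤ 1)
    (hE : 1 / ε ≤ E) (hB : Big w n d E) (hdepth : d = 0 ∨ (d + 1) ^ 2 ≤ depth) (h0 : σ.v 0 = n)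
    (hd : σ.v 1 = d) (h2 : σ.v 2 = E) :
    ∃ μ : PMF Bool, Ref w f D testerCode σ μ (fun b σ' => σ'.v 0 = b.toNat)
        (2200000 * (E * (2 ^ d * (d + 1) ^ 5) * n) + 100) (1680 * (E * (2 ^ d * (d + 1) ^ 5))) ∧
      (f ∈ DT n d → 2 / 3 ≤ expect μ boolInd) ∧
      (IsFarFrom D ε f (DT n depth) → expect μ boolInd ≤ 1 / 3) := by
  have hE0 : 0 < E := by
    have : (0 : ℝ) < E := (by positivity : 0 < 1 / ε).trans_le hE
    exact_mod_cast this
  have hw := hB.fits.pos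
  rcases Nat.eq_zero_or_pos n with hn | hn
  · refine ⟨PMF.pure true, ?_, fun _ => ?_, fun h => absurd h (not_isFarFrom_of_subsingleton hn)⟩
    · have h64 := hB.fits.le_two_pow
      have hassign : Det w f D (assign 0 (.c 1)) σ (fun σ' => σ'.v 0 = 1) 5 0 :=
        (Det.assign hw (by norm_num [numRegs]) (by show 1 < 2 ^ w; omega)).weaken le_rfl le_rfl
          fun _ σ' h => by rw [h]; rfl
      have hverdict := hassign.map (R' := fun (b : Bool) σ' => σ'.v 0 = b.toNat) (fun _ => true)
        fun _ _ h => h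
      rw [PMF.pure_map] at hverdict
      exact (Ref.cond (e := .v 0) (σ := σ) (T := 0) (Q := 0) hw (show 0 < numRegs by norm_num [numRegs])
        (fun h => absurd (h0.trans hn) h) fun _ => hverdict).bound
        (Nat.le_add_left_of_le (by decide)) (Nat.zero_le _)
    · rw [expect_pure]
      simp only [boolInd, if_true]
      exact ENNReal.div_le_of_le_mul (by norm_num)
  · refine ⟨verdictP f D d E, (testerCode_spec hB hE0 hn h0 hd h2).bound ?_ le_rfl, ?_,
      fun h => verdictP_sound hn D hε h1 hE h hdepth⟩
    · calc 1100000 * (E * (2 ^ d * (d + 1) ^ 5 * (n + 1))) ≤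
          1100000 * (E * (2 ^ d * (d + 1) ^ 5 * (2 * n))) := by gcongr; omega
        _ = 2200000 * (E * (2 ^ d * (d + 1) ^ 5) * n) := by ring
        _ ≤ _ := Nat.le_add_right _ _
    · rintro ⟨T, hT, rfl⟩
      exact verdictP_complete hT D E

end Machine

/-! ### Word length and the numerical form of the bounds. -/

section Numerics

/-- With P = 2^(d+L+1), where L is the logarithm of n + E, the numbers d + 1, 2^d, n and E are all
at most P. Since P ≥ 2, numerical factors are absorbed by powers of P as well, and P^10 bounds
everything; 2^w is at least P^40. -/
theorem Big.of_le {n d E w : ℕ} (h : 40 * (d + Nat.log 2 (n + E) + 1) ≤ w) : Big w n d E := by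
  have hlog : n + E < 2 ^ (Nat.log 2 (n + E) + 1) := Nat.lt_pow_succ_log_self (by norm_num) _
  generalize Nat.log 2 (n + E) = L at *
  have hP2 : 2 ≤ 2 ^ (d + L + 1) := Nat.le_self_pow (by omega) 2
  have hPd : 2 ^ d ≤ 2 ^ (d + L + 1) := Nat.pow_le_pow_right (by norm_num) (by omega)
  have hPL : 2 ^ (L + 1) ≤ 2 ^ (d + L + 1) := Nat.pow_le_pow_right (by norm_num) (by omega)
  have hPw : (2 ^ (d + L + 1)) ^ 40 ≤ 2 ^ w := by
    rw [← pow_mul, mul_comm]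
    exact Nat.pow_le_pow_right (by norm_num) h
  have hd : d < 2 ^ d := Nat.lt_two_pow_self
  have hrows := numRows_pos (d := d)
  have hk : ∀ k, (2 ^ k : ℕ) ≤ (2 ^ (d + L + 1)) ^ k := fun k => Nat.pow_le_pow_left hP2 k
  have hnb : numBlocks d = 16 * (2 ^ d * 2 ^ d) := by
    rw [numBlocks, blockBits, pow_add, two_mul, pow_add]
    ring
  have hnr : numRows d = 8 * (2 ^ d * (d + 1) ^ 3) := by
    rw [numRows, rowFactor]
    ring
  have hbb : blockBits d = 2 * d + 4 := rfl
  generalize 2 ^ (d + L + 1) = P at *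
  have hlt : ∀ j < 40, P ^ j < 2 ^ w := fun j hj => (Nat.pow_lt_pow_right hP2 hj).trans_le hPw
  have h3 := hk 3
  have h5 := hk 5
  have h7 := hk 7
  norm_num at h3 h5 h7
  have hP4 : 1 ≤ P ^ 4 := Nat.one_le_pow _ _ (by omega)
  have hcube : 2 ^ d * (d + 1) ^ 3 ≤ P ^ 4 :=
    calc 2 ^ d * (d + 1) ^ 3 ≤ P * P ^ 3 := by gcongr; omega
      _ = P ^ 4 := by ring
  have hr : 23 + numRows d ≤ P ^ 9 := by
    rw [hnr]
    calc 23 + 8 * (2 ^ d * (d + 1) ^ 3) ≤ 32 * P ^ 4 := by omega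
      _ ≤ P ^ 5 * P ^ 4 := by gcongr
      _ = P ^ 9 := by ring
  refine ⟨⟨by omega, ?_, by omega, ?_⟩, hr.trans_lt (hlt 9 (by norm_num)), ?_, ?_, ?_, ?_⟩
  · refine le_trans ?_ (hlt 10 (by norm_num)).le
    calc (22 + numRows d + 1) * n ≤ P ^ 9 * P := by gcongr <;> omega
      _ = P ^ 10 := by ring
  · exact lt_of_le_of_lt (by rw [pow_one]; omega) (hlt 1 (by norm_num))
  · refine lt_of_le_of_lt ?_ (hlt 10 (by norm_num))
    rw [hbb, hnb]
    calc (2 * d + 4 + 1) * (16 * (2 ^ d * 2 ^ d)) ≤ (P ^ 3 * P) * (P ^ 3 * P * (P * P)) := by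
          have : 8 * P ≤ P ^ 3 * P := Nat.mul_le_mul_right _ h3
          have h4 := hk 4
          norm_num at h4
          gcongr
          · omega
          · exact h4.trans (by rw [← pow_succ])
      _ = P ^ 10 := by ring
  · refine lt_of_le_of_lt ?_ (hlt 4 (by norm_num))
    calc 8 * 2 ^ d ≤ P ^ 3 * P := by gcongr
      _ = P ^ 4 := by ring
  · exact lt_of_le_of_lt (Nat.pow_le_pow_left (by omega) 2) (hlt 2 (by norm_num))
  · refine lt_of_le_of_lt ?_ (hlt 8 (by norm_num))
    calc 80 * E ≤ P ^ 7 * P := by gcongr <;> omega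
      _ = P ^ 8 := by ring

/-- The argument of the logarithm is at least 2^(d+1) and log 2 ≥ 1/2, so d + 1 is at most twice the
logarithm; 32 is 2^5. -/
theorem pow_five_le_log {d : ℕ} {ε : ℝ} (hε : 0 < ε) (h1 : ε ≤ 1) :
    ((d : ℝ) + 1) ^ 5 ≤ 32 * Real.log (2 ^ (2 * d) + 2 ^ d / ε) ^ 5 := by
  have hX : (2 : ℝ) ^ (d + 1) ≤ 2 ^ (2 * d) + 2 ^ d / ε := by
    have h2 : (2 : ℝ) ^ d ≤ 2 ^ (2 * d) := pow_le_pow_right₀ (by norm_num) (by omega)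
    have h3 : (2 : ℝ) ^ d ≤ 2 ^ d / ε := le_div_self (by positivity) hε h1
    rw [pow_succ]
    linarith
  have hlog := Real.log_le_log (by positivity) hX
  rw [Real.log_pow] at hlog
  push_cast at hlog
  have h2 : (1 / 2 : ℝ) ≤ Real.log 2 := by linarith [Real.log_two_gt_d9]
  have h3 : (d : ℝ) + 1 ≤ 2 * Real.log (2 ^ (2 * d) + 2 ^ d / ε) := by nlinarith
  calc ((d : ℝ) + 1) ^ 5 ≤ (2 * Real.log (2 ^ (2 * d) + 2 ^ d / ε)) ^ 5 := by gcongr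
    _ = _ := by ring

/-- Rounding up 1/ε costs a factor 2 because ε ≤ 1, and `pow_five_le_log` costs 32; hence 64. The
term 2^d/ε alone already suffices. -/
theorem steps_le_queryBound {d C K : ℕ} {ε : ℝ} (hε : 0 < ε) (h1 : ε ≤ 1) (hC : 64 * K ≤ C) :
    ((K * (⌈1 / ε⌉₊ * (2 ^ d * (d + 1) ^ 5)) : ℕ) : ℝ) ≤ queryBound C 5 d ε := by
  have hE : (⌈1 / ε⌉₊ : ℝ) ≤ 2 / ε := by
    have h2 := (Nat.ceil_lt_add_one (a := 1 / ε) (by positivity)).le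
    have h3 : 1 ≤ 1 / ε := by rwa [le_div_iff₀ hε, one_mul]
    have h4 : 2 / ε = 1 / ε + 1 / ε := by ring
    linarith
  have hlog := pow_five_le_log (d := d) hε h1
  have hC' : (64 * K : ℝ) ≤ C := by exact_mod_cast hC
  have h5 : 0 ≤ Real.log (2 ^ (2 * d) + 2 ^ d / ε) ^ 5 := by
    have : (0 : ℝ) ≤ ((d : ℝ) + 1) ^ 5 := by positivity
    linarith
  rw [queryBound]
  push_cast
  calc (K : ℝ) * (⌈1 / ε⌉₊ * (2 ^ d * ((d : ℝ) + 1) ^ 5)) ≤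
      K * (2 / ε * (2 ^ d * (32 * Real.log (2 ^ (2 * d) + 2 ^ d / ε) ^ 5))) := by gcongr
    _ = 64 * K * (2 ^ d / ε) * Real.log (2 ^ (2 * d) + 2 ^ d / ε) ^ 5 := by ring
    _ ≤ C * (2 ^ (2 * d) + 2 ^ d / ε) * Real.log (2 ^ (2 * d) + 2 ^ d / ε) ^ 5 := by
      gcongr
      exact le_add_of_nonneg_left (by positivity)

/-- For d ≥ 1 the square d^2 is at most both terms of the minimum, and (d+1)^2 ≤ 4 d^2. -/
theorem sq_le_depthBound {d C : ℕ} {ε : ℝ} (hε : 0 < ε) (h1 : ε ≤ 1) (hC : 4 ≤ C) :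
    d = 0 ∨ (d + 1) ^ 2 ≤ depthBound C d ε := by
  refine (Nat.eq_zero_or_pos d).imp_right fun hd => Nat.le_floor ?_
  have hd' : (1 : ℝ) ≤ d := by exact_mod_cast hd
  have hC' : (4 : ℝ) ≤ C := by exact_mod_cast hC
  have hlog : 0 ≤ Real.log (1 / ε) := Real.log_nonneg (by rwa [le_div_iff₀ hε, one_mul])
  have hmin : (d : ℝ) ^ 2 ≤ min ((d : ℝ) ^ 3) ((d : ℝ) ^ 2 + Real.log (1 / ε)) :=
    le_min (pow_le_pow_right₀ hd' (by norm_num)) (by linarith)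
  push_cast
  calc ((d : ℝ) + 1) ^ 2 ≤ 4 * d ^ 2 := by nlinarith
    _ ≤ _ := by gcongr

end Numerics

/-- The tester meets its specification, with any large enough constant `C`. -/
theorem testerCode_correct {C : ℕ} (hC : 200000 ≤ C) {n d : ℕ} {ε : ℝ} {w : ℕ} (hε : 0 < ε)
    (h1 : ε ≤ 1) (hw : 40 * (d + Nat.log 2 (n + ⌈1 / ε⌉₊) + 1) ≤ w) (D : PMF (Cube n))
    (f : BoolFun n) :
    RunsWithin f D (initial w testerCode [n, d, ⌈1 / ε⌉₊]) (queryBound C 5 d ε)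
        (C * 2 ^ (C * d) + C * queryBound C 5 d ε * n) ∧
      (f ∈ DT n d → 2 / 3 ≤ acceptProb f D (initial w testerCode [n, d, ⌈1 / ε⌉₊])) ∧
      (IsFarFrom D ε f (DT n (depthBound C d ε)) →
        2 / 3 ≤ rejectProb f D (initial w testerCode [n, d, ⌈1 / ε⌉₊])) := by
  have hB := Big.of_le hw
  have hreg : ∀ r x, r < 3 → [n, d, ⌈1 / ε⌉₊].getD r 0 = x → x < 2 ^ w →
      ((initial w testerCode [n, d, ⌈1 / ε⌉₊]).view n).v r = x := by
    intro r x hr hx hxw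
    rw [Config.view_reg _ (hr.trans (by norm_num [numRegs]))]
    show (BitVec.ofNat w _).toNat = x
    rw [hx, BitVec.toNat_ofNat, Nat.mod_eq_of_lt hxw]
  obtain ⟨μ, hμ, hcomplete, hsound⟩ := exists_verdict (f := f) (D := D)
    (σ := (initial w testerCode [n, d, ⌈1 / ε⌉₊]).view n) hε h1 (Nat.le_ceil _) hB
    (sq_le_depthBound (C := C) hε h1 (by omega)) (hreg 0 n (by norm_num) rfl hB.fits.lt)
    (hreg 1 d (by norm_num) rfl (by have := hB.steps_lt; nlinarith))
    (hreg 2 _ (by norm_num) rfl (by have := hB.samples_lt; omega))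
  obtain ⟨⟨N, hN⟩, haccept, hreject⟩ := hμ.verdict
  refine ⟨⟨N, fun c' hc' => ?_⟩, fun h => (hcomplete h).trans haccept,
    fun h => (two_thirds_le_of_le_third (hsound h)).trans hreject⟩
  obtain ⟨htodo, hqueries, htime⟩ := hN c' hc'
  refine ⟨htodo, hqueries.trans (steps_le_queryBound hε h1 (by omega)), htime.trans ?_⟩
  have hCC : (1 : ℝ) ≤ C := by exact_mod_cast (by omega : 1 ≤ C)
  have hC' : (200000 : ℝ) ≤ C := by exact_mod_cast hC
  -- The time constant is met with room to spare, since 64 * 3000 ≤ 200000 ≤ C and the factor C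
  -- stands in front again. The additive 100 goes into C * 2^(C d).
  have hsteps := steps_le_queryBound (d := d) (C := C) (K := 3000) hε h1 (by omega)
  have hpow : (1 : ℝ) ≤ 2 ^ (C * d) := one_le_pow₀ (by norm_num)
  rw [Nat.cast_mul] at hsteps
  have hY : (0 : ℝ) ≤ ((⌈1 / ε⌉₊ * (2 ^ d * (d + 1) ^ 5) : ℕ) : ℝ) := Nat.cast_nonneg _
  rw [Nat.cast_add, Nat.cast_mul, Nat.cast_mul]
  generalize ((⌈1 / ε⌉₊ * (2 ^ d * (d + 1) ^ 5) : ℕ) : ℝ) = Y at *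
  have hn : (0 : ℝ) ≤ n := Nat.cast_nonneg _
  push_cast at hsteps ⊢
  calc 2200000 * (Y * n) + 100 ≤ 200000 * (3000 * Y) * n + 200000 * 1 := by
        have := mul_nonneg hY hn
        linarith
    _ ≤ C * queryBound C 5 d ε * n + C * 2 ^ (C * d) := by gcongr
    _ = _ := add_comm _ _

end DTTest

end

theorem mainTheorem4 :
    ∃ (p : DTTest.Prog) (κ C k : ℕ),
      ∀ (n d : ℕ) (ε : ℝ) (w : ℕ), 0 < ε → ε ≤ 1 →
        κ * (d + Nat.log 2 (n + ⌈1 / ε⌉₊) + 1) ≤ w →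
        ∀ (D : PMF (DTTest.Cube n)) (f : DTTest.BoolFun n),
          DTTest.RunsWithin f D (DTTest.initial w p [n, d, ⌈1 / ε⌉₊])
            (DTTest.queryBound C k d ε)
            (C * 2 ^ (C * d) + C * DTTest.queryBound C k d ε * n) ∧
          (f ∈ DTTest.DT n d →
            2 / 3 ≤ DTTest.acceptProb f D (DTTest.initial w p [n, d, ⌈1 / ε⌉₊])) ∧
          (DTTest.IsFarFrom D ε f (DTTest.DT n (DTTest.depthBound C d ε)) →
            2 / 3 ≤ DTTest.rejectProb f D (DTTest.initial w p [n, d, ⌈1 / ε⌉₊])) := 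
  ⟨DTTest.testerCode, 40, 200000, 5, fun _ _ _ _ hε h1 hw D f =>
    DTTest.testerCode_correct le_rfl hε h1 hw D f⟩
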